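/- **Setting.** Let $\Gamma=(m_{i,j})_{i,j\in I}$ be a Coxeter matrix of small type ($m_{i,j}\in\{1,2,3\}$) over a finite set $I$, with Coxeter group $W$ (generators $s_i$) and Artin–Tits monoid $B^+$ (generators $\mathbf s_i$). Let $W$ act on $E=\bigoplus_{i\in I}\mathbb R\alpha_i$ by $s_i(\beta)=\beta-(\beta|\alpha_i)\alpha_i$, where $(\alpha_i|\alpha_j)=-2\cos(\pi/m_{i,j})$; let $\Phi=\{w(\alpha_i)\mid w\in W,\ i\in I\}$, let $\Phi^+$ be the set of positive roots, $\Phi^-=-\Phi^+$, and $\mathrm{dep}(\alpha)=\min\{\ell(w)\mid w\in W,\ w(\alpha)\in\Phi^-\}$ for $\alpha\in\Phi^+$. Let $R$ be a commutative ring, $b,c,d\in R^\times$, $a=d-\frac{bc}{d}$, and let $V$ be the free $R$-module with basis $(e_\alpha)_{\alpha\in\Phi^+}$. For $i\in I$ let $\varphi_i\in\mathscr L(V)$ be given by $$\varphi_i(e_\alpha)=\begin{cases}0&\text{if }\alpha=\alpha_i,\\ d\,e_\alpha&\text{if }s_i(\alpha)=\alpha,\\ a\,e_\alpha+c\,e_{s_i(\alpha)}&\text{if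 }\alpha\ne\alpha_i\text{ and }\mathrm{dep}(s_i(\alpha))>\mathrm{dep}(\alpha),\\ b\,e_{s_i(\alpha)}&\text{if }\alpha\neq\alpha_i\text{ and }\mathrm{dep}(s_i(\alpha))<\mathrm{dep}(\alpha).\end{cases}$$ An *LK-family* (relative to $(b,c,d)$) is a family $(f_i)_{i\in I}$ of linear forms on $V$ such that $f_i(e_{\alpha_j})=0$ for $i\ne j$, $f_i\varphi_j=d f_i$ if $m_{i,j}=2$, and $f_i\varphi_j=f_j\varphi_i$ if $m_{i,j}=3$. Put $f_{i,\alpha}=f_i(e_\alpha)$. The LK-representation $\psi:B^+\to\mathscr L(V)$ is then defined by $\psi_{\mathbf s_i}(v)=\varphi_i(v)+f_i(v)e_{\alpha_i}$. Let $G$ be a group of automorphisms of $\Gamma$, acting on $I$, $B^+$, $\Phi^+$ and, by permutation of the basis, on $V$, and assume that $f_{i,\alpha}=f_{g(i),g(\alpha)}$ for all $g\in G$, $i\in I$, $\alpha\in\Phi^+$. Then $\psi_x$ stabilizes $V^G$ for every $x\in(B^+)^G$, so that the twisted LK-representation $\psi^G:(B^+)^G\to\mathscr L(V^G)$, $\psi^G_x=\psi_x|_{V^G}$,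 is defined. Let $\Gamma'$ be the Coxeter matrix indexed by the spherical orbits $J$ of $I$ under $G$ (those for which the subgroup of $W$ generated by the $s_j$, $j\in J$, is finite), whose entry $m'_{J,K}$ for $J\neq K$ is the least $m\ge2$ such that $\Delta_J\Delta_K\Delta_J\cdots=\Delta_K\Delta_J\Delta_K\cdots$ in $B^+$ ($m$ factors on each side), and $\infty$ if there is none; here $\Delta_J$ is the right lcm of the $\mathbf s_j$, $j\in J$, in $B^+$. (The monoid $(B^+)^G$ is the Artin–Tits monoid of $\Gamma'$ with standard generators the $\Delta_J$.) Let $B_{\Gamma'}$ be the Artin–Tits group of $\Gamma'$; $\Gamma'$ is called spherical if its Coxeter group is finite. A totally ordered ring is understood to be non-trivial and such that products of positive elements are positive. **Theorem.** 1. (Twisted faithfulness criterion) Assume that $\mathrm{Im}(\psi^G)$ is a left cancellative submonoid of $\mathscr L(V^G)$ and that there are a totally ordered commutative ring $R_0$ and a ring homomorphism $R\to R_0$ that maps $a,b,c,d$ to positive elements and every $f_{i,\alpha}$, $(i,\alpha)\in I\times\Phi^+$, to $0$. Then $\psi^G$ is faithful. 2. (Typical situation) Let $R=R_0[x]$ for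 a totally ordered commutative ring $R_0$, let $b,c,d$ be positive units of $R_0$ with $bc<d^2$, and assume moreover that $\mathrm{Im}(f_i)\subseteq xR$ and $f_i(e_{\alpha_i})\neq0$ for all $i\in I$. Then $\psi^G$ is faithful. Furthermore, let $R'$ be any commutative overring of $R$ in which all the $f_i(e_{\alpha_i})$ are units, and let $V'$ and $\psi'$ be the module and the LK-representation over $R'$ obtained from $V$ and $\psi$ by extension of scalars. Then $\Delta_J\mapsto\psi'_{\Delta_J}|_{(V')^G}$ ($J$ a spherical orbit) defines a group homomorphism $\psi^G_{\mathrm{gr}}:B_{\Gamma'}\to\mathrm{GL}((V')^G)$, and if $\Gamma'$ is spherical, then $\psi^G_{\mathrm{gr}}$ is faithful. -/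

import Mathlib

noncomputable section

/-- The alternating product `a * b * a * ⋯` with `n` factors, starting with `a`. -/
def altProd {N : Type*} [Monoid N] (a b : N) : ℕ → N
  | 0 => 1
  | n + 1 => a * altProd b a n

theorem map_altProd {N P : Type*} [Monoid N] [Monoid P] (h : N →* P) (a b : N) (n : ℕ) :
    h (altProd a b n) = altProd (h a) (h b) n := by
  induction n generalizing a b with
  | zero => simp [altProd]
  | succ n ih => simp [altProd, ih]

namespace CoxeterMatrix

/-! In Mathlib's `CoxeterMatrix`, the entry `0` stands for `∞`. -/

section Artin

variable {I : Type*} (M : CoxeterMatrix I)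

/-- The braid relations `s_i s_j s_i ⋯ = s_j s_i s_j ⋯` (`m_{i,j}` factors), `m_{i,j} ≠ ∞`. -/
inductive BraidRel : FreeMonoid I → FreeMonoid I → Prop
  | braid (i j : I) (h : M i j ≠ 0) :
      BraidRel (altProd (FreeMonoid.of i) (FreeMonoid.of j) (M i j))
        (altProd (FreeMonoid.of j) (FreeMonoid.of i) (M i j))

/-- The Artin-Tits monoid `B⁺` of a Coxeter matrix. -/
abbrev ArtinMonoid : Type _ := PresentedMonoid M.BraidRel

/-- The standard generator `s_i` of the Artin-Tits monoid. -/
def artinGen (i : I) : M.ArtinMonoid := PresentedMonoid.of M.BraidRel i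

/-- The Artin-Tits group `B` of a Coxeter matrix. -/
abbrev ArtinGroup : Type _ :=
  PresentedGroup {r : FreeGroup I | ∃ i j : I, M i j ≠ 0 ∧
    r = altProd (FreeGroup.of i) (FreeGroup.of j) (M i j) *
      (altProd (FreeGroup.of j) (FreeGroup.of i) (M i j))⁻¹}

/-- The standard generator `s_i` of the Artin-Tits group. -/
def artinGroupGen (i : I) : M.ArtinGroup := PresentedGroup.of i

/-- A Coxeter matrix is of small type if all its entries are `1`, `2` or `3`. -/
def IsSmallType : Prop := ∀ i j : I, M i j = 1 ∨ M i j = 2 ∨ M i j = 3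

/-- A Coxeter matrix is spherical if its Coxeter group is finite. -/
def IsSpherical : Prop := Finite M.Group

/-- A subset `J` of `I` is spherical if the standard parabolic subgroup `W_J` is finite. -/
def IsSphericalSubset (J : Set I) : Prop := Finite (Subgroup.closure (M.simple '' J))

/-- `D` is a right lcm of the generators `s_j`, `j ∈ J`, in `B⁺`. (In a monoid, `x ∣ y` is the
left divisibility `∃ z, y = x * z`.) -/
def IsGarside (J : Set I) (D : M.ArtinMonoid) : Prop :=
  (∀ j ∈ J, M.artinGen j ∣ D) ∧ ∀ x, (∀ j ∈ J, M.artinGen j ∣ x) → D ∣ x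

open Classical in
/-- The Garside element `Δ_J`, the right lcm of the `s_j`, `j ∈ J`. It exists (and is unique)
exactly when `J` is spherical; the value is only used for such `J`. -/
def garside (J : Set I) : M.ArtinMonoid :=
  if h : ∃ D, M.IsGarside J D then h.choose else 1

/-- The group `Aut(Γ)` of automorphisms of the Coxeter matrix. -/
def graphAut : Subgroup (Equiv.Perm I) where
  carrier := {g | ∀ i j, M (g i) (g j) = M i j}
  one_mem' := fun _ _ => rfl
  mul_mem' := by
    intro g h hg hh i j
    simp only [Set.mem_ofPred_eq, Equiv.Perm.coe_mul, Function.comp_apply] at *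
    rw [hg, hh]
  inv_mem' := by
    intro g hg i j
    have := hg (g⁻¹ i) (g⁻¹ j)
    simpa using this.symm

/-- The action of a graph automorphism on `B⁺`, `s_i ↦ s_{g(i)}`. -/
def artinMap (g : M.graphAut) : M.ArtinMonoid →* M.ArtinMonoid :=
  PresentedMonoid.lift (fun i => M.artinGen (g.1 i)) (by
    rintro _ _ ⟨i, j, h⟩
    rw [map_altProd, map_altProd, FreeMonoid.lift_eval_of, FreeMonoid.lift_eval_of]
    have hm : M (g.1 i) (g.1 j) = M i j := g.2 i j
    have key := PresentedMonoid.mk_eq_mk_of_rel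
      (BraidRel.braid (M := M) (g.1 i) (g.1 j) (by rwa [hm]))
    rw [hm] at key
    have e := fun a b => map_altProd (PresentedMonoid.mk M.BraidRel) (FreeMonoid.of (g.1 a))
      (FreeMonoid.of (g.1 b)) (M i j)
    rw [e, e] at key
    exact key)

variable (G : Subgroup M.graphAut)

/-- The submonoid `(B⁺)^G` of fixed points. -/
def fixedMonoid : Submonoid M.ArtinMonoid where
  carrier := {x | ∀ g ∈ G, M.artinMap g x = x}
  one_mem' := fun _ _ => map_one _
  mul_mem' := by
    intro x y hx hy g hg
    rw [map_mul, hx g hg, hy g hg]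

/-- The spherical orbits of `I` under `G`. -/
abbrev SphericalOrbit : Type _ :=
  {J : Set I // (∃ i, J = MulAction.orbit G i) ∧ M.IsSphericalSubset J}

open Classical in
/-- The Coxeter matrix `Γ'`, indexed by the spherical orbits of `I` under `G`, for which `(B⁺)^G`
is the Artin-Tits monoid with standard generators the `Δ_J`: for `J ≠ K`, the entry `m'_{J,K}` is
the least `m ≥ 2` such that `Δ_J Δ_K Δ_J ⋯ = Δ_K Δ_J Δ_K ⋯` (`m` factors on both sides), and it is
`∞` (that is, `0 = sInf ∅`) if there is no such `m`. -/
def fixedMatrix : CoxeterMatrix (M.SphericalOrbit G) where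
  M := Matrix.of fun J K =>
    if J = K then 1 else
      sInf {m : ℕ | 2 ≤ m ∧
        altProd (M.garside J.1) (M.garside K.1) m = altProd (M.garside K.1) (M.garside J.1) m}
  isSymm := by
    ext J K
    simp only [Matrix.transpose_apply, Matrix.of_apply, eq_comm]
  diagonal := by simp
  off_diagonal := by
    intro J K hJK h
    rw [Matrix.of_apply, if_neg hJK] at h
    have h2 := Nat.sInf_mem (Nat.nonempty_of_sInf_eq_succ h)
    rw [h] at h2
    exact absurd h2.1 (by norm_num)

end Artin

section Roots

variable {I : Type*} [Fintype I] [DecidableEq I] (M : CoxeterMatrix I)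

/-- The bilinear form on `E = ⨁ ℝ α_i` with `(α_i | α_j) = -2 cos (π / m_{i,j})`. If
`m_{i,j} = ∞`, encoded as `0`, then `π / 0 = 0` gives the right value `-2`. -/
def rootForm : LinearMap.BilinForm ℝ (I → ℝ) :=
  Matrix.toBilin' (Matrix.of fun i j => -2 * Real.cos (Real.pi / (M i j : ℝ)))

/-- The basis vector `α_i` of `E`. -/
def simpleVec (i : I) : I → ℝ := Pi.single i 1

/-- The action of the generator `s_i` of `W` on `E`. -/
def refl (i : I) (v : I → ℝ) : I → ℝ := v - M.rootForm v (simpleVec i) • simpleVec i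

/-- The action on `E` of the element of `W` represented by a word in the generators. -/
def wordAct (l : List I) (v : I → ℝ) : I → ℝ := l.foldr M.refl v

/-- The standard root system `Φ = {w(α_i)}`. -/
def roots : Set (I → ℝ) := {v | ∃ (l : List I) (i : I), v = M.wordAct l (simpleVec i)}

/-- The set `Φ⁺` of positive roots. -/
def posRoots : Set (I → ℝ) := {v | v ∈ M.roots ∧ ∀ i, 0 ≤ v i}

/-- The type of positive roots. -/
abbrev PosRoot : Type _ := {v : I → ℝ // v ∈ M.posRoots}

/-- The depth `min {ℓ(w) | w ∈ W, w(v) ∈ Φ⁻}`, with `Φ⁻ = -Φ⁺`. As `ℓ(w)` is the least length of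
a word that represents `w`, this is a minimum over words. -/
def depth (v : I → ℝ) : ℕ :=
  sInf {n | ∃ l : List I, l.length = n ∧ -(M.wordAct l v) ∈ M.posRoots}

/-- The simple root `α_i` as a positive root. -/
def simpleRoot (i : I) : M.PosRoot :=
  ⟨simpleVec i, ⟨[], i, rfl⟩, fun j => by
    unfold simpleVec
    by_cases h : j = i
    · subst h; simp
    · simp [h]⟩

theorem rootForm_comp (g : M.graphAut) (v w : I → ℝ) :
    M.rootForm (v ∘ ⇑(g.1⁻¹)) (w ∘ ⇑(g.1⁻¹)) = M.rootForm v w := by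
  simp only [rootForm, Matrix.toBilin'_apply, Matrix.of_apply, Function.comp_apply]
  rw [← Equiv.sum_comp g.1]
  refine Finset.sum_congr rfl fun i _ => ?_
  rw [← Equiv.sum_comp g.1]
  refine Finset.sum_congr rfl fun j _ => ?_
  have hm : M (g.1 i) (g.1 j) = M i j := g.2 i j
  simp [hm]

theorem simpleVec_comp (g : M.graphAut) (i : I) :
    simpleVec i ∘ ⇑(g.1⁻¹) = simpleVec (g.1 i) := by
  ext j
  simp only [simpleVec, Function.comp_apply, Pi.single_apply]
  refine if_congr ?_ rfl rfl
  rw [Equiv.Perm.inv_eq_iff_eq]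

theorem wordAct_comp (g : M.graphAut) (l : List I) (v : I → ℝ) :
    M.wordAct l v ∘ ⇑(g.1⁻¹) = M.wordAct (l.map g.1) (v ∘ ⇑(g.1⁻¹)) := by
  induction l with
  | nil => rfl
  | cons i l ih =>
    change M.refl i (M.wordAct l v) ∘ ⇑(g.1⁻¹) =
      M.refl (g.1 i) (M.wordAct (l.map g.1) (v ∘ ⇑(g.1⁻¹)))
    rw [← ih]
    unfold refl
    rw [← M.simpleVec_comp g i, rootForm_comp]
    rfl

/-- The action of a graph automorphism on `Φ⁺`, induced by the permutation `α_i ↦ α_{g(i)}` of the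
basis of `E`. -/
def rootMap (g : M.graphAut) (α : M.PosRoot) : M.PosRoot :=
  ⟨α.1 ∘ ⇑(g.1⁻¹), by
    obtain ⟨v, ⟨l, i, rfl⟩, hv⟩ := α
    refine ⟨⟨l.map g.1, g.1 i, ?_⟩, fun j => hv _⟩
    rw [← M.simpleVec_comp g i, wordAct_comp]⟩

end Roots

section LK

variable {I : Type*} [Fintype I] [DecidableEq I] (M : CoxeterMatrix I)
variable (R : Type*) [CommRing R]

/-- The free `R`-module `V` with basis `(e_α)` indexed by `Φ⁺`. -/
abbrev LKModule : Type _ := M.PosRoot →₀ R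

variable {R}

/-- The basis vector `e_α` of `V`. -/
def basisVec (α : M.PosRoot) : M.LKModule R := Finsupp.single α 1

/-- The parameter `a = d - bc/d`. -/
def lkParam (b c d : Rˣ) : R := (d : R) - (b : R) * (c : R) * ((d⁻¹ : Rˣ) : R)

open Classical in
/-- The image `φ_i(e_α)`. It is `0` if `α = α_i`, `d e_α` if `s_i(α) = α`, `a e_α + c e_{s_i(α)}`
if `s_i(α)` has greater depth than `α`, and `b e_{s_i(α)}` if it has smaller depth. (The last
`0` is never reached: `s_i` permutes `Φ⁺ \ {α_i}`.) -/
def phiVec (b c d : Rˣ) (i : I) (α : M.PosRoot) : M.LKModule R :=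
  if α = M.simpleRoot i then 0
  else if h : M.refl i α.1 ∈ M.posRoots then
    if M.refl i α.1 = α.1 then (d : R) • M.basisVec α
    else if M.depth α.1 < M.depth (M.refl i α.1) then
      lkParam b c d • M.basisVec α + (c : R) • M.basisVec ⟨M.refl i α.1, h⟩
    else (b : R) • M.basisVec ⟨M.refl i α.1, h⟩
  else 0

/-- The endomorphism `φ_i` of `V`. -/
def phi (b c d : Rˣ) (i : I) : Module.End R (M.LKModule R) :=
  Finsupp.linearCombination R (M.phiVec b c d i)

/-- LK-families `(f_i)` relative to `(b, c, d)`. -/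
structure IsLKFamily (b c d : Rˣ) (f : I → Module.Dual R (M.LKModule R)) : Prop where
  apply_simple : ∀ i j, i ≠ j → f i (M.basisVec (M.simpleRoot j)) = 0
  comp_two : ∀ i j, M i j = 2 → f i ∘ₗ M.phi b c d j = (d : R) • f i
  comp_three : ∀ i j, M i j = 3 → f i ∘ₗ M.phi b c d j = f j ∘ₗ M.phi b c d i

/-- The endomorphism `ψ_i = φ_i + f_i ⊠ e_{α_i}` of `V`. -/
def psi (b c d : Rˣ) (f : I → Module.Dual R (M.LKModule R)) (i : I) :
    Module.End R (M.LKModule R) :=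
  M.phi b c d i + (f i).smulRight (M.basisVec (M.simpleRoot i))

/-- `ψ` is the LK-representation of `B⁺`, that is, the (unique) representation with
`s_i ↦ ψ_i`. -/
def IsLKRep (b c d : Rˣ) (f : I → Module.Dual R (M.LKModule R))
    (ψ : M.ArtinMonoid →* Module.End R (M.LKModule R)) : Prop :=
  ∀ i, ψ (M.artinGen i) = M.psi b c d f i

variable (G : Subgroup M.graphAut)

/-- The family satisfies `f_{i,α} = f_{g(i),g(α)}` for all `g ∈ G`. -/
def IsInvariantFamily (f : I → Module.Dual R (M.LKModule R)) : Prop :=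
  ∀ g ∈ G, ∀ (i : I) (α : M.PosRoot),
    f i (M.basisVec α) = f (g.1 i) (M.basisVec (M.rootMap g α))

variable (R) in
/-- The submodule `V^G` of fixed points, `G` acting by permutation of the basis `(e_α)`. -/
def fixedModule : Submodule R (M.LKModule R) where
  carrier := {v | ∀ g ∈ G, Finsupp.lmapDomain R R (M.rootMap g) v = v}
  zero_mem' := fun _ _ => map_zero _
  add_mem' := by
    intro v w hv hw g hg
    rw [map_add, hv g hg, hw g hg]
  smul_mem' := by
    intro r v hv g hg
    rw [map_smul, hv g hg]

/-- `ρ` is the representation `ψ^G` of `(B⁺)^G` on `V^G`, `ψ^G_x = ψ_x|_{V^G}`. -/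
def IsTwistedRep (ψ : M.ArtinMonoid →* Module.End R (M.LKModule R))
    (ρ : M.fixedMonoid G →* Module.End R (M.fixedModule R G)) : Prop :=
  ∀ (x : M.fixedMonoid G) (v : M.fixedModule R G), (ρ x v : M.LKModule R) = ψ x v

/-- `ρ` is the representation `ψ^G_gr` of the group `B_{Γ'}` on `V^G` induced by `ψ^G`: the
standard generator of index `J` acts as the restriction of `ψ_{Δ_J}` to `V^G`. -/
def IsTwistedGroupRep (ψ : M.ArtinMonoid →* Module.End R (M.LKModule R))
    (ρ : (M.fixedMatrix G).ArtinGroup →* LinearMap.GeneralLinearGroup R (M.fixedModule R G)) :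
    Prop :=
  ∀ (J : M.SphericalOrbit G) (v : M.fixedModule R G),
    (((ρ ((M.fixedMatrix G).artinGroupGen J) : Module.End R (M.fixedModule R G)) v :
      M.fixedModule R G) : M.LKModule R) = ψ (M.garside J.1) v

/-- A unit of `R` as a constant unit of `R[X]`. -/
def constUnit (u : Rˣ) : (Polynomial R)ˣ :=
  Units.map ((Polynomial.C : R →+* Polynomial R) : R →* Polynomial R) u

/-- The image in `S` of a unit of `R`. -/
def extendUnit (S : Type*) [CommRing S] [Algebra R S] (u : Rˣ) : Sˣ :=
  Units.map (algebraMap R S : R →* S) u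

/-- Extension of scalars of a family of linear forms: `f'_{i,α}` is the image of `f_{i,α}`. -/
def extendFamily (S : Type*) [CommRing S] [Algebra R S]
    (f : I → Module.Dual R (M.LKModule R)) : I → Module.Dual S (M.LKModule S) :=
  fun i => Finsupp.linearCombination S fun α => algebraMap R S (f i (M.basisVec α))

end LK

end CoxeterMatrix

end

set_option linter.unusedSectionVars false

namespace CoxeterMatrix

/-! Divisibility in `B⁺` is read off a positive specialisation. After base change to the ordered
ring `R₀` the forms `f_i` vanish and `ψ` becomes `φ`, whose matrix entries are nonnegative. Every
vector in the image of `φ_i` has coordinate zero along `α_i`. Conversely, if all values of `φ_y`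
have coordinate zero along `α_i`, positivity forces `s_i ∣ y` (`gen_dvd_of_phiRep_apply_eq_zero`).

An equality `ψ^G_x = ψ^G_y` can be tested on invariant vectors only, but the sum of the `g e_v` over
`g ∈ G` is invariant, and nonnegative terms cannot cancel, so it detects as much as `e_v`. Hence `x`
and `y` are divisible by the same generators. Being fixed by `G`, both are divisible by the Garside
element of a common orbit. This factor is cancelled in the image, and induction on the length
concludes (`twisted_injective`).

Over `R₀[X]` the specialisation is evaluation at `0`. The quadratic relation `phi_phi` shows that
`ψ_i` is injective when `f_i(e_{α_i})` is not a zero divisor, which makes the image left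
cancellative, and bijective when it is a unit, which gives the group representation.

If `Γ'` is spherical, unions of spherical orbits have Garside elements, and that of `J ∪ K` is the
alternating product of `Δ_J` and `Δ_K` with `m'_{J,K}` factors (`altProd_fixedMatrix_eq`). Therefore
words in the `Δ_J` that agree in `(B⁺)^G` agree in `B_{Γ'}` (`wordGroup_eq_of_wordFixed_eq`), and
every element of `B_{Γ'}` is a fraction of two words (`exists_fraction`). Faithfulness passes from
the monoid to the group. -/

theorem IsSmallType.cases {I : Type*} {M : CoxeterMatrix I} (hM : M.IsSmallType) (i j : I) :
    i = j ∨ (i ≠ j ∧ M i j = 2 ∧ M j i = 2) ∨ (i ≠ j ∧ M i j = 3 ∧ M j i = 3) := by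
  by_cases hij : i = j
  · exact Or.inl hij
  · rcases hM i j with h | h | h
    · exact absurd h (M.off_diagonal i j hij)
    · exact Or.inr (Or.inl ⟨hij, h, by rw [M.symmetric j i, h]⟩)
    · exact Or.inr (Or.inr ⟨hij, h, by rw [M.symmetric j i, h]⟩)

/-! ### The geometric representation and the signs of roots. -/

section RootSystem

variable {I : Type*} [Fintype I] [DecidableEq I] (M : CoxeterMatrix I)

theorem rootForm_simpleVec (i j : I) :
    M.rootForm (simpleVec i) (simpleVec j) = -2 * Real.cos (Real.pi / (M i j : ℝ)) := by
  simp [rootForm, simpleVec, Matrix.toBilin'_single]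

theorem rootForm_comm (v w : I → ℝ) : M.rootForm v w = M.rootForm w v := by
  simp only [rootForm, Matrix.toBilin'_apply, Matrix.of_apply]
  rw [Finset.sum_comm]
  refine Finset.sum_congr rfl fun i _ => Finset.sum_congr rfl fun j _ => ?_
  rw [M.symmetric j i]
  ring

theorem rootForm_self (i : I) : M.rootForm (simpleVec i) (simpleVec i) = 2 := by
  rw [rootForm_simpleVec]
  simp

theorem rootForm_two {i j : I} (h : M i j = 2) :
    M.rootForm (simpleVec i) (simpleVec j) = 0 := by
  rw [rootForm_simpleVec, h]
  simp

theorem rootForm_three {i j : I} (h : M i j = 3) :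
    M.rootForm (simpleVec i) (simpleVec j) = -1 := by
  rw [rootForm_simpleVec, h]
  simp

theorem simpleVec_nonneg (i : I) : 0 ≤ (simpleVec i : I → ℝ) :=
  Pi.single_nonneg.2 zero_le_one

theorem simpleVec_self (i : I) : (simpleVec i : I → ℝ) i = 1 := by simp [simpleVec]

theorem simpleVec_of_ne {i j : I} (h : j ≠ i) : (simpleVec i : I → ℝ) j = 0 := by
  simp [simpleVec, h]

theorem simpleVec_injective : Function.Injective (simpleVec : I → I → ℝ) := by
  intro i j h
  by_contra hij
  have := congrFun h i
  rw [simpleVec_self, simpleVec_of_ne hij] at this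
  exact one_ne_zero this

/-- The reflection `M.refl i` as a linear map. -/
noncomputable def reflLin (i : I) : Module.End ℝ (I → ℝ) :=
  LinearMap.id - (M.rootForm.flip (simpleVec i)).smulRight (simpleVec i)

theorem reflLin_apply (i : I) (v : I → ℝ) : M.reflLin i v = M.refl i v := rfl

theorem refl_def (i : I) (v : I → ℝ) :
    M.refl i v = v - M.rootForm v (simpleVec i) • simpleVec i := rfl

theorem refl_apply_of_ne {i k : I} (h : k ≠ i) (v : I → ℝ) : M.refl i v k = v k := by
  simp [refl_def, simpleVec_of_ne h]

theorem rootForm_refl (i : I) (v w : I → ℝ) :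
    M.rootForm (M.refl i v) w =
      M.rootForm v w - M.rootForm v (simpleVec i) * M.rootForm (simpleVec i) w := by
  simp [refl_def]

theorem rootForm_refl_self (i : I) (v : I → ℝ) :
    M.rootForm (M.refl i v) (simpleVec i) = -M.rootForm v (simpleVec i) := by
  rw [rootForm_refl, rootForm_self]
  ring

theorem refl_refl (i : I) (v : I → ℝ) : M.refl i (M.refl i v) = v := by
  rw [refl_def M i (M.refl i v), rootForm_refl_self, refl_def]
  module

theorem rootForm_refl_refl (i : I) (v w : I → ℝ) :
    M.rootForm (M.refl i v) (M.refl i w) = M.rootForm v w := by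
  rw [rootForm_refl, M.rootForm_comm v, M.rootForm_comm (simpleVec i), rootForm_refl,
    rootForm_refl, rootForm_self, M.rootForm_comm w v, M.rootForm_comm (simpleVec i) v]
  ring

theorem refl_simpleVec_self (i : I) : M.refl i (simpleVec i) = -simpleVec i := by
  rw [refl_def, rootForm_self]
  module

theorem refl_eq_self_iff (i : I) (v : I → ℝ) :
    M.refl i v = v ↔ M.rootForm v (simpleVec i) = 0 := by
  rw [refl_def, sub_eq_self, smul_eq_zero, or_iff_left]
  intro h
  have := congrFun h i
  rw [simpleVec_self] at this
  exact one_ne_zero this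

theorem refl_comm_of_two {i j : I} (h : M i j = 2) (v : I → ℝ) :
    M.refl i (M.refl j v) = M.refl j (M.refl i v) := by
  have h' : M j i = 2 := by rw [M.symmetric j i, h]
  simp only [refl_def, map_sub, map_smul, LinearMap.sub_apply, LinearMap.smul_apply,
    M.rootForm_two h, M.rootForm_two h', smul_eq_mul]
  module

theorem refl_braid_of_three {i j : I} (h : M i j = 3) (v : I → ℝ) :
    M.refl i (M.refl j (M.refl i v)) = M.refl j (M.refl i (M.refl j v)) := by
  have h' : M j i = 3 := by rw [M.symmetric j i, h]
  simp only [refl_def, map_sub, map_smul, LinearMap.sub_apply, LinearMap.smul_apply,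
    M.rootForm_three h, M.rootForm_three h', smul_eq_mul, rootForm_self]
  module

theorem isLiftable_reflLin (hM : M.IsSmallType) : M.IsLiftable M.reflLin := by
  have hs : ∀ i, M.reflLin i * M.reflLin i = 1 := fun i =>
    LinearMap.ext fun v => M.refl_refl i v
  intro i j
  rcases hM.cases i j with rfl | ⟨-, h, -⟩ | ⟨-, h, -⟩
  · rw [M.diagonal, pow_one, hs]
  · have hc : M.reflLin i * M.reflLin j = M.reflLin j * M.reflLin i :=
      LinearMap.ext fun v => M.refl_comm_of_two h v
    rw [h, pow_two]
    nth_rewrite 2 [hc]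
    rw [mul_assoc, ← mul_assoc (M.reflLin j), hs, one_mul, hs]
  · have hc : M.reflLin i * M.reflLin j * M.reflLin i = M.reflLin j * M.reflLin i * M.reflLin j :=
      LinearMap.ext fun v => M.refl_braid_of_three h v
    have : (M.reflLin i * M.reflLin j) ^ 3 = M.reflLin i * M.reflLin j * M.reflLin i *
      (M.reflLin j * M.reflLin i * M.reflLin j) := by noncomm_ring
    rw [h, this, ← hc]
    simp only [mul_assoc]
    rw [← mul_assoc (M.reflLin i) (M.reflLin i), hs, one_mul, ← mul_assoc (M.reflLin j), hs,
      one_mul, hs]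

/-- The length function of the Coxeter group. -/
noncomputable abbrev len (w : M.Group) : ℕ := M.toCoxeterSystem.length w

variable {M}

/-- The geometric representation of the Coxeter group. -/
noncomputable def act (hM : M.IsSmallType) : M.Group →* Module.End ℝ (I → ℝ) :=
  M.toCoxeterSystem.lift ⟨M.reflLin, M.isLiftable_reflLin hM⟩

variable (hM : M.IsSmallType)

theorem act_simple (i : I) : act hM (M.simple i) = M.reflLin i :=
  M.toCoxeterSystem.lift_apply_simple (M.isLiftable_reflLin hM) i

theorem act_simple_apply (i : I) (v : I → ℝ) : act hM (M.simple i) v = M.refl i v := by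
  rw [act_simple, reflLin_apply]

theorem act_mul_apply (w w' : M.Group) (v : I → ℝ) :
    act hM (w * w') v = act hM w (act hM w' v) := by
  rw [map_mul, Module.End.mul_apply]

theorem act_one_apply (v : I → ℝ) : act hM 1 v = v := by
  rw [map_one, Module.End.one_apply]

theorem act_inv_act (w : M.Group) (v : I → ℝ) : act hM w⁻¹ (act hM w v) = v := by
  rw [← act_mul_apply, inv_mul_cancel, act_one_apply]

theorem act_act_inv (w : M.Group) (v : I → ℝ) : act hM w (act hM w⁻¹ v) = v := by
  rw [← act_mul_apply, mul_inv_cancel, act_one_apply]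

theorem act_wordProd (l : List I) (v : I → ℝ) :
    act hM (M.toCoxeterSystem.wordProd l) v = M.wordAct l v := by
  induction l with
  | nil => simp [wordAct]
  | cons i l ih =>
    rw [CoxeterSystem.wordProd_cons, act_mul_apply, ih]
    exact act_simple_apply hM i _

theorem mem_roots_iff (v : I → ℝ) :
    v ∈ M.roots ↔ ∃ w i, v = act hM w (simpleVec i) := by
  constructor
  · rintro ⟨l, i, rfl⟩
    exact ⟨_, i, (act_wordProd hM l _).symm⟩
  · rintro ⟨w, i, rfl⟩
    obtain ⟨l, rfl⟩ := M.toCoxeterSystem.wordProd_surjective w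
    exact ⟨l, i, act_wordProd hM l _⟩

theorem act_mem_roots (w : M.Group) {v : I → ℝ} (hv : v ∈ M.roots) : act hM w v ∈ M.roots := by
  rw [mem_roots_iff hM] at hv ⊢
  obtain ⟨u, i, rfl⟩ := hv
  exact ⟨w * u, i, (act_mul_apply hM w u _).symm⟩

theorem rootForm_act (w : M.Group) (u v : I → ℝ) :
    M.rootForm (act hM w u) (act hM w v) = M.rootForm u v := by
  obtain ⟨l, rfl⟩ := M.toCoxeterSystem.wordProd_surjective w
  rw [act_wordProd, act_wordProd]
  induction l with
  | nil => rfl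
  | cons i l ih => exact (M.rootForm_refl_refl i _ _).trans ih

include hM in
theorem rootForm_self_of_mem_roots {v : I → ℝ} (hv : v ∈ M.roots) : M.rootForm v v = 2 := by
  obtain ⟨w, i, rfl⟩ := (mem_roots_iff hM v).1 hv
  rw [rootForm_act, rootForm_self]

theorem simple_mul_self (i : I) : M.simple i * M.simple i = 1 :=
  M.toCoxeterSystem.simple_mul_simple_self i

theorem simple_mul_cancel (i : I) (w : M.Group) : M.simple i * (M.simple i * w) = w := by
  rw [← mul_assoc, simple_mul_self, one_mul]

theorem mul_simple_cancel (i : I) (w : M.Group) : w * M.simple i * M.simple i = w := by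
  rw [mul_assoc, simple_mul_self, mul_one]

theorem simple_inv (i : I) : (M.simple i)⁻¹ = M.simple i :=
  M.toCoxeterSystem.inv_simple i

theorem simple_comm_of_two {i j : I} (h : M i j = 2) :
    M.simple i * M.simple j = M.simple j * M.simple i := by
  have h1 : (M.simple i * M.simple j) ^ 2 = 1 := by
    simpa [h] using M.toCoxeterSystem.simple_mul_simple_pow i j
  rw [pow_two, mul_eq_one_iff_eq_inv, mul_inv_rev, simple_inv, simple_inv] at h1
  exact h1

theorem simple_braid_of_three {i j : I} (h : M i j = 3) :
    M.simple i * M.simple j * M.simple i = M.simple j * M.simple i * M.simple j := by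
  have h1 : (M.simple i * M.simple j) ^ 3 = 1 := by
    simpa [h] using M.toCoxeterSystem.simple_mul_simple_pow i j
  have h2 : (M.simple i * M.simple j * M.simple i) * (M.simple j * M.simple i * M.simple j) = 1 := by
    rw [← h1]
    simp only [pow_succ, pow_zero, one_mul, mul_assoc]
  rw [mul_eq_one_iff_eq_inv] at h2
  rw [h2]
  simp only [mul_inv_rev, simple_inv, mul_assoc]

/-- The simple reflection of index `i` is a right descent of `w`. -/
abbrev RightDesc (w : M.Group) (i : I) : Prop := M.toCoxeterSystem.IsRightDescent w i

theorem len_mul_simple_le (w : M.Group) (i : I) : M.len (w * M.simple i) ≤ M.len w + 1 := by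
  rcases M.toCoxeterSystem.length_mul_simple w i with h | h <;>
    simp only [toCoxeterSystem_simple] at h <;> simp only [len] <;> omega

theorem RightDesc.len {w : M.Group} {i : I} (h : RightDesc w i) :
    M.len (w * M.simple i) + 1 = M.len w :=
  M.toCoxeterSystem.isRightDescent_iff.1 h

theorem rightDesc_iff_len {w : M.Group} {i : I} :
    RightDesc w i ↔ M.len (w * M.simple i) < M.len w := Iff.rfl

theorem refl_simpleVec_of_two {i j : I} (h : M i j = 2) :
    M.refl j (simpleVec i) = simpleVec i := by
  rw [refl_def, M.rootForm_two h]
  module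

theorem refl_simpleVec_of_three {i j : I} (h : M i j = 3) :
    M.refl j (simpleVec i) = simpleVec i + simpleVec j := by
  rw [refl_def, M.rootForm_three h]
  module

/-- Induction on the length: for a right descent `t` of `w = v s_t`, `s_t α_i` is `α_i` or `α_i +
α_t`, and `v` is shorter. If `i` is a descent of `v = u s_i`, then `v(α_i + α_t) = u α_t` and the
induction passes to `u`. -/
theorem act_simpleVec_nonneg {w : M.Group} {i : I} (hi : ¬ RightDesc w i) :
    0 ≤ act hM w (simpleVec i) := by
  induction hn : M.len w using Nat.strong_induction_on generalizing w i with
  | _ n ih =>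
    subst hn
    by_cases hw : w = 1
    · rw [hw, act_one_apply]
      exact simpleVec_nonneg i
    obtain ⟨t, ht⟩ := M.toCoxeterSystem.exists_rightDescent_of_ne_one hw
    obtain ⟨v, rfl⟩ : ∃ v, w = v * M.simple t := ⟨_, (mul_simple_cancel t w).symm⟩
    have hl := RightDesc.len ht
    rw [mul_simple_cancel] at hl
    have hvt : ¬ RightDesc v t := by
      rw [rightDesc_iff_len]
      omega
    rw [act_mul_apply, act_simple_apply]
    rw [rightDesc_iff_len, not_lt] at hi
    rcases hM.cases i t with rfl | ⟨-, h, -⟩ | ⟨-, h, -⟩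
    · rw [mul_simple_cancel] at hi
      omega
    · rw [refl_simpleVec_of_two h]
      refine ih _ (by omega) (fun hd => ?_) rfl
      have h1 := hd.len
      have h2 := len_mul_simple_le (v * M.simple i) t
      rw [mul_assoc, ← simple_comm_of_two h, ← mul_assoc] at hi
      omega
    · rw [refl_simpleVec_of_three h, map_add]
      by_cases hd : RightDesc v i
      · obtain ⟨u, rfl⟩ : ∃ u, v = u * M.simple i := ⟨_, (mul_simple_cancel i v).symm⟩
        have h1 := hd.len
        rw [mul_simple_cancel] at h1
        have h3 : M.refl i (simpleVec i + simpleVec t) = simpleVec t := by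
          rw [← refl_simpleVec_of_three h, ← M.refl_refl i (simpleVec t),
            refl_simpleVec_of_three (i := t) (j := i) (by rw [M.symmetric, h]),
            refl_simpleVec_of_three h, add_comm]
        rw [← map_add, act_mul_apply, act_simple_apply, h3]
        -- If `t` were a descent of `u`, then `w s_i = u s_t s_i s_t` would be shorter than `w`.
        refine ih _ (by omega) (fun hd' => ?_) rfl
        have h4 := hd'.len
        have h5 := len_mul_simple_le (u * M.simple t) i
        have h6 := len_mul_simple_le (u * M.simple t * M.simple i) t
        have h7 : u * M.simple i * M.simple t * M.simple i =
            u * M.simple t * M.simple i * M.simple t := by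
          simp only [mul_assoc]
          rw [← mul_assoc (M.simple i), simple_braid_of_three h, mul_assoc]
        rw [h7] at hi
        omega
      · exact add_nonneg (ih _ (by omega) hd rfl) (ih _ (by omega) hvt rfl)

theorem act_simpleVec_nonpos {w : M.Group} {i : I} (hi : RightDesc w i) :
    act hM w (simpleVec i) ≤ 0 := by
  have h := act_simpleVec_nonneg hM (w := w * M.simple i) (i := i) (by
    rw [rightDesc_iff_len, mul_simple_cancel]
    have := hi.len
    omega)
  rwa [act_mul_apply, act_simple_apply, refl_simpleVec_self, map_neg, neg_nonneg] at h

theorem ne_zero_of_mem_roots {v : I → ℝ} (hv : v ∈ M.roots) (hM : M.IsSmallType) : v ≠ 0 := by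
  rintro rfl
  have := rootForm_self_of_mem_roots hM hv
  simp at this

theorem simpleVec_mem_roots (i : I) : (simpleVec i : I → ℝ) ∈ M.roots := ⟨[], i, rfl⟩

theorem act_simpleVec_mem_roots (w : M.Group) (i : I) : act hM w (simpleVec i) ∈ M.roots :=
  act_mem_roots hM w (simpleVec_mem_roots i)

theorem rightDesc_iff {w : M.Group} {i : I} : RightDesc w i ↔ act hM w (simpleVec i) ≤ 0 := by
  refine ⟨act_simpleVec_nonpos hM, fun h => ?_⟩
  by_contra hi
  exact ne_zero_of_mem_roots (act_simpleVec_mem_roots hM w i) hM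
    (le_antisymm h (act_simpleVec_nonneg hM hi))

theorem not_rightDesc_iff {w : M.Group} {i : I} :
    ¬ RightDesc w i ↔ 0 ≤ act hM w (simpleVec i) := by
  refine ⟨act_simpleVec_nonneg hM, fun h hi => ?_⟩
  exact ne_zero_of_mem_roots (act_simpleVec_mem_roots hM w i) hM
    (le_antisymm (act_simpleVec_nonpos hM hi) h)

theorem act_injective : Function.Injective (act hM) := by
  rw [injective_iff_map_eq_one]
  intro w hw
  by_contra h
  obtain ⟨t, ht⟩ := M.toCoxeterSystem.exists_rightDescent_of_ne_one h
  have := act_simpleVec_nonpos hM ht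
  rw [hw, Module.End.one_apply] at this
  have := this t
  rw [simpleVec_self] at this
  exact absurd this (by norm_num)

include hM in
theorem nonneg_or_nonpos_of_mem_roots {v : I → ℝ} (hv : v ∈ M.roots) : 0 ≤ v ∨ v ≤ 0 := by
  obtain ⟨w, i, rfl⟩ := (mem_roots_iff hM v).1 hv
  by_cases h : RightDesc w i
  · exact Or.inr (act_simpleVec_nonpos hM h)
  · exact Or.inl (act_simpleVec_nonneg hM h)

include hM in
theorem neg_mem_roots {v : I → ℝ} (hv : v ∈ M.roots) : -v ∈ M.roots := by
  obtain ⟨w, i, rfl⟩ := (mem_roots_iff hM v).1 hv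
  rw [← map_neg, ← refl_simpleVec_self, ← act_simple_apply hM]
  exact act_mem_roots hM _ (act_simpleVec_mem_roots hM _ i)

include hM in
theorem refl_mem_roots (i : I) {v : I → ℝ} (hv : v ∈ M.roots) : M.refl i v ∈ M.roots := by
  rw [← act_simple_apply hM]
  exact act_mem_roots hM _ hv

theorem simpleVec_mem_posRoots (i : I) : (simpleVec i : I → ℝ) ∈ M.posRoots :=
  (M.simpleRoot i).2

include hM in
/-- A positive root vanishing off `i` is the simple root of index `i`. -/
theorem eq_simpleVec_of_forall_ne {v : I → ℝ} (hv : v ∈ M.posRoots) {i : I}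
    (h : ∀ k, k ≠ i → v k = 0) : v = simpleVec i := by
  have hv' : v = v i • simpleVec i := by
    ext k
    by_cases hk : k = i
    · subst hk
      simp [simpleVec_self]
    · simp [h k hk, simpleVec_of_ne hk]
  have h2 := rootForm_self_of_mem_roots hM hv.1
  -- As `(v|v) = 2 = (α_i|α_i)`, the square of the coefficient is `1`.
  rw [hv', map_smul, map_smul, LinearMap.smul_apply, rootForm_self] at h2
  have h3 : v i = 1 := by
    have h0 : 0 ≤ v i := hv.2 i
    simp only [smul_eq_mul] at h2
    nlinarith
  rw [hv', h3, one_smul]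

include hM in
theorem exists_ne_of_mem_posRoots {v : I → ℝ} (hv : v ∈ M.posRoots) {i : I}
    (h : v ≠ simpleVec i) : ∃ k, k ≠ i ∧ 0 < v k := by
  by_contra! hk
  exact h (eq_simpleVec_of_forall_ne hM hv fun k hki => le_antisymm (hk k hki) (hv.2 k))

include hM in
-- The reflection changes only the coordinate `i`. Another coordinate of `v` is positive and
-- survives, so the image cannot be a negative root.
theorem refl_mem_posRoots {v : I → ℝ} (hv : v ∈ M.posRoots) {i : I} (h : v ≠ simpleVec i) :
    M.refl i v ∈ M.posRoots := by
  refine ⟨refl_mem_roots hM i hv.1, ?_⟩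
  rcases nonneg_or_nonpos_of_mem_roots hM (refl_mem_roots hM i hv.1) with h1 | h1
  · exact h1
  · obtain ⟨k, hk, hk0⟩ := exists_ne_of_mem_posRoots hM hv h
    have := h1 k
    rw [refl_apply_of_ne M hk] at this
    exact absurd this (not_le.2 hk0)

end RootSystem

end CoxeterMatrix

namespace CoxeterMatrix

/-! ### Depth of positive roots. -/

section Depth

variable {I : Type*} [Fintype I] [DecidableEq I] {M : CoxeterMatrix I} (hM : M.IsSmallType)

include hM in
theorem mem_or_neg_mem_posRoots {v : I → ℝ} (hv : v ∈ M.roots) :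
    v ∈ M.posRoots ∨ -v ∈ M.posRoots := by
  rcases nonneg_or_nonpos_of_mem_roots hM hv with h | h
  · exact Or.inl ⟨hv, h⟩
  · exact Or.inr ⟨neg_mem_roots hM hv, fun i => neg_nonneg.2 (h i)⟩

theorem neg_notMem_posRoots (hM : M.IsSmallType) {v : I → ℝ} (hv : v ∈ M.posRoots) :
    -v ∉ M.posRoots := fun h =>
  ne_zero_of_mem_roots hv.1 hM
    (le_antisymm (fun i => neg_nonneg.1 (h.2 i)) (fun i => hv.2 i))

theorem depth_le {w : M.Group} {v : I → ℝ} (h : -(act hM w v) ∈ M.posRoots) :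
    M.depth v ≤ M.len w := by
  obtain ⟨l, hl, rfl⟩ := M.toCoxeterSystem.exists_isReduced w
  rw [act_wordProd] at h
  exact Nat.sInf_le ⟨l, hl.symm, h⟩

theorem exists_len_le_depth {v : I → ℝ} (hv : v ∈ M.posRoots) :
    ∃ w, M.len w ≤ M.depth v ∧ -(act hM w v) ∈ M.posRoots := by
  obtain ⟨u, i, hu⟩ := (mem_roots_iff hM v).1 hv.1
  have hne : {n | ∃ l : List I, l.length = n ∧ -(M.wordAct l v) ∈ M.posRoots}.Nonempty := by
    obtain ⟨l, hl⟩ := M.toCoxeterSystem.wordProd_surjective (M.simple i * u⁻¹)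
    refine ⟨_, l, rfl, ?_⟩
    rw [← act_wordProd hM, hl, act_mul_apply, hu, act_inv_act, act_simple_apply,
      refl_simpleVec_self, neg_neg]
    exact simpleVec_mem_posRoots i
  obtain ⟨l, hl, h⟩ := Nat.sInf_mem hne
  refine ⟨M.toCoxeterSystem.wordProd l, ?_, by rwa [act_wordProd]⟩
  exact (M.toCoxeterSystem.length_wordProd_le l).trans hl.le

/-- Let `w` be of minimal length sending `β = s_i v` to a negative root. If `i` is a right descent
of `w`, the shorter `w s_i` makes `v` negative. Otherwise let `w = s_j u` with `u` shorter.
Minimality forces `u β = α_j`, so `u v = α_j + (v|α_i) u α_i`, which has a negative coordinate; thus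
`u` already makes `v` negative. -/
theorem depth_lt_depth_refl (hM : M.IsSmallType) {v : I → ℝ} (hv : v ∈ M.posRoots) {i : I}
    (h : M.rootForm v (simpleVec i) < 0) : M.depth v < M.depth (M.refl i v) := by
  have hvi : v ≠ simpleVec i := by
    rintro rfl
    rw [rootForm_self] at h
    norm_num at h
  have hβ := refl_mem_posRoots hM hv hvi
  obtain ⟨w, hw, hneg⟩ := exists_len_le_depth hM hβ
  refine lt_of_lt_of_le ?_ hw
  by_cases hd : RightDesc w i
  · have := depth_le hM (w := w * M.simple i) (v := v) (by
      rwa [act_mul_apply, act_simple_apply])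
    have := hd.len
    omega
  have hw1 : w ≠ 1 := by
    rintro rfl
    rw [act_one_apply] at hneg
    exact neg_notMem_posRoots hM hβ hneg
  obtain ⟨j, hj⟩ := M.toCoxeterSystem.exists_leftDescent_of_ne_one hw1
  obtain ⟨u, rfl⟩ : ∃ u, w = M.simple j * u := ⟨_, (simple_mul_cancel j w).symm⟩
  have hl : M.len u + 1 = M.len (M.simple j * u) := by
    have := M.toCoxeterSystem.isLeftDescent_iff.1 hj
    rwa [toCoxeterSystem_simple, simple_mul_cancel] at this
  rw [act_mul_apply, act_simple_apply] at hneg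
  have huβ : act hM u (M.refl i v) = simpleVec j := by
    rcases mem_or_neg_mem_posRoots hM (act_mem_roots hM u hβ.1) with h1 | h1
    · by_contra hne
      exact neg_notMem_posRoots hM (refl_mem_posRoots hM h1 hne) hneg
    · have := depth_le hM h1
      omega
  have hγ : act hM (M.simple j * u) (simpleVec i) ∈ M.posRoots :=
    ⟨act_simpleVec_mem_roots hM _ i, (not_rightDesc_iff hM).1 hd⟩
  rw [act_mul_apply, act_simple_apply] at hγ
  have hγj : M.refl j (act hM u (simpleVec i)) ≠ simpleVec j := by
    intro h1
    have h2 : act hM u (simpleVec i) = act hM u (-(M.refl i v)) := by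
      rw [← M.refl_refl j (act hM u (simpleVec i)), h1, refl_simpleVec_self, map_neg, huβ]
    have h3 := congrArg (act hM u⁻¹) h2
    rw [act_inv_act, act_inv_act] at h3
    exact neg_notMem_posRoots hM hβ (h3 ▸ simpleVec_mem_posRoots i)
  have hui := refl_mem_posRoots hM hγ hγj
  rw [M.refl_refl] at hui
  have huj : act hM u (simpleVec i) ≠ simpleVec j := by
    intro h1
    rw [h1, refl_simpleVec_self] at hγ
    exact neg_notMem_posRoots hM (simpleVec_mem_posRoots j) hγ
  obtain ⟨k, hk, hk0⟩ := exists_ne_of_mem_posRoots hM hui huj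
  have huv : act hM u v = simpleVec j + M.rootForm v (simpleVec i) • act hM u (simpleVec i) := by
    rw [← huβ, refl_def, map_sub, map_smul]
    module
  have huvk : act hM u v k < 0 := by
    rw [huv, Pi.add_apply, simpleVec_of_ne hk, zero_add, Pi.smul_apply, smul_eq_mul]
    exact mul_neg_of_neg_of_pos h hk0
  rcases mem_or_neg_mem_posRoots hM (act_mem_roots hM u hv.1) with h1 | h1
  · exact absurd (h1.2 k) (not_le.2 huvk)
  · have := depth_le hM h1
    omega

/-- This replaces the depth comparisons in `phiVec` by the sign of `(v|α_i)`. -/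
theorem depth_lt_iff (hM : M.IsSmallType) {v : I → ℝ} (hv : v ∈ M.posRoots) {i : I}
    (hvi : v ≠ simpleVec i) :
    M.depth v < M.depth (M.refl i v) ↔ M.rootForm v (simpleVec i) < 0 := by
  refine ⟨fun h => ?_, depth_lt_depth_refl hM hv⟩
  by_contra hn
  rcases (not_lt.1 hn).eq_or_lt with h0 | h0
  · rw [(M.refl_eq_self_iff i v).2 h0.symm] at h
    exact lt_irrefl _ h
  · have := depth_lt_depth_refl hM (refl_mem_posRoots hM hv hvi) (i := i) (by
      rw [rootForm_refl_self]
      linarith)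
    rw [M.refl_refl] at this
    exact lt_asymm h this

end Depth

/-! ### The braid relations for the operators `φ_i`. -/

section Phi

variable {I : Type*} [Fintype I] [DecidableEq I] {M : CoxeterMatrix I} (hM : M.IsSmallType)
variable {R : Type*} [CommRing R] (b c d : Rˣ)

/-- The diagonal coefficient of `φ_i` at a root `v` with `p = (v|α_i)`. -/
noncomputable def diagCoeff (p : ℝ) : R := if p = 0 then d else if p < 0 then lkParam b c d else 0

/-- The off-diagonal coefficient of `φ_i` at a root `v` with `p = (v|α_i)`. -/
noncomputable def offCoeff (p : ℝ) : R := if p = 0 then 0 else if p < 0 then c else b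

variable (M R) in
open Classical in
/-- The basis vector `e_v` for a positive root `v`, and `0` for all other vectors. -/
noncomputable def rootVec (v : I → ℝ) : M.LKModule R :=
  if h : v ∈ M.posRoots then M.basisVec ⟨v, h⟩ else 0

theorem basisVec_eq_rootVec (α : M.PosRoot) : (M.basisVec α : M.LKModule R) = M.rootVec R α.1 := by
  rw [rootVec, dif_pos α.2]

theorem phi_basisVec (i : I) (α : M.PosRoot) :
    M.phi b c d i (M.basisVec α) = M.phiVec b c d i α := by
  simp [phi, basisVec]

theorem phi_simpleVec (i : I) : M.phi b c d i (M.rootVec R (simpleVec i)) = 0 := by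
  have : (M.basisVec (M.simpleRoot i) : M.LKModule R) = M.rootVec R (simpleVec i) :=
    basisVec_eq_rootVec _
  rw [← this, phi_basisVec, phiVec, if_pos rfl]

include hM in
theorem phi_rootVec {i : I} {v : I → ℝ} (hv : v ∈ M.posRoots) (hvi : v ≠ simpleVec i) :
    M.phi b c d i (M.rootVec R v) =
      diagCoeff b c d (M.rootForm v (simpleVec i)) • M.rootVec R v +
        offCoeff b c (M.rootForm v (simpleVec i)) • M.rootVec R (M.refl i v) := by
  have h1 : (⟨v, hv⟩ : M.PosRoot) ≠ M.simpleRoot i := fun h => hvi (congrArg Subtype.val h)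
  have h2 := refl_mem_posRoots hM hv hvi
  rw [rootVec, rootVec, dif_pos hv, dif_pos h2, phi_basisVec, phiVec, if_neg h1, dif_pos h2]
  simp only [depth_lt_iff hM hv hvi, refl_eq_self_iff, diagCoeff, offCoeff]
  split_ifs <;> simp

theorem lkParam_eq : (lkParam b c d : R) * d = d * d - b * c := by
  rw [lkParam, sub_mul, mul_assoc ((b : R) * c), Units.inv_mul, mul_one]

theorem endo_ext {N : Type*} [AddCommGroup N] [Module R N] {f g : M.LKModule R →ₗ[R] N}
    (h : ∀ v ∈ M.posRoots, f (M.rootVec R v) = g (M.rootVec R v)) : f = g := by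
  refine Finsupp.lhom_ext' fun α => LinearMap.ext_ring ?_
  have := h α.1 α.2
  rw [← basisVec_eq_rootVec] at this
  exact this

include hM in
theorem refl_ne_simpleVec {i j : I} {v : I → ℝ} (h : v ≠ M.refl j (simpleVec i)) :
    M.refl j v ≠ simpleVec i := fun h' => h (by rw [← h', M.refl_refl])

include hM in
theorem phi_comm_of_two {i j : I} (hij : i ≠ j) (h : M i j = 2) :
    M.phi b c d i * M.phi b c d j = M.phi b c d j * (M.phi b c d i : Module.End R _) := by
  have h' : M j i = 2 := by rw [M.symmetric j i, h]
  have key : ∀ {i j : I}, i ≠ j → M i j = 2 → M.phi b c d i (M.phi b c d j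
      (M.rootVec R (simpleVec i))) = 0 := by
    intro i j hij h
    rw [phi_rootVec hM b c d (simpleVec_mem_posRoots i) (simpleVec_injective.ne hij),
      refl_simpleVec_of_two h, map_add, map_smul, map_smul, phi_simpleVec]
    simp
  refine endo_ext fun v hv => ?_
  rw [Module.End.mul_apply, Module.End.mul_apply]
  by_cases hi : v = simpleVec i
  · rw [hi, phi_simpleVec, map_zero, key hij h]
  by_cases hj : v = simpleVec j
  · rw [hj, phi_simpleVec, map_zero, key hij.symm h']
  have hi' := refl_mem_posRoots hM hv hi
  have hj' := refl_mem_posRoots hM hv hj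
  have hij' : M.refl i v ≠ simpleVec j := refl_ne_simpleVec hM (by rwa [refl_simpleVec_of_two h'])
  have hji' : M.refl j v ≠ simpleVec i := refl_ne_simpleVec hM (by rwa [refl_simpleVec_of_two h])
  rw [phi_rootVec hM b c d hv hi, phi_rootVec hM b c d hv hj, map_add, map_smul, map_smul,
    map_add, map_smul, map_smul, phi_rootVec hM b c d hv hi, phi_rootVec hM b c d hv hj,
    phi_rootVec hM b c d hi' hij', phi_rootVec hM b c d hj' hji', rootForm_refl, rootForm_refl,
    M.rootForm_two h, M.rootForm_two h', refl_comm_of_two M h]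
  simp only [mul_zero, sub_zero]
  module

/-- With `p = (v|α_i)` and `q = (v|α_j)`, the two sides are the coefficients of `e_{s_i v}` in the
two sides of the braid relation applied to `e_v`. -/
theorem diagCoeff_offCoeff_braid (p q : ℝ) :
    offCoeff b c p * (diagCoeff b c d p * diagCoeff b c d q +
      diagCoeff b c d (p + q) * diagCoeff b c d (-p)) =
    (offCoeff b c p * (diagCoeff b c d q * diagCoeff b c d (p + q)) : R) := by
  unfold offCoeff diagCoeff
  rcases lt_trichotomy p 0 with hp | rfl | hp
  · have hp0 := hp.ne
    rcases lt_or_ge q 0 with hq | hq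
    · have hpq : p + q < 0 := by linarith
      simp [hp, hp0, hp.not_gt, hpq, hpq.ne, hq, hq.ne]
    · rcases hq.eq_or_lt with rfl | hq
      · simp [hp, hp0, hp.not_gt]
        ring
      · simp [hp, hp0, hp.not_gt, hq.ne', hq.not_gt]
  · simp
  · have hp0 := hp.ne'
    rcases lt_or_ge q 0 with hq | hq
    · simp [hp, hp0, hp.not_gt, hq, hq.ne]
      split_ifs <;> ring
    · have hpq : 0 < p + q := by linarith
      simp [hp, hp0, hp.not_gt, hpq.ne', hpq.not_gt]

/-- The same comparison for the coefficient of `e_v`. The definition of `a` matters when one of `p`,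
`q` is zero and the other negative: the identity is then `a (a d + b c - d²) = 0`. -/
theorem diagCoeff_braid (p q : ℝ) :
    diagCoeff b c d p * diagCoeff b c d p * diagCoeff b c d q +
      offCoeff b c p * offCoeff b c (-p) * diagCoeff b c d (p + q) =
    (diagCoeff b c d q * diagCoeff b c d q * diagCoeff b c d p +
      offCoeff b c q * offCoeff b c (-q) * diagCoeff b c d (p + q) : R) := by
  have ha := lkParam_eq b c d
  unfold offCoeff diagCoeff
  rcases lt_trichotomy p 0 with hp | rfl | hp <;> rcases lt_trichotomy q 0 with hq | rfl | hq
  · have hpq : p + q < 0 := by linarith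
    simp [hp, hp.ne, hp.not_gt, hq, hq.ne, hq.not_gt, hpq, hpq.ne]
  · simp [hp, hp.ne, hp.not_gt]
    linear_combination (lkParam b c d) * ha
  · simp [hp, hp.ne, hp.not_gt, hq, hq.ne', hq.not_gt]
    split_ifs <;> ring
  · simp [hq, hq.ne, hq.not_gt]
    linear_combination -(lkParam b c d) * ha
  · simp
  · simp [hq, hq.ne', hq.not_gt]
  · simp [hp, hp.ne', hp.not_gt, hq, hq.ne, hq.not_gt]
    split_ifs <;> ring
  · simp [hp, hp.ne', hp.not_gt]
  · have hpq : 0 < p + q := by linarith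
    simp [hp, hp.ne', hp.not_gt, hq, hq.ne', hq.not_gt, hpq.ne', hpq.not_gt]

include hM in
theorem simpleVec_add_mem_posRoots {i j : I} (hij : i ≠ j) (h : M i j = 3) :
    (simpleVec i + simpleVec j : I → ℝ) ∈ M.posRoots := by
  rw [← refl_simpleVec_of_three h]
  exact refl_mem_posRoots hM (simpleVec_mem_posRoots i) (simpleVec_injective.ne hij)

theorem simpleVec_add_ne (i j : I) : (simpleVec i + simpleVec j : I → ℝ) ≠ simpleVec i := by
  intro h
  have := congrFun (add_eq_left.1 h) j
  rw [simpleVec_self] at this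
  exact one_ne_zero this

theorem refl_simpleVec_add {i j : I} (h : M i j = 3) :
    M.refl j (simpleVec i + simpleVec j) = simpleVec i := by
  rw [← refl_simpleVec_of_three h, M.refl_refl]

theorem rootForm_simpleVec_add {i j : I} (h : M i j = 3) :
    M.rootForm (simpleVec i + simpleVec j) (simpleVec j) = 1 := by
  rw [map_add, LinearMap.add_apply, M.rootForm_three h, rootForm_self]
  norm_num

include hM in
theorem phi_simpleVec_of_three {i j : I} (hij : i ≠ j) (h : M i j = 3) :
    M.phi b c d j (M.rootVec R (simpleVec i)) =
      lkParam b c d • M.rootVec R (simpleVec i) +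
        (c : R) • M.rootVec R (simpleVec i + simpleVec j) := by
  rw [phi_rootVec hM b c d (simpleVec_mem_posRoots i) (simpleVec_injective.ne hij),
    M.rootForm_three h, refl_simpleVec_of_three h]
  simp [diagCoeff, offCoeff]

include hM in
theorem phi_simpleVec_add {i j : I} (hij : i ≠ j) (h : M i j = 3) :
    M.phi b c d j (M.rootVec R (simpleVec i + simpleVec j)) =
      (b : R) • M.rootVec R (simpleVec i) := by
  rw [phi_rootVec hM b c d (simpleVec_add_mem_posRoots hM hij h)
    (by rw [add_comm]; exact simpleVec_add_ne j i), rootForm_simpleVec_add h, refl_simpleVec_add h]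
  simp [diagCoeff, offCoeff, (zero_lt_one (α := ℝ)).not_gt]

include hM in
theorem phi_braid_of_three {i j : I} (hij : i ≠ j) (h : M i j = 3) :
    M.phi b c d i * M.phi b c d j * M.phi b c d i =
      M.phi b c d j * M.phi b c d i * (M.phi b c d j : Module.End R _) := by
  have h' : M j i = 3 := by rw [M.symmetric j i, h]
  have key : ∀ {i j : I}, i ≠ j → M i j = 3 → M.phi b c d j (M.phi b c d i (M.phi b c d j
      (M.rootVec R (simpleVec i)))) = 0 := by
    intro i j hij h
    have h' : M j i = 3 := by rw [M.symmetric j i, h]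
    rw [phi_simpleVec_of_three hM b c d hij h, map_add, map_smul, map_smul, phi_simpleVec,
      add_comm (simpleVec i), phi_simpleVec_add hM b c d hij.symm h', smul_zero, zero_add,
      map_smul, map_smul, phi_simpleVec, smul_zero, smul_zero]
  refine endo_ext fun v hv => ?_
  simp only [Module.End.mul_apply]
  -- The roots `α_i`, `α_j`, `α_i + α_j` are exceptional: both products pass through a simple root
  -- that is killed, and both sides vanish. For other `v` the generic formula `phi_rootVec` applies
  -- at each stage.
  by_cases hi : v = simpleVec i
  · rw [hi, phi_simpleVec, map_zero, map_zero, key hij h]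
  by_cases hj : v = simpleVec j
  · rw [hj, phi_simpleVec, map_zero, map_zero, key hij.symm h']
  by_cases hs : v = simpleVec i + simpleVec j
  · rw [hs, phi_simpleVec_add hM b c d hij h, add_comm,
      phi_simpleVec_add hM b c d hij.symm h']
    simp only [map_smul, phi_simpleVec, smul_zero, map_zero]
  have hi' := refl_mem_posRoots hM hv hi
  have hj' := refl_mem_posRoots hM hv hj
  have hij' : M.refl i v ≠ simpleVec j :=
    refl_ne_simpleVec hM (by rwa [refl_simpleVec_of_three h', add_comm])
  have hji' : M.refl j v ≠ simpleVec i :=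
    refl_ne_simpleVec hM (by rwa [refl_simpleVec_of_three h])
  have hii : M.refl i v ≠ simpleVec i := by
    intro h1
    have := M.refl_refl i v
    rw [h1, refl_simpleVec_self] at this
    exact neg_notMem_posRoots hM (simpleVec_mem_posRoots i) (this ▸ hv)
  have hjj : M.refl j v ≠ simpleVec j := by
    intro h1
    have := M.refl_refl j v
    rw [h1, refl_simpleVec_self] at this
    exact neg_notMem_posRoots hM (simpleVec_mem_posRoots j) (this ▸ hv)
  have hji2 := refl_mem_posRoots hM hi' hij'
  have hij2 := refl_mem_posRoots hM hj' hji'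
  have hiji : M.refl j (M.refl i v) ≠ simpleVec i := by
    refine refl_ne_simpleVec hM ?_
    rw [refl_simpleVec_of_three h]
    intro h1
    apply hj
    rw [← M.refl_refl i v, h1, add_comm, refl_simpleVec_add h']
  have hjij : M.refl i (M.refl j v) ≠ simpleVec j := by
    refine refl_ne_simpleVec hM ?_
    rw [refl_simpleVec_of_three h']
    intro h1
    apply hi
    rw [← M.refl_refl j v, h1, add_comm, refl_simpleVec_add h]
  have e1 := phi_rootVec hM b c d hv hi
  have e2 := phi_rootVec hM b c d hv hj
  have e3 := phi_rootVec hM b c d hi' hij'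
  have e4 := phi_rootVec hM b c d hj' hji'
  have e5 := phi_rootVec hM b c d hji2 hiji
  have e6 := phi_rootVec hM b c d hij2 hjij
  have e7 := phi_rootVec hM b c d hi' hii
  have e8 := phi_rootVec hM b c d hj' hjj
  rw [M.refl_refl] at e7 e8
  simp only [rootForm_refl, rootForm_self, M.rootForm_three h, M.rootForm_three h'] at e3 e4 e5 e6 e7 e8
  rw [refl_braid_of_three M h'] at e6
  -- Every value of the form met along the way is one of `p`, `q`, `p + q`, `-p`, `-q`.
  set p := M.rootForm v (simpleVec i)
  set q := M.rootForm v (simpleVec j)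
  rw [show q - p * -1 = p + q by ring] at e3
  rw [show p - q * -1 = p + q by ring] at e4
  rw [show p - p * 2 - (q - p * -1) * -1 = q by ring] at e5
  rw [show q - q * 2 - (p - q * -1) * -1 = p by ring] at e6
  rw [show p - p * 2 = -p by ring] at e7
  rw [show q - q * 2 = -q by ring] at e8
  simp only [e1, e2, e3, e4, e5, e6, e7, e8, map_add, map_smul, smul_add]
  have k1 := diagCoeff_offCoeff_braid b c d p q
  have k2 := diagCoeff_offCoeff_braid b c d q p
  have k3 := diagCoeff_braid b c d p q
  rw [add_comm q p] at k2
  -- Only the coefficients of `e_{s_i v}`, `e_{s_j v}` and `e_v` need an identity; the others match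
  -- up to commutativity.
  linear_combination (norm := module) k1 • M.rootVec R (M.refl i v) - k2 • M.rootVec R (M.refl j v)
    + k3 • M.rootVec R v

end Phi

end CoxeterMatrix

namespace CoxeterMatrix

/-! ### Cancellation and lcms in the Artin-Tits monoid. -/

section ArtinMonoid

variable {I : Type*} {M : CoxeterMatrix I}

theorem mk_of_eq_artinGen (i : I) : PresentedMonoid.mk M.BraidRel (FreeMonoid.of i) = M.artinGen i :=
  rfl

theorem altProd_artinGen (i j : I) :
    altProd (M.artinGen i) (M.artinGen j) (M i j) =
      altProd (M.artinGen j) (M.artinGen i) (M i j) := by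
  by_cases h : M i j = 0
  · rw [h]
    rfl
  · have := PresentedMonoid.mk_eq_mk_of_rel (BraidRel.braid i j h)
    rwa [map_altProd, map_altProd] at this

theorem gen_comm {i j : I} (h : M i j = 2) (x : M.ArtinMonoid) :
    M.artinGen i * (M.artinGen j * x) = M.artinGen j * (M.artinGen i * x) := by
  have := altProd_artinGen (M := M) i j
  rw [h] at this
  simp only [altProd, mul_one] at this
  rw [← mul_assoc, this, mul_assoc]

theorem gen_braid {i j : I} (h : M i j = 3) (x : M.ArtinMonoid) :
    M.artinGen i * (M.artinGen j * (M.artinGen i * x)) =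
      M.artinGen j * (M.artinGen i * (M.artinGen j * x)) := by
  have := altProd_artinGen (M := M) i j
  rw [h] at this
  simp only [altProd, mul_one] at this
  rw [← mul_assoc (M.artinGen j), ← mul_assoc (M.artinGen i), this]
  simp only [mul_assoc]

theorem altProd_eq_of_small (hM : M.IsSmallType) {N : Type*} [Monoid N] (f : I → N)
    (h2 : ∀ i j, i ≠ j → M i j = 2 → f i * f j = f j * f i)
    (h3 : ∀ i j, i ≠ j → M i j = 3 → f i * f j * f i = f j * f i * f j) (i j : I) :
    altProd (f i) (f j) (M i j) = altProd (f j) (f i) (M i j) := by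
  by_cases hij : i = j
  · rw [hij]
  · rcases hM i j with h | h | h
    · exact absurd h (M.off_diagonal i j hij)
    · rw [h]
      simpa [altProd] using h2 i j hij h
    · rw [h]
      simpa [altProd, mul_assoc] using h3 i j hij h

/-- The universal property of the Artin-Tits monoid of a Coxeter matrix of small type. -/
def artinLift (hM : M.IsSmallType) {N : Type*} [Monoid N] (f : I → N)
    (h2 : ∀ i j, i ≠ j → M i j = 2 → f i * f j = f j * f i)
    (h3 : ∀ i j, i ≠ j → M i j = 3 → f i * f j * f i = f j * f i * f j) :
    M.ArtinMonoid →* N :=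
  PresentedMonoid.lift f (by
    rintro _ _ ⟨i, j, -⟩
    rw [map_altProd, map_altProd, FreeMonoid.lift_eval_of, FreeMonoid.lift_eval_of]
    exact altProd_eq_of_small hM f h2 h3 i j)

theorem artinLift_gen (hM : M.IsSmallType) {N : Type*} [Monoid N] (f : I → N)
    (h2 : ∀ i j, i ≠ j → M i j = 2 → f i * f j = f j * f i)
    (h3 : ∀ i j, i ≠ j → M i j = 3 → f i * f j * f i = f j * f i * f j) (i : I) :
    artinLift hM f h2 h3 (M.artinGen i) = f i :=
  PresentedMonoid.lift_of _ _

theorem eq_one_or_exists_gen_mul (x : M.ArtinMonoid) : x = 1 ∨ ∃ i y, x = M.artinGen i * y := by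
  obtain ⟨l, rfl⟩ := PresentedMonoid.surjective_mk x
  induction l using FreeMonoid.casesOn with
  | one => exact Or.inl (map_one _)
  | of_mul i l => exact Or.inr ⟨i, PresentedMonoid.mk _ l, by rw [map_mul]; rfl⟩

variable (M) in
/-- The length of an element of the Artin-Tits monoid, as a homomorphism. -/
def lengthHom : M.ArtinMonoid →* Multiplicative ℕ :=
  PresentedMonoid.lift (fun _ => Multiplicative.ofAdd 1) (by
    rintro _ _ ⟨i, j, -⟩
    rw [map_altProd, map_altProd, FreeMonoid.lift_eval_of, FreeMonoid.lift_eval_of])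

/-- The length of an element of the Artin-Tits monoid. -/
def alen (x : M.ArtinMonoid) : ℕ := (M.lengthHom x).toAdd

@[simp]
theorem alen_mul (x y : M.ArtinMonoid) : alen (x * y) = alen x + alen y := by
  simp [alen]

@[simp]
theorem alen_one : alen (1 : M.ArtinMonoid) = 0 := by
  simp [alen]

@[simp]
theorem alen_gen (i : I) : alen (M.artinGen i) = 1 := rfl

theorem eq_one_of_alen {x : M.ArtinMonoid} (h : alen x = 0) : x = 1 := by
  rcases eq_one_or_exists_gen_mul x with rfl | ⟨i, y, rfl⟩
  · rfl
  · simp at h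

theorem artin_induction {p : M.ArtinMonoid → Prop} (one : p 1)
    (gen_mul : ∀ i x, p x → p (M.artinGen i * x)) (x : M.ArtinMonoid) : p x := by
  induction hn : alen x generalizing x with
  | zero => rw [eq_one_of_alen hn]; exact one
  | succ n ih =>
    rcases eq_one_or_exists_gen_mul x with rfl | ⟨i, y, rfl⟩
    · exact one
    · refine gen_mul i y (ih y ?_)
      simp at hn
      omega

/-- The equality `s_i x = s_j y` comes from the lcm of `s_i` and `s_j`. -/
def Compl (i : I) (x : M.ArtinMonoid) (j : I) (y : M.ArtinMonoid) : Prop :=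
  (i = j ∧ x = y) ∨
  (i ≠ j ∧ M i j = 2 ∧ ∃ z, x = M.artinGen j * z ∧ y = M.artinGen i * z) ∨
  (i ≠ j ∧ M i j = 3 ∧ ∃ z, x = M.artinGen j * (M.artinGen i * z) ∧
    y = M.artinGen i * (M.artinGen j * z))

theorem Compl.symm {i j : I} {x y : M.ArtinMonoid} (h : Compl i x j y) : Compl j y i x := by
  rcases h with ⟨rfl, rfl⟩ | ⟨hij, h, z, rfl, rfl⟩ | ⟨hij, h, z, rfl, rfl⟩
  · exact Or.inl ⟨rfl, rfl⟩
  · exact Or.inr (Or.inl ⟨hij.symm, by rw [M.symmetric, h], z, rfl, rfl⟩)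
  · exact Or.inr (Or.inr ⟨hij.symm, by rw [M.symmetric, h], z, rfl, rfl⟩)

theorem Compl.mul_right {i j : I} {x y : M.ArtinMonoid} (h : Compl i x j y) (t : M.ArtinMonoid) :
    Compl i (x * t) j (y * t) := by
  rcases h with ⟨rfl, rfl⟩ | ⟨hij, h, z, rfl, rfl⟩ | ⟨hij, h, z, rfl, rfl⟩
  · exact Or.inl ⟨rfl, rfl⟩
  · exact Or.inr (Or.inl ⟨hij, h, z * t, by simp only [mul_assoc], by simp only [mul_assoc]⟩)
  · exact Or.inr (Or.inr ⟨hij, h, z * t, by simp only [mul_assoc], by simp only [mul_assoc]⟩)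

theorem Compl.eq {i : I} {x y : M.ArtinMonoid} (h : Compl i x i y) : x = y := by
  rcases h with h | h | h
  · exact h.2
  · exact absurd rfl h.1
  · exact absurd rfl h.1

theorem Compl.two {i j : I} {x y : M.ArtinMonoid} (h : Compl i x j y) (hij : M i j = 2) :
    ∃ z, x = M.artinGen j * z ∧ y = M.artinGen i * z := by
  rcases h with ⟨rfl, -⟩ | h | h
  · rw [M.diagonal] at hij
    norm_num at hij
  · exact h.2.2
  · exact absurd (h.2.1.symm.trans hij) (by norm_num)

theorem Compl.three {i j : I} {x y : M.ArtinMonoid} (h : Compl i x j y) (hij : M i j = 3) :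
    ∃ z, x = M.artinGen j * (M.artinGen i * z) ∧ y = M.artinGen i * (M.artinGen j * z) := by
  rcases h with ⟨rfl, -⟩ | h | h
  · rw [M.diagonal] at hij
    norm_num at hij
  · exact absurd (h.2.1.symm.trans hij) (by norm_num)
  · exact h.2.2

variable (M) in
/-- All equalities `s_i x = s_j y` with `x` of length less than `n` come from the lcm of `s_i`
and `s_j`. -/
def ComplBelow (n : ℕ) : Prop :=
  ∀ (i j : I) (x y : M.ArtinMonoid), M.artinGen i * x = M.artinGen j * y → alen x < n →
    Compl i x j y

/-- Infinite descent: the lcm of `s_i` and `s_j` turns the equality into `s_k v = s_i (s_j z)`, of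
the same shape with the indices rotated and with `v` shorter than `u`. -/
theorem ComplBelow.not_affine {n : ℕ} (H : M.ComplBelow n) {i j k : I} (hij : M i j = 3)
    (hjk : M j k = 3) (hik : M i k = 3) {u v : M.ArtinMonoid} (hu : alen u < n)
    (h : M.artinGen i * u = M.artinGen j * (M.artinGen k * v)) : False := by
  induction hn : alen u using Nat.strong_induction_on generalizing i j k u v with
  | _ m ih =>
    obtain ⟨z, rfl, h2⟩ := (H i j _ _ h hu).three hij
    have hl := congrArg alen h2
    simp at hl hu hn
    exact ih (alen v) (by omega) (i := k) (j := i) (k := j) (u := v) (v := z)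
      (by rw [M.symmetric, hik]) hij (by rw [M.symmetric, hjk]) (by omega) h2 rfl

theorem ComplBelow.trans_two_two {n : ℕ} (H : M.ComplBelow n) {i j k : I} (hij : M i j = 2)
    (hjk : M j k = 2) {z z' : M.ArtinMonoid} (hz : alen z < n)
    (h : M.artinGen i * z = M.artinGen k * z') :
    Compl i (M.artinGen j * z) k (M.artinGen j * z') := by
  have hji : M j i = 2 := by rw [M.symmetric, hij]
  rcases H i k _ _ h hz with ⟨rfl, rfl⟩ | ⟨hik, h3, t, rfl, rfl⟩ | ⟨hik, h3, t, rfl, rfl⟩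
  · exact Or.inl ⟨rfl, rfl⟩
  · exact Or.inr (Or.inl ⟨hik, h3, M.artinGen j * t, gen_comm hjk t, gen_comm hji t⟩)
  · refine Or.inr (Or.inr ⟨hik, h3, M.artinGen j * t, ?_, ?_⟩)
    · rw [gen_comm hjk, gen_comm hji]
    · rw [gen_comm hji, gen_comm hjk]

theorem ComplBelow.trans_three_two (hM : M.IsSmallType) {n : ℕ} (H : M.ComplBelow n) {i j k : I}
    (hij : M i j = 3) (hjk : M j k = 2) {z z' : M.ArtinMonoid} (hz : alen z + 1 < n)
    (h : M.artinGen i * (M.artinGen j * z) = M.artinGen k * z') :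
    Compl i (M.artinGen j * (M.artinGen i * z)) k (M.artinGen j * z') := by
  have hji : M j i = 3 := by rw [M.symmetric, hij]
  have hC := H i k _ _ h (by simp; omega)
  rcases hM.cases i k with rfl | ⟨hik, h2, -⟩ | ⟨hik, h3, hki⟩
  · rw [hji] at hjk
    norm_num at hjk
  · obtain ⟨t, h1, rfl⟩ := hC.two h2
    obtain ⟨u, rfl, rfl⟩ := (H j k _ _ h1 (by omega)).two hjk
    refine Or.inr (Or.inl ⟨hik, h2, M.artinGen j * (M.artinGen i * u), ?_, ?_⟩)
    · rw [gen_comm h2, gen_comm hjk]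
    · rw [gen_braid hji]
  · obtain ⟨t, h1, rfl⟩ := hC.three h3
    obtain ⟨p, rfl, h4⟩ := (H j k _ _ h1 (by omega)).two hjk
    have hl := congrArg alen h4
    simp at hl hz
    obtain ⟨q, rfl, rfl⟩ := (H i j _ _ h4 (by omega)).three hij
    refine Or.inr (Or.inr ⟨hik, h3,
      M.artinGen j * (M.artinGen i * (M.artinGen k * q)), ?_, ?_⟩)
    · rw [gen_braid h3, gen_comm hjk, ← gen_comm hjk q, gen_braid hji]
    · rw [← gen_comm hjk (M.artinGen i * q), gen_braid hji, gen_braid h3, gen_comm hjk]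

theorem ComplBelow.trans_three_three (hM : M.IsSmallType) {n : ℕ} (H : M.ComplBelow n)
    {i j k : I} (hij : M i j = 3) (hjk : M j k = 3) {z z' : M.ArtinMonoid} (hz : alen z + 1 < n)
    (h : M.artinGen i * (M.artinGen j * z) = M.artinGen k * (M.artinGen j * z')) :
    Compl i (M.artinGen j * (M.artinGen i * z)) k (M.artinGen j * (M.artinGen k * z')) := by
  have hji : M j i = 3 := by rw [M.symmetric, hij]
  have hkj : M k j = 3 := by rw [M.symmetric, hjk]
  have hC := H i k _ _ h (by simp; omega)
  have hl := congrArg alen h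
  simp at hl
  rcases hM.cases i k with rfl | ⟨hik, h2, hki⟩ | ⟨hik, h3, -⟩
  · have h1 := (H j j _ _ hC.eq (by omega)).eq
    exact Or.inl ⟨rfl, by rw [h1]⟩
  · obtain ⟨t, h1, h1'⟩ := hC.two h2
    obtain ⟨p, rfl, rfl⟩ := (H j k _ _ h1 (by omega)).three hjk
    obtain ⟨q, rfl, h4⟩ := (H j i _ _ h1' (by omega)).three hji
    simp at hz hl
    have h5 := (H j j _ _ h4 (by simp; omega)).eq
    obtain ⟨r, rfl, rfl⟩ := (H k i _ _ h5 (by omega)).two hki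
    refine Or.inr (Or.inl ⟨hik, h2,
      M.artinGen j * (M.artinGen k * (M.artinGen i * (M.artinGen j * r))), ?_, ?_⟩)
    · rw [gen_comm h2, gen_braid hij, gen_braid hjk]
    · rw [gen_comm hki, gen_braid hkj, gen_braid hji, gen_comm hki]
  · obtain ⟨t, h1, -⟩ := hC.three h3
    exact (H.not_affine hjk (by rw [M.symmetric, h3]) hji (by omega) h1).elim

/-- The core of the cancellation argument: two equalities explained by lcms compose to one that is.
The cases are the types of the pairs `(i, j)` and `(j, k)`, and all the equalities solved on the way
have remainders of length less than `n`. Three entries equal to `3` are excluded by `not_affine`. -/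
theorem ComplBelow.trans (hM : M.IsSmallType) {n : ℕ} (H : M.ComplBelow n) {i j k : I}
    {x y w : M.ArtinMonoid} (hx : alen x ≤ n) (hxy : Compl i x j y) (hyw : Compl j y k w) :
    Compl i x k w := by
  rcases hxy with ⟨rfl, rfl⟩ | ⟨hij, h, z, rfl, rfl⟩ | ⟨hij, h, z, rfl, rfl⟩
  · exact hyw
  · rcases hyw with ⟨rfl, rfl⟩ | ⟨hjk, h', z', h1, rfl⟩ | ⟨hjk, h', z', h1, rfl⟩
    · exact Or.inr (Or.inl ⟨hij, h, z, rfl, rfl⟩)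
    · exact H.trans_two_two h h' (by simp at hx; omega) h1
    · have hl := congrArg alen h1
      simp at hl hx
      exact (H.trans_three_two hM (by rw [M.symmetric, h']) (by rw [M.symmetric, h]) (by omega)
        h1.symm).symm
  · rcases hyw with ⟨rfl, rfl⟩ | ⟨hjk, h', z', h1, rfl⟩ | ⟨hjk, h', z', h1, rfl⟩
    · exact Or.inr (Or.inr ⟨hij, h, z, rfl, rfl⟩)
    · exact H.trans_three_two hM h h' (by simp at hx; omega) h1
    · exact H.trans_three_three hM h h' (by simp at hx; omega) h1

/-- Induction over the rules generating the congruence, following first letters and remainders;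
transitivity is `ComplBelow.trans`. Equality in the monoid is carried along because it gives the
equality of lengths that transports the bound `n`. -/
theorem compl_of_rel (hM : M.IsSmallType) {n : ℕ} (H : M.ComplBelow n) {w x : FreeMonoid I}
    (h : ConGen.Rel M.BraidRel w x) :
    PresentedMonoid.mk M.BraidRel w = PresentedMonoid.mk M.BraidRel x ∧ 
    ((w = 1 ∧ x = 1) ∨ ∃ i u j v, w = FreeMonoid.of i * u ∧ x = FreeMonoid.of j * v ∧
      (alen (PresentedMonoid.mk M.BraidRel u) ≤ n →
        Compl i (PresentedMonoid.mk M.BraidRel u) j (PresentedMonoid.mk M.BraidRel v))) := by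
  have len_eq : ∀ {i j : I} {u v : FreeMonoid I}, PresentedMonoid.mk M.BraidRel
      (FreeMonoid.of i * u) = PresentedMonoid.mk M.BraidRel (FreeMonoid.of j * v) →
      alen (PresentedMonoid.mk M.BraidRel u) = alen (PresentedMonoid.mk M.BraidRel v) := by
    intro i j u v h
    have := congrArg alen h
    simpa [map_mul, mk_of_eq_artinGen] using this
  induction h with
  | of w x hwx =>
    refine ⟨PresentedMonoid.mk_eq_mk_of_rel hwx, Or.inr ?_⟩
    obtain ⟨i, j, -⟩ := hwx
    rcases hM.cases i j with rfl | ⟨hij, h, -⟩ | ⟨hij, h, -⟩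
    · exact ⟨i, 1, i, 1, by simp [altProd], by simp [altProd], fun _ => Or.inl ⟨rfl, rfl⟩⟩
    · refine ⟨i, FreeMonoid.of j, j, FreeMonoid.of i, by simp [h, altProd],
        by simp [h, altProd], fun _ => Or.inr (Or.inl ⟨hij, h, 1, ?_⟩)⟩
      simp [mk_of_eq_artinGen]
    · refine ⟨i, FreeMonoid.of j * FreeMonoid.of i, j, FreeMonoid.of i * FreeMonoid.of j,
        by simp [h, altProd], by simp [h, altProd], fun _ => Or.inr (Or.inr ⟨hij, h, 1, ?_⟩)⟩
      simp [mk_of_eq_artinGen]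
  | refl w =>
    refine ⟨rfl, ?_⟩
    induction w using FreeMonoid.casesOn with
    | one => exact Or.inl ⟨rfl, rfl⟩
    | of_mul i u => exact Or.inr ⟨i, u, i, u, rfl, rfl, fun _ => Or.inl ⟨rfl, rfl⟩⟩
  | symm _ ih =>
    refine ⟨ih.1.symm, ?_⟩
    obtain ⟨he, h | ⟨i, u, j, v, rfl, rfl, h⟩⟩ := ih
    · exact Or.inl ⟨h.2, h.1⟩
    · exact Or.inr ⟨j, v, i, u, rfl, rfl, fun hn => (h ((len_eq he).trans_le hn)).symm⟩
  | trans _ _ ih1 ih2 =>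
    refine ⟨ih1.1.trans ih2.1, ?_⟩
    obtain ⟨he, ⟨rfl, rfl⟩ | ⟨i, u, j, v, rfl, rfl, h⟩⟩ := ih1
    · obtain ⟨he', ⟨-, rfl⟩ | ⟨i', u', j', v', h1, rfl, h'⟩⟩ := ih2
      · exact Or.inl ⟨rfl, rfl⟩
      · have := congrArg FreeMonoid.length h1
        simp at this
        omega
    · obtain ⟨he', ⟨h1, rfl⟩ | ⟨i', u', j', v', h1, rfl, h'⟩⟩ := ih2
      · have := congrArg FreeMonoid.length h1
        simp at this
      · obtain ⟨rfl, rfl⟩ : j = i' ∧ v = u' := by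
          have h2 := congrArg FreeMonoid.toList h1
          simpa using h2
        refine Or.inr ⟨i, u, j', v', rfl, rfl, fun hn => ?_⟩
        exact H.trans hM hn (h hn) (h' ((len_eq he).symm.trans_le hn))
  | mul _ _ ih1 ih2 =>
    refine ⟨by rw [map_mul, map_mul, ih1.1, ih2.1], ?_⟩
    obtain ⟨he, ⟨rfl, rfl⟩ | ⟨i, u, j, v, rfl, rfl, h⟩⟩ := ih1
    · simpa using ih2.2
    · refine Or.inr ⟨i, _, j, _, mul_assoc _ _ _, mul_assoc _ _ _, fun hn => ?_⟩
      rw [map_mul, map_mul, ← ih2.1]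
      refine Compl.mul_right (h ?_) _
      rw [map_mul, alen_mul] at hn
      omega

theorem complBelow (hM : M.IsSmallType) (n : ℕ) : M.ComplBelow n := by
  induction n with
  | zero => exact fun _ _ _ _ _ h => absurd h (Nat.not_lt_zero _)
  | succ n H =>
    intro i j x y h hx
    obtain ⟨u, rfl⟩ := PresentedMonoid.surjective_mk x
    obtain ⟨v, rfl⟩ := PresentedMonoid.surjective_mk y
    rw [← mk_of_eq_artinGen, ← mk_of_eq_artinGen, ← map_mul, ← map_mul] at h
    obtain ⟨-, ⟨h1, -⟩ | ⟨i', u', j', v', h1, h2, h3⟩⟩ :=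
      compl_of_rel hM H (PresentedMonoid.mk_eq_mk_iff.1 h)
    · have := congrArg FreeMonoid.length h1
      simp at this
    · obtain ⟨rfl, rfl⟩ : i = i' ∧ u = u' := by
        simpa using congrArg FreeMonoid.toList h1
      obtain ⟨rfl, rfl⟩ : j = j' ∧ v = v' := by
        simpa using congrArg FreeMonoid.toList h2
      exact h3 (by omega)

theorem compl_of_eq (hM : M.IsSmallType) {i j : I} {x y : M.ArtinMonoid}
    (h : M.artinGen i * x = M.artinGen j * y) : Compl i x j y :=
  complBelow hM _ i j x y h (Nat.lt_succ_self _)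

theorem artin_mul_left_cancel (hM : M.IsSmallType) {z x y : M.ArtinMonoid} (h : z * x = z * y) :
    x = y := by
  induction z using artin_induction with
  | one => simpa using h
  | gen_mul i z ih =>
    rw [mul_assoc, mul_assoc] at h
    exact ih (compl_of_eq hM h).eq

theorem artin_dvd_antisymm {x y : M.ArtinMonoid} (h : x ∣ y) (h' : y ∣ x) :
    x = y := by
  obtain ⟨z, rfl⟩ := h
  obtain ⟨t, ht⟩ := h'
  have := congrArg alen ht
  simp at this
  rw [eq_one_of_alen (x := z) (by omega), mul_one]

/-- Elements with a common multiple have an lcm. -/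
theorem exists_lcm (hM : M.IsSmallType) {n x y : M.ArtinMonoid} (hx : x ∣ n) (hy : y ∣ n) :
    ∃ m, x ∣ m ∧ y ∣ m ∧ ∀ n', x ∣ n' → y ∣ n' → m ∣ n' := by
  induction hn : alen n using Nat.strong_induction_on generalizing n x y with
  | _ k ih =>
    subst hn
    rcases eq_one_or_exists_gen_mul x with rfl | ⟨i, x', rfl⟩
    · exact ⟨y, one_dvd y, dvd_rfl, fun _ _ h => h⟩
    rcases eq_one_or_exists_gen_mul y with rfl | ⟨j, y', rfl⟩
    · exact ⟨_, dvd_rfl, one_dvd _, fun _ h _ => h⟩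
    -- The element `s_i p = s_j q` is the lcm of the two first letters.
    have hij : ∃ p q, M.artinGen i * p = M.artinGen j * q ∧
        ∀ x y, M.artinGen i * x = M.artinGen j * y → ∃ z, x = p * z ∧ y = q * z := by
      obtain ⟨r, hr⟩ := hx
      obtain ⟨s, hs⟩ := hy
      rw [mul_assoc] at hr hs
      rcases hM.cases i j with rfl | ⟨hij, h, -⟩ | ⟨hij, h, -⟩
      · exact ⟨1, 1, rfl, fun x y h => ⟨x, by simp, by simp [(compl_of_eq hM h).eq]⟩⟩
      · refine ⟨M.artinGen j, M.artinGen i, by simpa using gen_comm h 1, fun x y hxy => ?_⟩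
        exact (compl_of_eq hM hxy).two h
      · refine ⟨M.artinGen j * M.artinGen i, M.artinGen i * M.artinGen j,
          by simpa [mul_assoc] using gen_braid h 1, fun x y hxy => ?_⟩
        simpa only [mul_assoc] using (compl_of_eq hM hxy).three h
    obtain ⟨p, q, hpq, hmin⟩ := hij
    obtain ⟨r, hr⟩ := hx
    obtain ⟨s, hs⟩ := hy
    rw [mul_assoc] at hr hs
    have hl := congrArg alen hr
    have hl' := congrArg alen hs
    simp at hl hl'
    obtain ⟨z, hz1, hz2⟩ := hmin _ _ (hr.symm.trans hs)
    have hlz := congrArg alen hz1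
    have hlz' := congrArg alen hz2
    simp at hlz hlz'
    -- The lcm is assembled from smaller ones: `u = x' a = p a'` for `x'` and `p`, `v = y' e = q e'`
    -- for `y'` and `q`, then `w` for `a'` and `e'`. The result is `s_i p w`. Each smaller pair has
    -- a common multiple shorter than `n`, so the induction applies.
    obtain ⟨u, ⟨a, ha⟩, ⟨a', ha'⟩, hu⟩ := ih (alen (x' * r)) (by simp; omega) (Dvd.intro r rfl)
      (Dvd.intro z hz1.symm) rfl
    obtain ⟨v, ⟨e, he⟩, ⟨e', he'⟩, hv⟩ := ih (alen (y' * s)) (by simp; omega) (Dvd.intro s rfl)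
      (Dvd.intro z hz2.symm) rfl
    have hfac : ∀ n', M.artinGen i * x' ∣ n' → M.artinGen j * y' ∣ n' →
        ∃ t, n' = M.artinGen i * (p * t) ∧ a' ∣ t ∧ e' ∣ t := by
      rintro n' ⟨r', hr'⟩ ⟨s', hs'⟩
      rw [mul_assoc] at hr' hs'
      obtain ⟨t, ht1, ht2⟩ := hmin _ _ (hr'.symm.trans hs')
      refine ⟨t, by rw [hr', ht1], ?_, ?_⟩
      · obtain ⟨k, hk⟩ := hu (x' * r') (Dvd.intro _ rfl) (Dvd.intro t ht1.symm)
        refine ⟨k, artin_mul_left_cancel hM (z := p) ?_⟩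
        rw [← ht1, hk, ha', mul_assoc]
      · obtain ⟨k, hk⟩ := hv (y' * s') (Dvd.intro _ rfl) (Dvd.intro t ht2.symm)
        refine ⟨k, artin_mul_left_cancel hM (z := q) ?_⟩
        rw [← ht2, hk, he', mul_assoc]
    have hnx : n = M.artinGen i * (p * z) := by rw [hr, hz1]
    obtain ⟨t, ht, hat, het⟩ := hfac n (Dvd.intro r (by rw [hr, mul_assoc]))
      (Dvd.intro s (by rw [hs, mul_assoc]))
    have hlt := congrArg alen ht
    simp at hlt
    obtain ⟨w, ⟨f, hf⟩, ⟨f', hf'⟩, hw⟩ := ih (alen t) (by omega) hat het rfl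
    refine ⟨M.artinGen i * (p * w), ⟨a * f, ?_⟩, ⟨e * f', ?_⟩, fun n' h1 h2 => ?_⟩
    · rw [hf, ← mul_assoc p, ← ha', ha]
      simp only [mul_assoc]
    · rw [hf', ← mul_assoc, hpq, mul_assoc, ← mul_assoc q, ← he', he]
      simp only [mul_assoc]
    · obtain ⟨t', rfl, h3, h4⟩ := hfac n' h1 h2
      obtain ⟨k, rfl⟩ := hw t' h3 h4
      exact ⟨k, by simp only [mul_assoc]⟩

/-- Generators with a common multiple have an lcm. -/
theorem exists_isGarside [Finite I] (hM : M.IsSmallType) (J : Set I) {n : M.ArtinMonoid}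
    (hn : ∀ j ∈ J, M.artinGen j ∣ n) : ∃ D, M.IsGarside J D := by
  induction J, J.toFinite using Set.Finite.induction_on with
  | empty => exact ⟨1, by simp, fun x _ => one_dvd x⟩
  | @insert j J _ _ ih =>
    obtain ⟨D, hD1, hD2⟩ := ih fun k hk => hn k (Set.mem_insert_of_mem j hk)
    obtain ⟨m, h1, h2, h3⟩ := exists_lcm hM (hn j (Set.mem_insert j J))
      (hD2 n fun k hk => hn k (Set.mem_insert_of_mem j hk))
    refine ⟨m, ?_, fun x hx => ?_⟩
    · rintro k (rfl | hk)
      · exact h1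
      · exact (hD1 k hk).trans h2
    · exact h3 x (hx j (Set.mem_insert j J))
        (hD2 x fun k hk => hx k (Set.mem_insert_of_mem j hk))

theorem IsGarside.unique {J : Set I} {D D' : M.ArtinMonoid}
    (h : M.IsGarside J D) (h' : M.IsGarside J D') : D = D' :=
  artin_dvd_antisymm (h.2 D' h'.1) (h'.2 D h.1)

theorem isGarside_garside {J : Set I} (h : ∃ D, M.IsGarside J D) :
    M.IsGarside J (M.garside J) := by
  rw [garside, dif_pos h]
  exact h.choose_spec

theorem IsGarside.garside_eq {J : Set I} {D : M.ArtinMonoid}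
    (h : M.IsGarside J D) : M.garside J = D :=
  (isGarside_garside ⟨D, h⟩).unique h

end ArtinMonoid

end CoxeterMatrix

namespace CoxeterMatrix

/-! ### The LK-representation, and when its operators are injective or bijective. -/

section LKRepresentation

variable {I : Type*} [Fintype I] [DecidableEq I] {M : CoxeterMatrix I} (hM : M.IsSmallType)
variable {R : Type*} [CommRing R] {b c d : Rˣ} {f : I → Module.Dual R (M.LKModule R)}

theorem basisVec_simpleRoot (i : I) :
    (M.basisVec (M.simpleRoot i) : M.LKModule R) = M.rootVec R (simpleVec i) :=
  basisVec_eq_rootVec _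

theorem psi_apply (i : I) (x : M.LKModule R) :
    M.psi b c d f i x = M.phi b c d i x + f i x • M.rootVec R (simpleVec i) := by
  rw [psi, basisVec_simpleRoot]
  rfl

theorem IsLKFamily.simple (hf : M.IsLKFamily b c d f) {i j : I} (hij : i ≠ j) :
    f i (M.rootVec R (simpleVec j)) = 0 := by
  rw [← basisVec_simpleRoot]
  exact hf.apply_simple i j hij

theorem IsLKFamily.phi_two (hf : M.IsLKFamily b c d f) {i j : I} (h : M i j = 2)
    (x : M.LKModule R) : f i (M.phi b c d j x) = d * f i x :=
  LinearMap.congr_fun (hf.comp_two i j h) x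

theorem IsLKFamily.phi_three (hf : M.IsLKFamily b c d f) {i j : I} (h : M i j = 3)
    (x : M.LKModule R) : f i (M.phi b c d j x) = f j (M.phi b c d i x) :=
  LinearMap.congr_fun (hf.comp_three i j h) x

theorem rootVec_apply {v : I → ℝ} (hv : v ∈ M.posRoots) (β : M.PosRoot) [Decidable (v = β.1)] :
    M.rootVec R v β = if v = β.1 then 1 else 0 := by
  classical
  rw [rootVec, dif_pos hv, basisVec, Finsupp.single_apply]
  simp only [Subtype.ext_iff]

theorem rootVec_simpleVec_apply (i : I) :
    M.rootVec R (simpleVec i) (M.simpleRoot i) = 1 := by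
  classical
  rw [rootVec_apply (simpleVec_mem_posRoots i)]
  exact if_pos rfl

theorem rootVec_apply_of_ne {v : I → ℝ} (hv : v ∈ M.posRoots) {β : M.PosRoot} (h : v ≠ β.1) :
    M.rootVec R v β = 0 := by
  classical
  rw [rootVec_apply hv, if_neg h]

theorem lkModule_induction {p : M.LKModule R → Prop} (zero : p 0)
    (add : ∀ x y, p x → p y → p (x + y)) (smul : ∀ (r : R) x, p x → p (r • x))
    (root : ∀ v ∈ M.posRoots, p (M.rootVec R v)) (x : M.LKModule R) : p x := by
  induction x using Finsupp.induction_linear with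
  | zero => exact zero
  | add x y hx hy => exact add x y hx hy
  | single α r =>
    have := smul r _ (root α.1 α.2)
    rw [← basisVec_eq_rootVec, basisVec, Finsupp.smul_single, smul_eq_mul, mul_one] at this
    exact this

include hM in
theorem refl_ne_simpleVec_self {v : I → ℝ} (hv : v ∈ M.posRoots) (i : I) :
    M.refl i v ≠ simpleVec i := by
  intro h1
  have := M.refl_refl i v
  rw [h1, refl_simpleVec_self] at this
  exact neg_notMem_posRoots hM (simpleVec_mem_posRoots i) (this ▸ hv)

variable (b c d) in
include hM in
/-- The quadratic relation `φ_i ^ 2 = a φ_i + b c` off `e_{α_i}`. -/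
theorem phi_phi (i : I) (x : M.LKModule R) :
    M.phi b c d i (M.phi b c d i x) = (lkParam b c d : R) • M.phi b c d i x +
      ((b : R) * c) • (x - x (M.simpleRoot i) • M.rootVec R (simpleVec i)) := by
  classical
  induction x using lkModule_induction with
  | zero => simp
  | add x y hx hy =>
    rw [map_add, map_add, hx, hy, Finsupp.add_apply]
    module
  | smul r x hx =>
    rw [map_smul, map_smul, hx, Finsupp.smul_apply, smul_eq_mul]
    module
  | root v hv =>
    by_cases hvi : v = simpleVec i
    · rw [hvi, phi_simpleVec, map_zero, rootVec_simpleVec_apply]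
      simp
    · have e7 := phi_rootVec hM b c d (refl_mem_posRoots hM hv hvi)
        (refl_ne_simpleVec_self hM hv i)
      rw [M.refl_refl, rootForm_refl_self] at e7
      rw [phi_rootVec hM b c d hv hvi, map_add, map_smul, map_smul, e7,
        phi_rootVec hM b c d hv hvi, rootVec_apply_of_ne hv (β := M.simpleRoot i) hvi]
      have k1 : (diagCoeff b c d (M.rootForm v (simpleVec i)) : R) *
          diagCoeff b c d (M.rootForm v (simpleVec i)) +
          offCoeff b c (M.rootForm v (simpleVec i)) * offCoeff b c (-M.rootForm v (simpleVec i)) =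
          lkParam b c d * diagCoeff b c d (M.rootForm v (simpleVec i)) + b * c := by
        have ha := lkParam_eq b c d
        unfold diagCoeff offCoeff
        rcases lt_trichotomy (M.rootForm v (simpleVec i)) 0 with h | h | h
        · simp [h, h.ne, h.not_gt]
          ring
        · simp [h]
          linear_combination -ha
        · simp [h, h.ne', h.not_gt]
      have k2 : (offCoeff b c (M.rootForm v (simpleVec i)) : R) *
          (diagCoeff b c d (M.rootForm v (simpleVec i)) +
            diagCoeff b c d (-M.rootForm v (simpleVec i))) =
          lkParam b c d * offCoeff b c (M.rootForm v (simpleVec i)) := by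
        unfold diagCoeff offCoeff
        rcases lt_trichotomy (M.rootForm v (simpleVec i)) 0 with h | h | h
        · simp [h, h.ne, h.not_gt]
          ring
        · simp [h]
        · simp [h, h.ne', h.not_gt]
          ring
      linear_combination (norm := module) k1 • M.rootVec R v + k2 • M.rootVec R (M.refl i v)

include hM in
theorem psi_comm_of_two (hf : M.IsLKFamily b c d f) {i j : I} (hij : i ≠ j) (h : M i j = 2) :
    M.psi b c d f i * M.psi b c d f j = M.psi b c d f j * M.psi b c d f i := by
  have h' : M j i = 2 := by rw [M.symmetric j i, h]
  have hsimple : ∀ {i j : I}, i ≠ j → M i j = 2 →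
      M.phi b c d i (M.rootVec R (simpleVec j)) = (d : R) • M.rootVec R (simpleVec j) := by
    intro i j hij h
    have h' : M j i = 2 := by rw [M.symmetric j i, h]
    rw [phi_rootVec hM b c d (simpleVec_mem_posRoots j) (simpleVec_injective.ne hij.symm),
      M.rootForm_two h']
    simp [diagCoeff, offCoeff]
  refine LinearMap.ext fun x => ?_
  have hφ := LinearMap.congr_fun (phi_comm_of_two hM b c d hij h) x
  simp only [Module.End.mul_apply] at hφ
  simp only [Module.End.mul_apply, psi_apply, map_add, map_smul, hφ, hf.phi_two h, hf.phi_two h',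
    hsimple hij h, hsimple hij.symm h', hf.simple hij, hf.simple hij.symm]
  module

include hM in
-- The expression found in `key` is symmetric in `i` and `j`, because `f_j φ_i = f_i φ_j` and
-- because the `φ`'s satisfy the braid relation.
theorem psi_braid_of_three (hf : M.IsLKFamily b c d f) {i j : I} (hij : i ≠ j) (h : M i j = 3) :
    M.psi b c d f i * M.psi b c d f j * M.psi b c d f i =
      M.psi b c d f j * M.psi b c d f i * M.psi b c d f j := by
  have h' : M j i = 3 := by rw [M.symmetric j i, h]
  have key : ∀ {i j : I}, i ≠ j → M i j = 3 → ∀ x,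
      (M.psi b c d f i * M.psi b c d f j * M.psi b c d f i) x =
        M.phi b c d i (M.phi b c d j (M.phi b c d i x)) +
        (lkParam b c d * f j (M.phi b c d i x) + b * c * f j x) • M.rootVec R (simpleVec i) +
        (f j (M.phi b c d i x)) • (lkParam b c d • M.rootVec R (simpleVec j) +
          (c : R) • M.rootVec R (simpleVec i + simpleVec j)) +
        (b * c * f i x) • M.rootVec R (simpleVec j) := by
    intro i j hij h x
    have h' : M j i = 3 := by rw [M.symmetric j i, h]
    have e1 := phi_simpleVec_of_three hM b c d hij h
    have e2 := phi_simpleVec_add hM b c d hij.symm h'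
    have e3 := phi_simpleVec_of_three hM b c d hij.symm h'
    rw [add_comm (simpleVec j)] at e2 e3
    -- This is `f_i φ_j = f_j φ_i` at `e_{α_i}`, where `φ_i` vanishes.
    have e4 : lkParam b c d * f i (M.rootVec R (simpleVec i)) +
        c * f i (M.rootVec R (simpleVec i + simpleVec j)) = 0 := by
      have := hf.phi_three h (M.rootVec R (simpleVec i))
      rw [e1, phi_simpleVec, map_zero, map_add, map_smul, map_smul] at this
      simpa using this
    -- Moving `φ_j` across the forms produces `φ_i ^ 2`, which the quadratic relation reduces.
    have e5 : f i (M.phi b c d j (M.phi b c d i x)) =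
        lkParam b c d * f j (M.phi b c d i x) + b * c * f j x := by
      rw [hf.phi_three h, phi_phi hM, map_add, map_smul, map_smul, map_sub, map_smul,
        hf.simple hij.symm]
      simp [mul_assoc]
    simp only [Module.End.mul_apply, psi_apply, map_add, map_smul, e1, e2, e3, e5,
      phi_simpleVec, hf.simple hij, hf.simple hij.symm, add_zero, zero_add, zero_smul]
    linear_combination (norm := module) (f i x) • e4 • M.rootVec R (simpleVec i)
  refine LinearMap.ext fun x => ?_
  have hφ := LinearMap.congr_fun (phi_braid_of_three hM b c d hij h) x
  simp only [Module.End.mul_apply] at hφ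
  rw [key hij h, key hij.symm h', hφ, hf.phi_three h', add_comm (simpleVec j)]
  module

/-- The LK-representation. -/
noncomputable def psiRep (hf : M.IsLKFamily b c d f) :
    M.ArtinMonoid →* Module.End R (M.LKModule R) :=
  artinLift hM (M.psi b c d f) (fun _ _ => psi_comm_of_two hM hf)
    (fun _ _ => psi_braid_of_three hM hf)

theorem psiRep_gen (hf : M.IsLKFamily b c d f) (i : I) :
    psiRep hM hf (M.artinGen i) = M.psi b c d f i :=
  artinLift_gen hM _ _ _ i

theorem psiRep_gen_mul (hf : M.IsLKFamily b c d f) (i : I) (y : M.ArtinMonoid)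
    (x : M.LKModule R) :
    psiRep hM hf (M.artinGen i * y) x = M.psi b c d f i (psiRep hM hf y x) := by
  rw [map_mul, psiRep_gen, Module.End.mul_apply]

theorem psi_simpleVec (i : I) :
    M.psi b c d f i (M.rootVec R (simpleVec i)) =
      f i (M.rootVec R (simpleVec i)) • M.rootVec R (simpleVec i) := by
  rw [psi_apply, phi_simpleVec, zero_add]

include hM in
-- If `ψ_i x = 0`, then `φ_i x` is a multiple of `e_{α_i}` and `φ_i ^ 2 x = 0`. As `b c` is a unit,
-- the quadratic relation makes `x` a multiple of `e_{α_i}`, on which `ψ_i` is multiplication by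
-- `f_i(e_{α_i})`.
theorem psi_injective {i : I} (h : ∀ r : R, r * f i (M.rootVec R (simpleVec i)) = 0 → r = 0) :
    Function.Injective (M.psi b c d f i) := by
  rw [injective_iff_map_eq_zero]
  intro x hx
  have h1 := hx
  rw [psi_apply] at h1
  have h2 := phi_phi hM b c d i x
  rw [eq_neg_of_add_eq_zero_left h1, map_neg, map_smul, phi_simpleVec, smul_zero, neg_zero] at h2
  have h3 : x = (x (M.simpleRoot i) +
      (((b⁻¹ : Rˣ) : R) * ((c⁻¹ : Rˣ) : R)) * (lkParam b c d * f i x)) •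
        M.rootVec R (simpleVec i) := by
    have h4 := congrArg ((((b⁻¹ : Rˣ) : R) * ((c⁻¹ : Rˣ) : R)) • ·) h2
    have h5 : (((b⁻¹ : Rˣ) : R) * ((c⁻¹ : Rˣ) : R)) * (b * c) = 1 := by
      rw [mul_mul_mul_comm, Units.inv_mul, Units.inv_mul, one_mul]
    simp only [smul_zero, smul_add, smul_neg, smul_smul, h5, one_smul] at h4
    linear_combination (norm := module) -h4
  rw [h3, map_smul, psi_simpleVec, smul_smul] at hx
  have h6 := DFunLike.congr_fun hx (M.simpleRoot i)
  rw [Finsupp.smul_apply, rootVec_simpleVec_apply, smul_eq_mul, mul_one] at h6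
  rw [h3, h _ h6, zero_smul]

include hM in
theorem psi_bijective {i : I} (h : IsUnit (f i (M.rootVec R (simpleVec i)))) :
    Function.Bijective (M.psi b c d f i) := by
  refine ⟨psi_injective hM fun r hr => by simpa using h.mul_left_eq_zero.1 hr, fun y => ?_⟩
  have hrange : ∀ y, ∃ r : R, y + r • M.rootVec R (simpleVec i) ∈
      LinearMap.range (M.psi b c d f i) := by
    intro y
    have h1 := phi_phi hM b c d i y
    have h5 : (((b⁻¹ : Rˣ) : R) * ((c⁻¹ : Rˣ) : R)) * (b * c) = 1 := by
      rw [mul_mul_mul_comm, Units.inv_mul, Units.inv_mul, one_mul]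
    have h2 : ∃ s : R, ((b : R) * c) • y + s • M.rootVec R (simpleVec i) ∈
        LinearMap.range (M.psi b c d f i) := by
      -- By the quadratic relation, `ψ_i` maps `φ_i y - a y` to `b c y` modulo `e_{α_i}`.
      refine ⟨-(b * c * y (M.simpleRoot i)) + f i (M.phi b c d i y - lkParam b c d • y),
        M.phi b c d i y - lkParam b c d • y, ?_⟩
      rw [psi_apply, map_sub, map_smul, h1]
      module
    obtain ⟨s, hs⟩ := h2
    refine ⟨(((b⁻¹ : Rˣ) : R) * ((c⁻¹ : Rˣ) : R)) * s, ?_⟩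
    have := Submodule.smul_mem _ (((b⁻¹ : Rˣ) : R) * ((c⁻¹ : Rˣ) : R)) hs
    rwa [smul_add, smul_smul, h5, one_smul, smul_smul] at this
  obtain ⟨r, hr⟩ := hrange y
  have he : M.rootVec R (simpleVec i) ∈ LinearMap.range (M.psi b c d f i) := by
    obtain ⟨u, hu⟩ := h
    refine ⟨((u⁻¹ : Rˣ) : R) • M.rootVec R (simpleVec i), ?_⟩
    rw [map_smul, psi_simpleVec, ← hu, smul_smul, Units.inv_mul, one_smul]
  have := Submodule.sub_mem _ hr (Submodule.smul_mem _ r he)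
  rwa [add_sub_cancel_right] at this

theorem psiRep_injective (hf : M.IsLKFamily b c d f)
    (h : ∀ (i : I) (r : R), r * f i (M.rootVec R (simpleVec i)) = 0 → r = 0)
    (x : M.ArtinMonoid) : Function.Injective (psiRep hM hf x) := by
  induction x using artin_induction with
  | one => rw [map_one]; exact Function.injective_id
  | gen_mul i x ih =>
    intro y z hyz
    rw [psiRep_gen_mul, psiRep_gen_mul] at hyz
    exact ih (psi_injective hM (h i) hyz)

theorem psiRep_surjective (hf : M.IsLKFamily b c d f)
    (h : ∀ i, IsUnit (f i (M.rootVec R (simpleVec i))))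
    (x : M.ArtinMonoid) : Function.Surjective (psiRep hM hf x) := by
  induction x using artin_induction with
  | one => rw [map_one]; exact Function.surjective_id
  | gen_mul i x ih =>
    intro z
    obtain ⟨y, rfl⟩ := (psi_bijective (b := b) (c := c) (d := d) hM (h i)).2 z
    obtain ⟨y, rfl⟩ := ih y
    exact ⟨y, psiRep_gen_mul hM hf i x y⟩

end LKRepresentation

end CoxeterMatrix

namespace CoxeterMatrix

/-! ### Graph automorphisms acting on the Artin-Tits monoid. -/

section GraphAutomorphisms

variable {I : Type*} {M : CoxeterMatrix I}

theorem artinMap_gen (g : M.graphAut) (i : I) : M.artinMap g (M.artinGen i) = M.artinGen (g.1 i) :=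
  PresentedMonoid.lift_of _ _

theorem artinMap_dvd (g : M.graphAut) {i : I} {x : M.ArtinMonoid} (h : M.artinGen i ∣ x) :
    M.artinGen (g.1 i) ∣ M.artinMap g x := by
  rw [← artinMap_gen]
  exact map_dvd _ h

theorem alen_artinMap (g : M.graphAut) (x : M.ArtinMonoid) : alen (M.artinMap g x) = alen x := by
  induction x using artin_induction with
  | one => simp
  | gen_mul i x ih => simp [artinMap_gen, ih]

variable {G : Subgroup M.graphAut}

/-- The `G`-stable subsets of `I`. -/
def StableSet (G : Subgroup M.graphAut) (J : Set I) : Prop := ∀ g ∈ G, ∀ j ∈ J, g.1 j ∈ J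

theorem stableSet_orbit (i : I) : StableSet G (MulAction.orbit G i) := by
  rintro g hg _ ⟨k, rfl⟩
  exact ⟨⟨g, hg⟩ * k, rfl⟩

theorem StableSet.union {J K : Set I} (hJ : StableSet G J) (hK : StableSet G K) :
    StableSet G (J ∪ K) := by
  rintro g hg j (h | h)
  · exact Or.inl (hJ g hg j h)
  · exact Or.inr (hK g hg j h)

/-- Stability of `J` makes `g(D)` a common multiple of its generators, so `D` divides `g(D)`; the
two have the same length. -/
theorem IsGarside.mem_fixedMonoid {J : Set I} (hJ : StableSet G J) {D : M.ArtinMonoid}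
    (hD : M.IsGarside J D) : D ∈ M.fixedMonoid G := by
  intro g hg
  obtain ⟨z, hz⟩ := hD.2 (M.artinMap g D) fun j hj => by
    have := artinMap_dvd g (hD.1 _ (hJ g⁻¹ (G.inv_mem hg) j hj))
    rwa [show g.1 (g⁻¹.1 j) = j by simp] at this
  have := congrArg alen hz
  rw [alen_artinMap, alen_mul] at this
  rw [hz, eq_one_of_alen (x := z) (by omega), mul_one]

theorem mem_fixedMonoid_of_mul (hM : M.IsSmallType) {x y : M.ArtinMonoid}
    (hx : x ∈ M.fixedMonoid G) (hxy : x * y ∈ M.fixedMonoid G) : y ∈ M.fixedMonoid G := by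
  intro g hg
  have h := hxy g hg
  rw [map_mul, hx g hg] at h
  exact artin_mul_left_cancel hM h

theorem gen_dvd_of_mem_orbit {x : M.ArtinMonoid} (hx : x ∈ M.fixedMonoid G) {i j : I}
    (hj : j ∈ MulAction.orbit G i) (h : M.artinGen i ∣ x) : M.artinGen j ∣ x := by
  obtain ⟨g, rfl⟩ := hj
  have := artinMap_dvd g.1 h
  rwa [hx g.1 g.2] at this

/-- An element of `(B⁺)^G` divisible by `s_i` is divisible by the Garside element of the orbit of
`i`, in `(B⁺)^G`. -/
theorem exists_orbit_garside_dvd [Finite I] (hM : M.IsSmallType) {x : M.ArtinMonoid}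
    (hx : x ∈ M.fixedMonoid G) {i : I} (h : M.artinGen i ∣ x) :
    ∃ D ∈ M.fixedMonoid G, M.IsGarside (MulAction.orbit G i) D ∧ D ∣ x := by
  have hJ : ∀ j ∈ MulAction.orbit G i, M.artinGen j ∣ x := fun j hj =>
    gen_dvd_of_mem_orbit hx hj h
  obtain ⟨D, hD⟩ := exists_isGarside hM _ hJ
  exact ⟨D, hD.mem_fixedMonoid (stableSet_orbit i), hD, hD.2 x hJ⟩

end GraphAutomorphisms

/-! ### Equivariance of `ψ` and the twisted representation. -/

section Equivariance

variable {I : Type*} [Fintype I] [DecidableEq I] {M : CoxeterMatrix I} (hM : M.IsSmallType)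
variable {R : Type*} [CommRing R] {b c d : Rˣ} {f : I → Module.Dual R (M.LKModule R)}

variable (R) in
/-- The action of a graph automorphism on `V`. -/
noncomputable abbrev permLin (g : M.graphAut) : M.LKModule R →ₗ[R] M.LKModule R :=
  Finsupp.lmapDomain R R (M.rootMap g)

theorem comp_mem_posRoots (g : M.graphAut) {v : I → ℝ} (hv : v ∈ M.posRoots) :
    v ∘ ⇑(g.1⁻¹) ∈ M.posRoots :=
  (M.rootMap g ⟨v, hv⟩).2

theorem permLin_rootVec (g : M.graphAut) {v : I → ℝ} (hv : v ∈ M.posRoots) :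
    permLin R g (M.rootVec R v) = M.rootVec R (v ∘ ⇑(g.1⁻¹)) := by
  rw [rootVec, rootVec, dif_pos hv, dif_pos (comp_mem_posRoots g hv), basisVec, permLin,
    Finsupp.lmapDomain_apply, Finsupp.mapDomain_single]
  rfl

theorem refl_comp (g : M.graphAut) (i : I) (v : I → ℝ) :
    M.refl (g.1 i) (v ∘ ⇑(g.1⁻¹)) = M.refl i v ∘ ⇑(g.1⁻¹) := by
  rw [refl_def, refl_def, ← M.simpleVec_comp g i, rootForm_comp]
  rfl

theorem comp_injective (g : M.graphAut) :
    Function.Injective fun v : I → ℝ => v ∘ ⇑(g.1⁻¹) :=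
  (g.1⁻¹).surjective.injective_comp_right

include hM in
theorem phi_permLin (g : M.graphAut) (i : I) (x : M.LKModule R) :
    M.phi b c d (g.1 i) (permLin R g x) = permLin R g (M.phi b c d i x) := by
  have : M.phi b c d (g.1 i) ∘ₗ permLin R g = permLin R g ∘ₗ M.phi b c d i := by
    refine endo_ext fun v hv => ?_
    rw [LinearMap.comp_apply, LinearMap.comp_apply, permLin_rootVec g hv]
    by_cases hvi : v = simpleVec i
    · rw [hvi, M.simpleVec_comp, phi_simpleVec, phi_simpleVec, map_zero]
    · have hvi' : v ∘ ⇑(g.1⁻¹) ≠ simpleVec (g.1 i) := by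
        rw [← M.simpleVec_comp]
        exact (comp_injective g).ne hvi
      rw [phi_rootVec hM b c d hv hvi, phi_rootVec hM b c d (comp_mem_posRoots g hv) hvi',
        map_add, map_smul, map_smul, permLin_rootVec g hv,
        permLin_rootVec g (refl_mem_posRoots hM hv hvi), refl_comp, ← M.simpleVec_comp,
        rootForm_comp]
  exact LinearMap.congr_fun this x

variable {G : Subgroup M.graphAut}

theorem IsInvariantFamily.apply_permLin (hG : M.IsInvariantFamily G f) {g : M.graphAut} (hg : g ∈ G)
    (i : I) (x : M.LKModule R) : f (g.1 i) (permLin R g x) = f i x := by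
  have : f (g.1 i) ∘ₗ permLin R g = f i := by
    refine endo_ext fun v hv => ?_
    have := hG g hg i ⟨v, hv⟩
    rw [basisVec_eq_rootVec, basisVec_eq_rootVec] at this
    rw [LinearMap.comp_apply, permLin_rootVec g hv, this]
    rfl
  exact LinearMap.congr_fun this x

include hM in
theorem psi_permLin (hG : M.IsInvariantFamily G f) {g : M.graphAut} (hg : g ∈ G) (i : I)
    (x : M.LKModule R) :
    M.psi b c d f (g.1 i) (permLin R g x) = permLin R g (M.psi b c d f i x) := by
  rw [psi_apply, psi_apply, phi_permLin hM, hG.apply_permLin hg, map_add, map_smul,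
    permLin_rootVec g (simpleVec_mem_posRoots i), M.simpleVec_comp]

theorem psiRep_permLin (hf : M.IsLKFamily b c d f) (hG : M.IsInvariantFamily G f) {g : M.graphAut}
    (hg : g ∈ G) (y : M.ArtinMonoid) (x : M.LKModule R) :
    psiRep hM hf (M.artinMap g y) (permLin R g x) = permLin R g (psiRep hM hf y x) := by
  induction y using artin_induction with
  | one => simp
  | gen_mul i y ih =>
    rw [map_mul, artinMap_gen, psiRep_gen_mul, psiRep_gen_mul, ih, psi_permLin hM hG hg]

theorem psiRep_mem_fixedModule (hf : M.IsLKFamily b c d f) (hG : M.IsInvariantFamily G f)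
    {y : M.ArtinMonoid} (hy : y ∈ M.fixedMonoid G) {x : M.LKModule R}
    (hx : x ∈ M.fixedModule R G) : psiRep hM hf y x ∈ M.fixedModule R G := by
  intro g hg
  have := psiRep_permLin hM hf hG hg y x
  rw [hy g hg, permLin, hx g hg] at this
  exact this.symm

/-- The twisted LK-representation. -/
noncomputable def twistedRep (hf : M.IsLKFamily b c d f) (hG : M.IsInvariantFamily G f) :
    M.fixedMonoid G →* Module.End R (M.fixedModule R G) where
  toFun y := (psiRep hM hf y).restrict fun _ hx => psiRep_mem_fixedModule hM hf hG y.2 hx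
  map_one' := by
    ext x
    simp
  map_mul' y z := by
    refine LinearMap.ext fun x => Subtype.ext ?_
    simp

theorem twistedRep_apply (hf : M.IsLKFamily b c d f) (hG : M.IsInvariantFamily G f)
    (y : M.fixedMonoid G) (x : M.fixedModule R G) :
    (twistedRep hM hf hG y x : M.LKModule R) = psiRep hM hf y x := rfl

theorem twistedRep_injective_apply (hf : M.IsLKFamily b c d f) (hG : M.IsInvariantFamily G f)
    (h : ∀ (i : I) (r : R), r * f i (M.rootVec R (simpleVec i)) = 0 → r = 0)
    (y : M.fixedMonoid G) : Function.Injective (twistedRep hM hf hG y) := fun _ _ huv =>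
  Subtype.ext (psiRep_injective hM hf h y (congrArg Subtype.val huv))

/-- The preimage in `V` of a fixed vector is itself fixed, by equivariance and injectivity of `ψ_y`.
-/
theorem twistedRep_surjective_apply (hf : M.IsLKFamily b c d f) (hG : M.IsInvariantFamily G f)
    (h : ∀ i, IsUnit (f i (M.rootVec R (simpleVec i))))
    (y : M.fixedMonoid G) : Function.Surjective (twistedRep hM hf hG y) := by
  have hinj := psiRep_injective hM hf fun i r hr => (h i).mul_left_eq_zero.1 hr
  intro v
  obtain ⟨u, hu⟩ := psiRep_surjective hM hf h y v
  refine ⟨⟨u, fun g hg => hinj y ?_⟩, Subtype.ext hu⟩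
  have := psiRep_permLin hM hf hG hg y u
  rw [y.2 g hg, hu] at this
  rw [hu]
  exact this.trans (v.2 g hg)

end Equivariance

/-! ### Change of scalars. -/

section BaseChange

variable {I : Type*} [Fintype I] [DecidableEq I] {M : CoxeterMatrix I} (hM : M.IsSmallType)
variable {R S : Type*} [CommRing R] [CommRing S] (h : R →+* S)
variable {b c d : Rˣ} {f : I → Module.Dual R (M.LKModule R)}

variable (M) in
/-- The base change of vectors along a ring homomorphism. -/
noncomputable def baseMap : M.LKModule R →+ M.LKModule S :=
  Finsupp.mapRange.addMonoidHom h.toAddMonoidHom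

theorem baseMap_apply (x : M.LKModule R) (β : M.PosRoot) : M.baseMap h x β = h (x β) := rfl

theorem baseMap_smul (r : R) (x : M.LKModule R) : M.baseMap h (r • x) = h r • M.baseMap h x := by
  ext β
  simp [baseMap_apply]

theorem baseMap_rootVec (v : I → ℝ) : M.baseMap h (M.rootVec R v) = M.rootVec S v := by
  by_cases hv : v ∈ M.posRoots
  · ext β
    classical
    rw [baseMap_apply, rootVec_apply hv, rootVec_apply hv]
    split_ifs <;> simp
  · rw [rootVec, rootVec, dif_neg hv, dif_neg hv, map_zero]

theorem baseMap_injective (hh : Function.Injective h) : Function.Injective (M.baseMap h) :=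
  Finsupp.mapRange_injective _ (map_zero h) hh

theorem baseMap_permLin (g : M.graphAut) (x : M.LKModule R) :
    M.baseMap h (permLin R g x) = permLin S g (M.baseMap h x) := by
  induction x using lkModule_induction with
  | zero => simp
  | add x y hx hy => rw [map_add, map_add, hx, hy, map_add, map_add]
  | smul r x hx => rw [map_smul, baseMap_smul, baseMap_smul, hx, map_smul]
  | root v hv => rw [permLin_rootVec g hv, baseMap_rootVec, baseMap_rootVec, permLin_rootVec g hv]

theorem baseMap_mem_fixedModule {G : Subgroup M.graphAut} {x : M.LKModule R}
    (hx : x ∈ M.fixedModule R G) : M.baseMap h x ∈ M.fixedModule S G := fun g hg => by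
  have := baseMap_permLin h g x
  rw [permLin, hx g hg] at this
  exact this.symm

variable (b c d) in
theorem map_lkParam : h (lkParam b c d) = lkParam (Units.map (h : R →* S) b)
    (Units.map (h : R →* S) c) (Units.map (h : R →* S) d) := by
  simp only [lkParam, map_sub, map_mul, Units.coe_map, MonoidHom.coe_coe, ← map_inv]

include hM in
theorem baseMap_phi (i : I) (x : M.LKModule R) :
    M.baseMap h (M.phi b c d i x) = M.phi (Units.map (h : R →* S) b)
      (Units.map (h : R →* S) c) (Units.map (h : R →* S) d) i (M.baseMap h x) := by
  induction x using lkModule_induction with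
  | zero => simp
  | add x y hx hy => rw [map_add, map_add, hx, hy, map_add, map_add]
  | smul r x hx => rw [map_smul, baseMap_smul, baseMap_smul, hx, map_smul]
  | root v hv =>
    by_cases hvi : v = simpleVec i
    · rw [hvi, phi_simpleVec, baseMap_rootVec, phi_simpleVec, map_zero]
    · have h1 : ∀ p : ℝ, h (diagCoeff b c d p) = diagCoeff (Units.map (h : R →* S) b)
          (Units.map (h : R →* S) c) (Units.map (h : R →* S) d) p := by
        intro p
        unfold diagCoeff
        split_ifs
        · rfl
        · exact map_lkParam h b c d
        · exact map_zero h
      have h2 : ∀ p : ℝ, h (offCoeff b c p) = offCoeff (Units.map (h : R →* S) b)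
          (Units.map (h : R →* S) c) p := by
        intro p
        unfold offCoeff
        split_ifs
        · exact map_zero h
        · rfl
        · rfl
      rw [phi_rootVec hM b c d hv hvi, map_add, baseMap_smul, baseMap_smul, baseMap_rootVec,
        baseMap_rootVec, phi_rootVec hM _ _ _ hv hvi, h1, h2]

theorem map_apply_eq {f' : I → Module.Dual S (M.LKModule S)}
    (hf' : ∀ i, ∀ v ∈ M.posRoots, f' i (M.rootVec S v) = h (f i (M.rootVec R v))) (i : I)
    (x : M.LKModule R) : h (f i x) = f' i (M.baseMap h x) := by
  induction x using lkModule_induction with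
  | zero => simp
  | add x y hx hy => rw [map_add, map_add, hx, hy, map_add, map_add]
  | smul r x hx => rw [map_smul, baseMap_smul, smul_eq_mul, map_mul, hx, map_smul, smul_eq_mul]
  | root v hv => rw [baseMap_rootVec, hf' i v hv]

include hM in
theorem baseMap_psi {f' : I → Module.Dual S (M.LKModule S)}
    (hf' : ∀ i, ∀ v ∈ M.posRoots, f' i (M.rootVec S v) = h (f i (M.rootVec R v))) (i : I)
    (x : M.LKModule R) :
    M.baseMap h (M.psi b c d f i x) = M.psi (Units.map (h : R →* S) b)
      (Units.map (h : R →* S) c) (Units.map (h : R →* S) d) f' i (M.baseMap h x) := by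
  rw [psi_apply, psi_apply, map_add, baseMap_phi hM, baseMap_smul, baseMap_rootVec,
    map_apply_eq h hf']

/-- Serves twice: with `f' = 0`, to specialise to the ordered ring, and with the extended forms, to
compare `R` with an overring. -/
theorem baseMap_psiRep (hf : M.IsLKFamily b c d f) {f' : I → Module.Dual S (M.LKModule S)}
    (hf' : M.IsLKFamily (Units.map (h : R →* S) b) (Units.map (h : R →* S) c)
      (Units.map (h : R →* S) d) f')
    (hff' : ∀ i, ∀ v ∈ M.posRoots, f' i (M.rootVec S v) = h (f i (M.rootVec R v)))
    (y : M.ArtinMonoid) (x : M.LKModule R) :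
    M.baseMap h (psiRep hM hf y x) = psiRep hM hf' y (M.baseMap h x) := by
  induction y using artin_induction with
  | one => simp
  | gen_mul i y ih => rw [psiRep_gen_mul, psiRep_gen_mul, baseMap_psi hM h hff', ih]

theorem isLKFamily_zero : M.IsLKFamily b c d (0 : I → Module.Dual R (M.LKModule R)) where
  apply_simple _ _ _ := rfl
  comp_two _ _ _ := by simp
  comp_three _ _ _ := by simp

include hM in
theorem isLKFamily_baseChange (hf : M.IsLKFamily b c d f) {f' : I → Module.Dual S (M.LKModule S)}
    (hff' : ∀ i, ∀ v ∈ M.posRoots, f' i (M.rootVec S v) = h (f i (M.rootVec R v))) :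
    M.IsLKFamily (Units.map (h : R →* S) b) (Units.map (h : R →* S) c)
      (Units.map (h : R →* S) d) f' := by
  refine ⟨fun i j hij => ?_, fun i j hij => endo_ext fun v hv => ?_,
    fun i j hij => endo_ext fun v hv => ?_⟩
  · rw [basisVec_simpleRoot, hff' i _ (simpleVec_mem_posRoots j), hf.simple hij, map_zero]
  · rw [LinearMap.comp_apply, ← baseMap_rootVec h, ← baseMap_phi hM, ← map_apply_eq h hff', hf.phi_two hij,
      LinearMap.smul_apply, ← map_apply_eq h hff', map_mul]
    rfl
  · rw [LinearMap.comp_apply, LinearMap.comp_apply, ← baseMap_rootVec h, ← baseMap_phi hM,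
      ← baseMap_phi hM, ← map_apply_eq h hff', ← map_apply_eq h hff', hf.phi_three hij]

theorem isInvariantFamily_baseChange {G : Subgroup M.graphAut} (hG : M.IsInvariantFamily G f)
    {f' : I → Module.Dual S (M.LKModule S)}
    (hff' : ∀ i, ∀ v ∈ M.posRoots, f' i (M.rootVec S v) = h (f i (M.rootVec R v))) :
    M.IsInvariantFamily G f' := by
  intro g hg i α
  have := hG g hg i α
  rw [basisVec_eq_rootVec, basisVec_eq_rootVec] at this ⊢
  rw [hff' _ _ α.2, hff' _ _ (M.rootMap g α).2, this]

end BaseChange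

end CoxeterMatrix

namespace CoxeterMatrix

/-! ### Positivity of `φ` and detection of left divisors. -/

section Positivity

variable {I : Type*} [Fintype I] [DecidableEq I] {M : CoxeterMatrix I} (hM : M.IsSmallType)

theorem simpleRoot_val (i : I) : (M.simpleRoot i).1 = simpleVec i := rfl

section Coordinates

variable {R : Type*} [CommRing R] (b c d : Rˣ)

include hM in
theorem phi_apply_simpleRoot (i : I) (x : M.LKModule R) :
    M.phi b c d i x (M.simpleRoot i) = 0 := by
  induction x using lkModule_induction with
  | zero => simp
  | add x y hx hy => rw [map_add, Finsupp.add_apply, hx, hy, add_zero]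
  | smul r x hx => rw [map_smul, Finsupp.smul_apply, hx, smul_zero]
  | root v hv =>
    by_cases hvi : v = simpleVec i
    · rw [hvi, phi_simpleVec]
      rfl
    · rw [phi_rootVec hM b c d hv hvi, Finsupp.add_apply, Finsupp.smul_apply, Finsupp.smul_apply,
        rootVec_apply_of_ne hv (β := M.simpleRoot i) hvi,
        rootVec_apply_of_ne (refl_mem_posRoots hM hv hvi) (β := M.simpleRoot i)
          (refl_ne_simpleVec_self hM hv i)]
      simp

include hM in
-- The transpose of `phi_rootVec`: the off-diagonal contribution to the coordinate `β` comes from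
-- `s_i β`, where the form with `α_i` has the opposite sign.
theorem phi_apply_of_ne {i : I} {β β' : M.PosRoot} (hβ : β.1 ≠ simpleVec i)
    (hβ' : β'.1 = M.refl i β.1) (x : M.LKModule R) :
    M.phi b c d i x β = diagCoeff b c d (M.rootForm β.1 (simpleVec i)) * x β +
      offCoeff b c (-M.rootForm β.1 (simpleVec i)) * x β' := by
  induction x using lkModule_induction with
  | zero => simp
  | add x y hx hy =>
    rw [map_add, Finsupp.add_apply, hx, hy, Finsupp.add_apply, Finsupp.add_apply]
    ring
  | smul r x hx =>
    rw [map_smul, Finsupp.smul_apply, hx, Finsupp.smul_apply, Finsupp.smul_apply]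
    simp only [smul_eq_mul]
    ring
  | root v hv =>
    classical
    by_cases hvi : v = simpleVec i
    · subst hvi
      have h1 : simpleVec i ≠ β'.1 := by
        rw [hβ']
        exact (refl_ne_simpleVec_self hM β.2 i).symm
      rw [phi_simpleVec, rootVec_apply_of_ne hv hβ.symm, rootVec_apply_of_ne hv h1]
      simp
    · have h1 : M.refl i v = β.1 ↔ v = β'.1 := by
        rw [hβ']
        constructor
        · intro h
          rw [← h, M.refl_refl]
        · rintro rfl
          rw [M.refl_refl]
      rw [phi_rootVec hM b c d hv hvi, Finsupp.add_apply, Finsupp.smul_apply, Finsupp.smul_apply,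
        rootVec_apply hv, rootVec_apply hv, rootVec_apply (refl_mem_posRoots hM hv hvi)]
      simp only [h1]
      congr 1
      · split_ifs with h
        · rw [h]; simp
        · simp
      · split_ifs with h
        · rw [h, hβ', rootForm_refl_self]
          simp
        · simp

end Coordinates

variable {R : Type*} [CommRing R] [LinearOrder R] [IsStrictOrderedRing R] {b c d : Rˣ}

theorem psi_zero_apply (i : I) (x : M.LKModule R) :
    M.psi b c d 0 i x = M.phi b c d i x := by
  rw [psi_apply]
  simp

variable (b c d) in
/-- The representation `φ` of the Artin-Tits monoid, the LK-representation of the zero family. -/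
noncomputable def phiRep : M.ArtinMonoid →* Module.End R (M.LKModule R) :=
  psiRep hM (isLKFamily_zero (b := b) (c := c) (d := d))

theorem phiRep_gen_mul (i : I) (y : M.ArtinMonoid) (x : M.LKModule R) :
    phiRep hM b c d (M.artinGen i * y) x = M.phi b c d i (phiRep hM b c d y x) := by
  rw [phiRep, psiRep_gen_mul, psi_zero_apply]

theorem diagCoeff_nonneg (ha : 0 < lkParam b c d) (hd : (0 : R) < d) (p : ℝ) :
    (0 : R) ≤ diagCoeff b c d p := by
  unfold diagCoeff
  split_ifs
  exacts [hd.le, ha.le, le_rfl]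

theorem offCoeff_nonneg (hb : (0 : R) < b) (hc : (0 : R) < c) (p : ℝ) :
    (0 : R) ≤ offCoeff b c p := by
  unfold offCoeff
  split_ifs
  exacts [le_rfl, hc.le, hb.le]

variable (ha : 0 < lkParam b c d) (hb : (0 : R) < b) (hc : (0 : R) < c) (hd : (0 : R) < d)
include ha hb hc hd

theorem phiRep_nonneg (y : M.ArtinMonoid) {x : M.LKModule R} (hx : ∀ β, 0 ≤ x β) (β : M.PosRoot) :
    0 ≤ phiRep hM b c d y x β := by
  induction y using artin_induction generalizing β with
  | one => simpa using hx β
  | gen_mul i y ih =>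
    rw [phiRep_gen_mul]
    by_cases hβ : β = M.simpleRoot i
    · rw [hβ, phi_apply_simpleRoot hM]
    · have hβ1 : β.1 ≠ simpleVec i := fun h => hβ (Subtype.ext h)
      rw [phi_apply_of_ne hM b c d hβ1 (β' := ⟨_, refl_mem_posRoots hM β.2 hβ1⟩) rfl]
      exact add_nonneg (mul_nonneg (diagCoeff_nonneg ha hd _) (ih _))
        (mul_nonneg (offCoeff_nonneg hb hc _) (ih _))

theorem rootVec_nonneg (v : I → ℝ) (β : M.PosRoot) : 0 ≤ M.rootVec R v β := by
  classical
  by_cases hv : v ∈ M.posRoots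
  · rw [rootVec_apply hv]
    split_ifs
    · exact zero_le_one
    · exact le_rfl
  · rw [rootVec, dif_neg hv]
    exact le_rfl

/-- If the image of `φ_y` has no component along `e_{α_i}`, then `s_i` divides `y`. -/
theorem gen_dvd_of_phiRep_apply_eq_zero {y : M.ArtinMonoid} {i : I}
    (h : ∀ v ∈ M.posRoots, phiRep hM b c d y (M.rootVec R v) (M.simpleRoot i) = 0) :
    M.artinGen i ∣ y := by
  induction hn : alen y using Nat.strong_induction_on generalizing y i with
  | _ n ih =>
    subst hn
    rcases eq_one_or_exists_gen_mul y with rfl | ⟨j, y, rfl⟩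
    · have := h _ (simpleVec_mem_posRoots i)
      rw [map_one, Module.End.one_apply, rootVec_simpleVec_apply] at this
      exact absurd this one_ne_zero
    simp only [phiRep_gen_mul] at h
    rcases hM.cases i j with rfl | ⟨hij, h2, h2'⟩ | ⟨hij, h3, h3'⟩
    · exact Dvd.intro y rfl
    -- Here `s_j` fixes `α_i`, so `φ_j` multiplies the coordinate along `α_i` by the unit `d`, and
    -- the vanishing passes to the shorter element.
    · obtain ⟨z, rfl⟩ := ih (alen y) (by simp) (y := y) (i := i) (fun v hv => by
        have := h v hv
        rw [phi_apply_of_ne hM b c d (β := M.simpleRoot i) (β' := M.simpleRoot i)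
          (simpleVec_injective.ne hij) (refl_simpleVec_of_two h2).symm] at this
        simp only [simpleRoot_val, M.rootForm_two h2, diagCoeff, offCoeff] at this
        simpa using this) rfl
      exact ⟨M.artinGen j * z, gen_comm h2' z⟩
    · let γ : M.PosRoot := ⟨_, simpleVec_add_mem_posRoots hM hij h3⟩
      -- The coordinate of `φ_j x` along `α_i` is `a` times that of `x` along `α_i` plus `b` times
      -- that along `α_i + α_j`. Both terms are nonnegative, so both vanish.
      have hdecomp : ∀ v ∈ M.posRoots, phiRep hM b c d y (M.rootVec R v) (M.simpleRoot i) = 0 ∧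
          phiRep hM b c d y (M.rootVec R v) γ = 0 := by
        intro v hv
        have h0 := h v hv
        rw [phi_apply_of_ne hM b c d (β := M.simpleRoot i) (β' := γ)
          (simpleVec_injective.ne hij) (refl_simpleVec_of_three h3).symm] at h0
        simp only [simpleRoot_val, M.rootForm_three h3, diagCoeff, offCoeff] at h0
        have h1 := phiRep_nonneg hM ha hb hc hd y (rootVec_nonneg ha hb hc hd v) (M.simpleRoot i)
        have h2 := phiRep_nonneg hM ha hb hc hd y (rootVec_nonneg ha hb hc hd v) γ
        norm_num [(zero_lt_one (α := ℝ)).not_gt] at h0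
        rw [add_eq_zero_iff_of_nonneg (mul_nonneg ha.le h1) (mul_nonneg hb.le h2)] at h0
        exact ⟨(mul_eq_zero.1 h0.1).resolve_left ha.ne', (mul_eq_zero.1 h0.2).resolve_left hb.ne'⟩
      obtain ⟨z, rfl⟩ := ih (alen y) (by simp) (y := y) (i := i) (fun v hv => (hdecomp v hv).1) rfl
      -- The coordinate of `φ_i x` along `α_i + α_j` is `c` times that of `x` along `α_j`, so `s_j`
      -- divides `z` and the original element is `s_j s_i s_j t`.
      obtain ⟨t, rfl⟩ := ih (alen z) (by simp; omega) (y := z) (i := j) (fun v hv => by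
        have h0 := (hdecomp v hv).2
        have hγ : γ.1 ≠ simpleVec i := simpleVec_add_ne i j
        have hγ' : M.refl i γ.1 = simpleVec j := by
          have := refl_simpleVec_add h3'
          rwa [add_comm] at this
        have hγ'' : M.rootForm γ.1 (simpleVec i) = 1 := by
          have := rootForm_simpleVec_add h3'
          rwa [add_comm] at this
        rw [phiRep_gen_mul, phi_apply_of_ne hM b c d hγ (β' := M.simpleRoot j) hγ'.symm,
          hγ''] at h0
        simp only [diagCoeff, offCoeff] at h0
        norm_num [(zero_lt_one (α := ℝ)).not_gt] at h0
        exact h0) rfl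
      exact ⟨M.artinGen j * (M.artinGen i * t), gen_braid h3' t⟩

end Positivity

/-! ### The faithfulness criterion. -/

section Faithfulness

variable {I : Type*} [Fintype I] [DecidableEq I] {M : CoxeterMatrix I} (hM : M.IsSmallType)
variable {R : Type*} [CommRing R] {b c d : Rˣ} {f : I → Module.Dual R (M.LKModule R)}
variable {G : Subgroup M.graphAut}

theorem permLin_mul (g h : M.graphAut) (x : M.LKModule R) :
    permLin R (g * h) x = permLin R g (permLin R h x) := by
  simp only [permLin, Finsupp.lmapDomain_apply]
  rw [← Finsupp.mapDomain_comp]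
  congr 1

theorem sum_permLin_mem [Fintype G] (x : M.LKModule R) :
    ∑ g : G, permLin R g.1 x ∈ M.fixedModule R G := by
  intro g hg
  rw [map_sum]
  exact Fintype.sum_equiv (Equiv.mulLeft (⟨g, hg⟩ : G)) _ _ fun k => (permLin_mul g k.1 x).symm

/-- The faithfulness criterion. -/
theorem twisted_injective (hf : M.IsLKFamily b c d f) (hG : M.IsInvariantFamily G f)
    (hcancel : IsLeftCancelMul (MonoidHom.mrange (twistedRep hM hf hG)))
    {R₀ : Type*} [CommRing R₀] [LinearOrder R₀] [IsStrictOrderedRing R₀] (h : R →+* R₀)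
    (ha : 0 < h (lkParam b c d)) (hb : 0 < h b) (hc : 0 < h c) (hd : 0 < h d)
    (hf0 : ∀ (i : I) (α : M.PosRoot), h (f i (M.basisVec α)) = 0) :
    Function.Injective (twistedRep hM hf hG) := by
  have hfin : Finite G := inferInstance
  have := Fintype.ofFinite G
  rw [map_lkParam] at ha
  have hbase := baseMap_psiRep hM h hf isLKFamily_zero (fun i v hv => by
    have := hf0 i ⟨v, hv⟩
    rw [basisVec_eq_rootVec] at this
    rw [this]
    rfl)
  have hdvd : ∀ x y : M.fixedMonoid G, twistedRep hM hf hG x = twistedRep hM hf hG y → ∀ i,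
      M.artinGen i ∣ x.1 → M.artinGen i ∣ y.1 := by
    rintro x y hxy i ⟨z, hz⟩
    refine gen_dvd_of_phiRep_apply_eq_zero (R := R₀) (b := Units.map (h : R →* R₀) b)
      (c := Units.map (h : R →* R₀) c) (d := Units.map (h : R →* R₀) d) hM ha hb hc hd
      fun v hv => ?_
    -- The sum over `G` of the translates of `e_v` is an invariant vector, on which the two
    -- operators agree.
    have h1 : psiRep hM hf x.1 (∑ g : G, permLin R g.1 (M.rootVec R v)) =
        psiRep hM hf y.1 (∑ g : G, permLin R g.1 (M.rootVec R v)) :=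
      congrArg Subtype.val (LinearMap.congr_fun hxy ⟨_, sum_permLin_mem (M.rootVec R v)⟩)
    replace h1 := congrArg (M.baseMap h) h1
    rw [hbase, hbase, map_sum] at h1
    simp only [baseMap_permLin, baseMap_rootVec] at h1
    have h2 := DFunLike.congr_fun h1 (M.simpleRoot i)
    -- Over `R₀` the first factor `φ_i` kills the coordinate along `α_i` on the side of `x`. On the
    -- side of `y` it is a sum of nonnegative terms, so each is zero; the term `g = 1` is the one
    -- for `e_v`.
    rw [hz, psiRep_gen_mul, psi_zero_apply, phi_apply_simpleRoot hM, map_sum,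
      Finsupp.finsetSum_apply] at h2
    have h3 := (Finset.sum_eq_zero_iff_of_nonneg fun g _ => ?_).1 h2.symm (1 : G)
      (Finset.mem_univ _)
    · rw [permLin_rootVec _ hv] at h3
      exact h3
    · rw [permLin_rootVec _ hv]
      exact phiRep_nonneg hM ha hb hc hd y.1 (rootVec_nonneg ha hb hc hd _) _
  intro x y hxy
  induction hn : alen x.1 using Nat.strong_induction_on generalizing x y with
  | _ n ih =>
    subst hn
    rcases eq_one_or_exists_gen_mul x.1 with hx | ⟨i, x', hx⟩
    · rcases eq_one_or_exists_gen_mul y.1 with hy | ⟨i, y', hy⟩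
      · exact Subtype.ext (hx.trans hy.symm)
      · obtain ⟨z, hz⟩ := hdvd y x hxy.symm i (Dvd.intro y' hy.symm)
        rw [hx] at hz
        have := congrArg alen hz
        simp at this
        omega
    · have hix : M.artinGen i ∣ x.1 := Dvd.intro x' hx.symm
      obtain ⟨D, hDG, hD, u, hu⟩ := exists_orbit_garside_dvd hM x.2 hix
      obtain ⟨v, hv⟩ := hD.2 y.1 fun j hj =>
        gen_dvd_of_mem_orbit y.2 hj (hdvd x y hxy i hix)
      have huG : u ∈ M.fixedMonoid G := mem_fixedMonoid_of_mul hM hDG (hu ▸ x.2)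
      have hvG : v ∈ M.fixedMonoid G := mem_fixedMonoid_of_mul hM hDG (hv ▸ y.2)
      obtain rfl : x = ⟨D, hDG⟩ * ⟨u, huG⟩ := Subtype.ext hu
      obtain rfl : y = ⟨D, hDG⟩ * ⟨v, hvG⟩ := Subtype.ext hv
      rw [map_mul, map_mul] at hxy
      -- The common factor `D` is cancelled inside the image, where cancellation is assumed. Since
      -- `s_i` divides `D`, the length drops.
      have huv : twistedRep hM hf hG ⟨u, huG⟩ = twistedRep hM hf hG ⟨v, hvG⟩ :=
        congrArg Subtype.val (hcancel.mul_left_cancel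
          (⟨_, ⟨D, hDG⟩, rfl⟩ : MonoidHom.mrange (twistedRep hM hf hG))
          (a₁ := ⟨_, ⟨u, huG⟩, rfl⟩) (a₂ := ⟨_, ⟨v, hvG⟩, rfl⟩) (Subtype.ext hxy))
      obtain ⟨t, ht⟩ := hD.1 i (MulAction.mem_orbit_self i)
      have hl : 0 < alen D := by
        rw [ht]
        simp
      rw [ih (alen u) (by simp; omega) huv rfl]

/-- Injective operators can be cancelled on the left. -/
theorem isLeftCancelMul_mrange_twistedRep (hf : M.IsLKFamily b c d f)
    (hG : M.IsInvariantFamily G f)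
    (h : ∀ (i : I) (r : R), r * f i (M.rootVec R (simpleVec i)) = 0 → r = 0) :
    IsLeftCancelMul (MonoidHom.mrange (twistedRep hM hf hG)) := by
  refine ⟨?_⟩
  rintro ⟨_, x, rfl⟩ ⟨u, hu⟩ ⟨v, hv⟩ huv
  refine Subtype.ext (LinearMap.ext fun w => ?_)
  exact twistedRep_injective_apply hM hf hG h x (LinearMap.congr_fun (congrArg Subtype.val huv) w)

end Faithfulness

end CoxeterMatrix

namespace CoxeterMatrix

/-! ### Reduced elements and Matsumoto's theorem. -/

section ReducedElements

variable {I : Type*} [Fintype I] [DecidableEq I] {M : CoxeterMatrix I} (hM : M.IsSmallType)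

/-- The simple reflection of index `i` is a left descent of `w`. -/
abbrev LeftDesc (w : M.Group) (i : I) : Prop := M.toCoxeterSystem.IsLeftDescent w i

theorem LeftDesc.len {w : M.Group} {i : I} (h : LeftDesc w i) :
    M.len (M.simple i * w) + 1 = M.len w :=
  M.toCoxeterSystem.isLeftDescent_iff.1 h

theorem len_of_not_leftDesc {w : M.Group} {i : I} (h : ¬ LeftDesc w i) :
    M.len (M.simple i * w) = M.len w + 1 :=
  M.toCoxeterSystem.not_isLeftDescent_iff.1 h

theorem leftDesc_iff_len {w : M.Group} {i : I} :
    LeftDesc w i ↔ M.len (M.simple i * w) < M.len w := Iff.rfl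

theorem leftDesc_inv_iff {w : M.Group} {i : I} : LeftDesc w⁻¹ i ↔ RightDesc w i :=
  M.toCoxeterSystem.isLeftDescent_inv_iff

theorem leftDesc_iff {w : M.Group} {i : I} : LeftDesc w i ↔ act hM w⁻¹ (simpleVec i) ≤ 0 := by
  rw [← rightDesc_iff, ← leftDesc_inv_iff, inv_inv]

theorem not_leftDesc_iff {w : M.Group} {i : I} :
    ¬ LeftDesc w i ↔ 0 ≤ act hM w⁻¹ (simpleVec i) := by
  rw [← not_rightDesc_iff, ← leftDesc_inv_iff, inv_inv]

/-- The projection of the Artin-Tits monoid to the Coxeter group. -/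
def toW (hM : M.IsSmallType) : M.ArtinMonoid →* M.Group :=
  artinLift hM M.simple (fun _ _ _ => simple_comm_of_two) (fun _ _ _ => simple_braid_of_three)

theorem toW_gen (i : I) : toW hM (M.artinGen i) = M.simple i := artinLift_gen hM _ _ _ i

theorem len_mul_le (w w' : M.Group) : M.len (w * w') ≤ M.len w + M.len w' :=
  M.toCoxeterSystem.length_mul_le w w'

theorem len_one : M.len 1 = 0 := M.toCoxeterSystem.length_one

theorem len_simple (i : I) : M.len (M.simple i) = 1 := M.toCoxeterSystem.length_simple i

theorem len_toW_le (x : M.ArtinMonoid) : M.len (toW hM x) ≤ alen x := by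
  induction x using artin_induction with
  | one => simp
  | gen_mul i x ih =>
    have := len_mul_le (M.simple i) (toW hM x)
    rw [len_simple] at this
    rw [map_mul, toW_gen, alen_mul, alen_gen]
    omega

/-- An element of the Artin-Tits monoid is reduced if its words are reduced. -/
def IsRed (x : M.ArtinMonoid) : Prop := M.len (toW hM x) = alen x

variable {hM}

theorem IsRed.of_mul {x y : M.ArtinMonoid} (h : IsRed hM (x * y)) : IsRed hM x ∧ IsRed hM y := by
  have h1 := len_mul_le (toW hM x) (toW hM y)
  have h2 := len_toW_le hM x
  have h3 := len_toW_le hM y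
  unfold IsRed at *
  rw [map_mul, alen_mul] at h
  omega

theorem IsRed.of_dvd {x y : M.ArtinMonoid} (h : IsRed hM y) (hxy : x ∣ y) : IsRed hM x := by
  obtain ⟨z, rfl⟩ := hxy
  exact h.of_mul.1

theorem IsRed.leftDesc {x : M.ArtinMonoid} (h : IsRed hM x) {i : I} (hi : M.artinGen i ∣ x) :
    LeftDesc (toW hM x) i := by
  obtain ⟨y, rfl⟩ := hi
  have h1 := len_toW_le hM y
  rw [IsRed] at h
  rw [leftDesc_iff_len, h, map_mul, toW_gen, simple_mul_cancel]
  simp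
  omega

theorem IsRed.not_leftDesc {i : I} {x : M.ArtinMonoid} (h : IsRed hM (M.artinGen i * x)) :
    ¬ LeftDesc (toW hM x) i := by
  have h1 := h.of_mul.2
  rw [IsRed] at h h1
  rw [leftDesc_iff_len, h1, ← toW_gen hM, ← map_mul, h]
  simp

variable (hM)

theorem isRed_gen_mul {i : I} {x : M.ArtinMonoid} (h : IsRed hM x)
    (hi : ¬ LeftDesc (toW hM x) i) : IsRed hM (M.artinGen i * x) := by
  rw [IsRed] at h ⊢
  rw [map_mul, toW_gen, len_of_not_leftDesc hi, h]
  simp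
  omega

theorem exists_isRed (w : M.Group) : ∃ x, IsRed hM x ∧ toW hM x = w := by
  induction hn : M.len w using Nat.strong_induction_on generalizing w with
  | _ n ih =>
    subst hn
    by_cases hw : w = 1
    · exact ⟨1, by simp [IsRed], by rw [hw, map_one]⟩
    · obtain ⟨i, hi⟩ := M.toCoxeterSystem.exists_leftDescent_of_ne_one hw
      have hl := LeftDesc.len hi
      obtain ⟨x, hx, hxw⟩ := ih _ (by omega) (M.simple i * w) rfl
      refine ⟨M.artinGen i * x, isRed_gen_mul hM hx ?_, ?_⟩
      · rw [hxw, leftDesc_iff_len, simple_mul_cancel]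
        omega
      · rw [map_mul, toW_gen, hxw, simple_mul_cancel]

include hM in
theorem exists_eq_of_leftDesc_of_two {w : M.Group} {i j : I} (h : M i j = 2)
    (hi : LeftDesc w i) (hj : LeftDesc w j) :
    ∃ u, w = M.simple i * (M.simple j * u) ∧ M.len u + 2 = M.len w := by
  have h1 : LeftDesc (M.simple i * w) j := by
    rw [leftDesc_iff hM] at hj ⊢
    rwa [mul_inv_rev, simple_inv, act_mul_apply, act_simple_apply,
      refl_simpleVec_of_two (by rw [M.symmetric, h])]
  refine ⟨M.simple j * (M.simple i * w), by simp only [simple_mul_cancel], ?_⟩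
  have := hi.len
  have := h1.len
  omega

include hM in
-- Descents are signs of `w⁻¹` on simple roots. Once `s_i` is removed, the sign at `α_j` is that of
-- `w⁻¹(α_i + α_j)`, a sum of nonpositive vectors; once `s_j` is removed too, the sign at `α_i` is
-- that of `w⁻¹ α_j`.
theorem exists_eq_of_leftDesc_of_three {w : M.Group} {i j : I} (h : M i j = 3)
    (hi : LeftDesc w i) (hj : LeftDesc w j) :
    ∃ u, w = M.simple i * (M.simple j * (M.simple i * u)) ∧ M.len u + 3 = M.len w := by
  have h' : M j i = 3 := by rw [M.symmetric, h]
  have h1 : LeftDesc (M.simple i * w) j := by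
    rw [leftDesc_iff hM] at hi hj ⊢
    rw [mul_inv_rev, simple_inv, act_mul_apply, act_simple_apply,
      refl_simpleVec_of_three h', map_add]
    exact add_nonpos hj hi
  have h2 : LeftDesc (M.simple j * (M.simple i * w)) i := by
    rw [leftDesc_iff hM] at hj ⊢
    rw [mul_inv_rev, mul_inv_rev, simple_inv, simple_inv, act_mul_apply, act_mul_apply,
      act_simple_apply, act_simple_apply, refl_simpleVec_of_three h, add_comm,
      refl_simpleVec_add h']
    exact hj
  refine ⟨M.simple i * (M.simple j * (M.simple i * w)), by simp only [simple_mul_cancel], ?_⟩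
  have := hi.len
  have := h1.len
  have := h2.len
  omega

variable {hM}

/-- Matsumoto's theorem: a reduced element is determined by its image in the Coxeter group. -/
theorem IsRed.eq {x y : M.ArtinMonoid} (hx : IsRed hM x) (hy : IsRed hM y)
    (h : toW hM x = toW hM y) : x = y := by
  have hlen : alen x = alen y := by rw [← hx, ← hy, h]
  induction hn : alen x using Nat.strong_induction_on generalizing x y with
  | _ n ih =>
    subst hn
    rcases eq_one_or_exists_gen_mul x with rfl | ⟨i, x, rfl⟩
    · exact (eq_one_of_alen (by simpa using hlen.symm)).symm
    rcases eq_one_or_exists_gen_mul y with rfl | ⟨j, y, rfl⟩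
    · simp at hlen
    have hi := hx.leftDesc (Dvd.intro x rfl)
    have hj := hy.leftDesc (Dvd.intro y rfl)
    rw [← h] at hj
    have hx' := hx.of_mul.2
    have hy' := hy.of_mul.2
    -- The induction hypothesis in usable form: a common first letter `k` is removed.
    have hstep : ∀ {k : I} {z t : M.ArtinMonoid}, alen z < alen (M.artinGen i * x) → IsRed hM z →
        alen z = alen t → M.len (toW hM (M.artinGen k * z)) = alen z + 1 →
        toW hM (M.artinGen k * z) = toW hM (M.artinGen k * t) → z = t := by
      intro k z t hz hzr hzt hl hzt'
      rw [map_mul, map_mul, mul_right_inj] at hzt'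
      refine ih _ hz hzr ?_ hzt' hzt rfl
      rw [IsRed, ← hzt', hzr, hzt]
    simp only [alen_mul, alen_gen] at hlen hstep
    rcases hM.cases i j with rfl | ⟨hij, h2, -⟩ | ⟨hij, h3, -⟩
    · rw [hstep (by omega) hx' (by omega) (by rw [hx]; simp; omega) h]
    -- Both `i` and `j` are descents of the common image, so it starts with the longest element of
    -- the rank two subgroup. A reduced lift `z` of the rest gives two words beginning with `s_i`
    -- and `s_j`, equal by a braid relation, to compare with `x` and `y`.
    · obtain ⟨u, hu, hul⟩ := exists_eq_of_leftDesc_of_two hM h2 hi hj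
      obtain ⟨z, hz, rfl⟩ := exists_isRed hM u
      rw [hz, hx] at hul
      simp only [alen_mul, alen_gen] at hul
      rw [← toW_gen hM, ← toW_gen hM, ← map_mul, ← map_mul] at hu
      rw [hstep (k := i) (z := x) (t := M.artinGen j * z) (by omega) hx' (by simp; omega)
        (by rw [hx]; simp; omega) hu, hstep (k := j) (z := y) (t := M.artinGen i * z) (by omega) hy'
        (by simp; omega) (by rw [hy]; simp; omega) (by rw [← h, hu, gen_comm h2]), gen_comm h2]
    · obtain ⟨u, hu, hul⟩ := exists_eq_of_leftDesc_of_three hM h3 hi hj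
      obtain ⟨z, hz, rfl⟩ := exists_isRed hM u
      rw [hz, hx] at hul
      simp only [alen_mul, alen_gen] at hul
      rw [← toW_gen hM, ← toW_gen hM, ← map_mul, ← map_mul, ← map_mul] at hu
      rw [hstep (k := i) (z := x) (t := M.artinGen j * (M.artinGen i * z)) (by omega) hx'
        (by simp; omega) (by rw [hx]; simp; omega) hu,
        hstep (k := j) (z := y) (t := M.artinGen i * (M.artinGen j * z)) (by omega) hy'
        (by simp; omega) (by rw [hy]; simp; omega) (by rw [← h, hu, gen_braid h3]), gen_braid h3]

theorem IsRed.gen_dvd {x : M.ArtinMonoid} (hx : IsRed hM x) {i : I}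
    (hi : LeftDesc (toW hM x) i) : M.artinGen i ∣ x := by
  obtain ⟨z, hz, hzw⟩ := exists_isRed hM (M.simple i * toW hM x)
  refine ⟨z, hx.eq (isRed_gen_mul hM hz ?_) ?_⟩
  · rw [hzw, leftDesc_iff_len, simple_mul_cancel]
    have := hi.len
    omega
  · rw [map_mul, toW_gen, hzw, simple_mul_cancel]

end ReducedElements

/-! ### Parabolic subgroups, longest elements and Garside elements. -/

section Parabolic

variable {I : Type*} [Fintype I] [DecidableEq I] {M : CoxeterMatrix I} (hM : M.IsSmallType)

variable (M) in
/-- The standard parabolic subgroup of the Coxeter group generated by `J`. -/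
abbrev parabolic (J : Set I) : Subgroup M.Group := Subgroup.closure (M.simple '' J)

theorem simple_mem_parabolic {J : Set I} {j : I} (hj : j ∈ J) : M.simple j ∈ M.parabolic J :=
  Subgroup.subset_closure ⟨j, hj, rfl⟩

theorem act_apply_of_mem_parabolic {J : Set I} {w : M.Group} (hw : w ∈ M.parabolic J) {k : I}
    (hk : k ∉ J) (v : I → ℝ) : act hM w v k = v k := by
  induction hw using Subgroup.closure_induction generalizing v with
  | mem x hx =>
    obtain ⟨j, hj, rfl⟩ := hx
    rw [act_simple_apply, refl_apply_of_ne]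
    rintro rfl
    exact hk hj
  | one => rw [act_one_apply]
  | mul x y _ _ ihx ihy => rw [act_mul_apply, ihx, ihy]
  | inv x _ ih => rw [← ih (act hM x⁻¹ v), act_act_inv]

include hM in
theorem mem_of_leftDesc {J : Set I} {w : M.Group} (hw : w ∈ M.parabolic J) {k : I}
    (hk : LeftDesc w k) : k ∈ J := by
  by_contra h
  have h1 := (leftDesc_iff hM).1 hk k
  rw [act_apply_of_mem_parabolic hM (inv_mem hw) h, simpleVec_self] at h1
  exact absurd h1 (by norm_num)

theorem map_nonneg_of_forall {J : Set I} {L : Module.End ℝ (I → ℝ)}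
    (hL : ∀ j ∈ J, 0 ≤ L (simpleVec j)) {v : I → ℝ} (hv : 0 ≤ v) (hvJ : ∀ k ∉ J, v k = 0) :
    0 ≤ L v := by
  have h : v = ∑ k, v k • simpleVec k := by
    ext l
    simp [simpleVec, Pi.single_apply]
  rw [h, map_sum]
  refine Finset.sum_nonneg fun k _ => ?_
  rw [map_smul]
  by_cases hk : k ∈ J
  · exact smul_nonneg (hv k) (hL k hk)
  · rw [hvJ k hk, zero_smul]

open Classical in
/-- The homomorphism with value `1` at the elements whose letters are in `J`, and `0` at the
others. -/
noncomputable def suppHom (J : Set I) : M.ArtinMonoid →* ℕ :=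
  artinLift hM (fun i => if i ∈ J then 1 else 0) (fun _ _ _ _ => mul_comm _ _) (by
    intro i j _ _
    split_ifs <;> rfl)

/-- The letters of `x` are in `J`. -/
def SuppIn (J : Set I) (x : M.ArtinMonoid) : Prop := suppHom hM J x = 1

theorem suppIn_one (J : Set I) : SuppIn hM J 1 := map_one _

theorem suppIn_mul {J : Set I} {x y : M.ArtinMonoid} :
    SuppIn hM J (x * y) ↔ SuppIn hM J x ∧ SuppIn hM J y := by
  rw [SuppIn, map_mul, ← Nat.isUnit_iff, IsUnit.mul_iff, Nat.isUnit_iff, Nat.isUnit_iff]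
  rfl

theorem suppIn_gen {J : Set I} {i : I} : SuppIn hM J (M.artinGen i) ↔ i ∈ J := by
  rw [SuppIn, suppHom, artinLift_gen]
  simp

variable {hM}

theorem SuppIn.of_dvd {J : Set I} {x y : M.ArtinMonoid} (h : SuppIn hM J y) (hxy : x ∣ y) :
    SuppIn hM J x := by
  obtain ⟨z, rfl⟩ := hxy
  exact ((suppIn_mul hM).1 h).1

theorem SuppIn.mono {J K : Set I} (hJK : J ⊆ K) {x : M.ArtinMonoid} (h : SuppIn hM J x) :
    SuppIn hM K x := by
  induction x using artin_induction with
  | one => exact suppIn_one hM K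
  | gen_mul i x ih =>
    rw [suppIn_mul, suppIn_gen] at h ⊢
    exact ⟨hJK h.1, ih h.2⟩

theorem SuppIn.toW_mem {J : Set I} {x : M.ArtinMonoid} (h : SuppIn hM J x) :
    toW hM x ∈ M.parabolic J := by
  induction x using artin_induction with
  | one => rw [map_one]; exact one_mem _
  | gen_mul i x ih =>
    rw [suppIn_mul, suppIn_gen] at h
    rw [map_mul, toW_gen]
    exact mul_mem (simple_mem_parabolic h.1) (ih h.2)

theorem IsRed.suppIn {J : Set I} {x : M.ArtinMonoid} (hx : IsRed hM x)
    (h : toW hM x ∈ M.parabolic J) : SuppIn hM J x := by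
  induction x using artin_induction with
  | one => exact suppIn_one hM J
  | gen_mul i x ih =>
    have hi := mem_of_leftDesc hM h (hx.leftDesc (Dvd.intro x rfl))
    rw [suppIn_mul, suppIn_gen]
    refine ⟨hi, ih hx.of_mul.2 ?_⟩
    rw [map_mul, toW_gen] at h
    exact (Subgroup.mul_mem_cancel_left _ (simple_mem_parabolic hi)).1 h

/-- The element `w` is minimal in its coset `W_J w`. Each letter `i` put in front of a suffix `y`
adds to the length, since `y⁻¹ α_i` is a nonnegative combination of the `α_j`, `j ∈ J`, on which
`w⁻¹` is nonnegative. -/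
theorem len_toW_mul {J : Set I} {y : M.ArtinMonoid} (hy : IsRed hM y) (hJ : SuppIn hM J y)
    {w : M.Group} (hw : ∀ j ∈ J, ¬ LeftDesc w j) : M.len (toW hM y * w) = alen y + M.len w := by
  induction y using artin_induction with
  | one => simp
  | gen_mul i y ih =>
    rw [suppIn_mul, suppIn_gen] at hJ
    have h1 := ih hy.of_mul.2 hJ.2
    rw [map_mul, toW_gen, mul_assoc, len_of_not_leftDesc, h1]
    · simp
      omega
    · rw [not_leftDesc_iff hM, mul_inv_rev, act_mul_apply]
      refine map_nonneg_of_forall (J := J) (fun j hj => (not_leftDesc_iff hM).1 (hw j hj))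
        ((not_leftDesc_iff hM).1 hy.not_leftDesc) fun k hk => ?_
      rw [act_apply_of_mem_parabolic hM (inv_mem hJ.2.toW_mem) hk, simpleVec_of_ne]
      rintro rfl
      exact hk hJ.1

/-- `w` is the longest element of the parabolic subgroup generated by `J`. -/
structure IsLongest (J : Set I) (w : M.Group) : Prop where
  mem : w ∈ M.parabolic J
  left : ∀ j ∈ J, LeftDesc w j
  right : ∀ j ∈ J, RightDesc w j

theorem IsLongest.inv {J : Set I} {w : M.Group} (h : IsLongest J w) : IsLongest J w⁻¹ where
  mem := inv_mem h.mem
  left j hj := leftDesc_inv_iff.2 (h.right j hj)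
  right j hj := by
    rw [← leftDesc_inv_iff, inv_inv]
    exact h.left j hj

/-- For `j ∈ J`, `w` sends `α_j` to a nonpositive combination of simple roots of `J`, and `y⁻¹`
makes it nonnegative again. So `y⁻¹ w` has no right descent in `J`; lying in the parabolic subgroup
it has none at all, and is trivial. -/
theorem IsLongest.eq (hM : M.IsSmallType) {J : Set I} {w y : M.Group} (hw : IsLongest J w)
    (hy : y ∈ M.parabolic J) (hyl : ∀ j ∈ J, LeftDesc y j) : y = w := by
  have hmem : y⁻¹ * w ∈ M.parabolic J := mul_mem (inv_mem hy) hw.mem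
  have key : ∀ j ∈ J, ¬ RightDesc (y⁻¹ * w) j := by
    intro j hj
    have := map_nonneg_of_forall (J := J) (L := -act hM y⁻¹) (v := -act hM w (simpleVec j))
      (fun k hk => neg_nonneg.2 ((leftDesc_iff hM).1 (hyl k hk)))
      (neg_nonneg.2 ((rightDesc_iff hM).1 (hw.right j hj))) fun k hk => by
        rw [Pi.neg_apply, act_apply_of_mem_parabolic hM hw.mem hk, simpleVec_of_ne, neg_zero]
        rintro rfl
        exact hk hj
    rw [not_rightDesc_iff hM, act_mul_apply]
    simpa using this
  by_contra hne
  have h1 : y⁻¹ * w ≠ 1 := fun h => hne (inv_mul_eq_one.1 h)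
  obtain ⟨i, hi⟩ := M.toCoxeterSystem.exists_rightDescent_of_ne_one h1
  exact key i (mem_of_leftDesc hM (inv_mem hmem) (leftDesc_inv_iff.2 hi)) hi

theorem IsLongest.mul_self (hM : M.IsSmallType) {J : Set I} {w : M.Group} (hw : IsLongest J w) :
    w * w = 1 := by
  have := hw.eq hM hw.inv.mem hw.inv.left
  rw [mul_eq_one_iff_inv_eq, this]

/-- An element of maximal length in `F` has all the left descents, and so has its inverse. Allowing
a subgroup `F` that may be smaller than the parabolic one matters for unions of orbits, where
finiteness of the parabolic subgroup is not known beforehand. -/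
theorem exists_isLongest {J : Set I} {F : Subgroup M.Group} [Finite F] (hF : F ≤ M.parabolic J)
    (h : ∀ x ∈ F, ∀ j ∈ J, ¬ LeftDesc x j → ∃ y ∈ F, M.len x < M.len y) :
    ∃ w ∈ F, IsLongest J w := by
  obtain ⟨⟨w, hw⟩, hmax⟩ := Finite.exists_max fun x : F => M.len x.1
  have hl : ∀ x ∈ F, M.len w ≤ M.len x → ∀ j ∈ J, LeftDesc x j := by
    intro x hx hxw j hj
    by_contra hn
    obtain ⟨y, hy, hlt⟩ := h x hx j hj hn
    have := hmax ⟨y, hy⟩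
    simp only at this
    omega
  refine ⟨w, hw, hF hw, hl w hw le_rfl, fun j hj => leftDesc_inv_iff.1 ?_⟩
  exact hl w⁻¹ (inv_mem hw) (M.toCoxeterSystem.length_inv w).ge j hj

theorem exists_isLongest_of_isSphericalSubset {J : Set I} (hJ : M.IsSphericalSubset J) :
    ∃ w : M.Group, IsLongest J w := by
  have : Finite (M.parabolic J) := hJ
  obtain ⟨w, -, hw⟩ := exists_isLongest (J := J) (F := M.parabolic J) le_rfl
    fun x hx j hj hn => ⟨M.simple j * x, mul_mem (simple_mem_parabolic hj) hx, by
      rw [len_of_not_leftDesc hn]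
      exact Nat.lt_succ_self _⟩
  exact ⟨w, hw⟩

/-- The Garside element is the reduced lift of the longest element. -/
theorem IsLongest.isGarside {J : Set I} {x : M.ArtinMonoid} (hx : IsRed hM x)
    (hw : IsLongest J (toW hM x)) : M.IsGarside J x := by
  have hJx : ∀ j ∈ J, M.artinGen j ∣ x := fun j hj => hx.gen_dvd (hw.left j hj)
  obtain ⟨D, hD⟩ := exists_isGarside hM J hJx
  have hDx := hD.2 x hJx
  have hDr := hx.of_dvd hDx
  have : toW hM D = toW hM x := hw.eq hM ((hx.suppIn hw.mem).of_dvd hDx).toW_mem fun j hj =>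
    hDr.leftDesc (hD.1 j hj)
  rwa [← hDr.eq hx this]

variable (hM) in
/-- The properties of the Garside element of a spherical subset. -/
structure GarsideData (J : Set I) (D : M.ArtinMonoid) : Prop where
  isGarside : M.IsGarside J D
  isRed : IsRed hM D
  isLongest : IsLongest J (toW hM D)

theorem IsLongest.garsideData (hM : M.IsSmallType) {J : Set I} {w : M.Group}
    (hw : IsLongest J w) : GarsideData hM J (M.garside J) := by
  obtain ⟨x, hx, rfl⟩ := exists_isRed hM w
  rw [(hw.isGarside hx).garside_eq]
  exact ⟨hw.isGarside hx, hx, hw⟩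

theorem GarsideData.suppIn {J : Set I} {D : M.ArtinMonoid} (h : GarsideData hM J D) :
    SuppIn hM J D :=
  h.isRed.suppIn h.isLongest.mem

theorem GarsideData.alen_pos {J : Set I} {D : M.ArtinMonoid} (h : GarsideData hM J D)
    (hJ : J.Nonempty) : 0 < alen D := by
  obtain ⟨j, hj⟩ := hJ
  obtain ⟨x, hx⟩ := h.isGarside.1 j hj
  rw [hx]
  simp

/-- `Δ_J` is quasi-central. -/
theorem GarsideData.exists_gen_mul_eq {J : Set I} {D : M.ArtinMonoid} (h : GarsideData hM J D)
    {j : I} (hj : j ∈ J) : ∃ k ∈ J, M.artinGen j * D = D * M.artinGen k := by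
  set w := toW hM D with hw
  have hβ : -(act hM w⁻¹ (simpleVec j)) ∈ M.posRoots :=
    ⟨neg_mem_roots hM (act_simpleVec_mem_roots hM _ j),
      neg_nonneg.2 ((leftDesc_iff hM).1 (h.isLongest.left j hj))⟩
  set β := -(act hM w⁻¹ (simpleVec j)) with hβd
  have hβJ : ∀ k ∉ J, β k = 0 := by
    intro k hk
    rw [hβd, Pi.neg_apply, act_apply_of_mem_parabolic hM (inv_mem h.isLongest.mem) hk,
      simpleVec_of_ne, neg_zero]
    rintro rfl
    exact hk hj
  have hwβ : act hM w β = -simpleVec j := by rw [hβd, map_neg, act_act_inv]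
  obtain ⟨k, hk⟩ : ∃ k, β k ≠ 0 := by
    by_contra! h0
    exact ne_zero_of_mem_roots hβ.1 hM (funext h0)
  have hkJ : k ∈ J := by
    by_contra hkJ
    exact hk (hβJ k hkJ)
  have hγ : ∀ k ∈ J, -(act hM w (simpleVec k)) ∈ M.posRoots := fun k hk =>
    ⟨neg_mem_roots hM (act_simpleVec_mem_roots hM _ k),
      neg_nonneg.2 ((rightDesc_iff hM).1 (h.isLongest.right k hk))⟩
  -- Off `j` the coordinates of `w β` vanish, and they are sums of terms of one sign. Thus every
  -- `α_k` occurring in `β` is sent by `w` to a multiple of `α_j`, and a negative root of this form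
  -- is `-α_j`.
  have hwk : act hM w (simpleVec k) = -simpleVec j := by
    rw [← eq_simpleVec_of_forall_ne hM (hγ k hkJ) (i := j), neg_neg]
    intro l hl
    have hsum : β = ∑ k, β k • simpleVec k := by
      ext l
      simp [simpleVec, Pi.single_apply]
    have h1 := congrFun hwβ l
    rw [hsum, map_sum, Finset.sum_apply, Pi.neg_apply, simpleVec_of_ne hl, neg_zero,
      ← neg_eq_zero, ← Finset.sum_neg_distrib] at h1
    have h2 := (Finset.sum_eq_zero_iff_of_nonneg fun m _ => ?_).1 h1 k (Finset.mem_univ k)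
    · rw [map_smul, Pi.smul_apply, smul_eq_mul, ← mul_neg] at h2
      exact (mul_eq_zero.1 h2).resolve_left hk
    · rw [map_smul, Pi.smul_apply, smul_eq_mul, ← mul_neg]
      by_cases hm : m ∈ J
      · exact mul_nonneg (hβ.2 m) ((hγ m hm).2 l)
      · rw [hβJ m hm, zero_mul]
  have hconj : M.simple j * w = w * M.simple k := by
    refine act_injective hM (LinearMap.ext fun v => ?_)
    rw [act_mul_apply, act_mul_apply, act_simple_apply, act_simple_apply, refl_def, refl_def,
      map_sub, map_smul, hwk, ← neg_neg (simpleVec j), ← hwk, map_neg, rootForm_act, hwk]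
    module
  -- With `D = s_j Z`, the element `Z s_k` is another reduced lift of `w`, so it equals `D`;
  -- multiplying by `s_j` gives the claim.
  obtain ⟨Z, hZ⟩ := h.isGarside.1 j hj
  have hZw : toW hM Z = M.simple j * w := by
    rw [hw, hZ, map_mul, toW_gen, simple_mul_cancel]
  have hZk : toW hM (Z * M.artinGen k) = w := by
    rw [map_mul, toW_gen, hZw, hconj, mul_simple_cancel]
  have hZr : IsRed hM (Z * M.artinGen k) := by
    have := h.isRed
    rw [IsRed] at this
    rw [IsRed, hZk, hw, this, hZ]
    simp [add_comm]
  refine ⟨k, hkJ, ?_⟩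
  conv_lhs => rw [← hZr.eq h.isRed hZk, ← mul_assoc, ← hZ]

/-- By quasi-centrality a first letter moves through a power of `D` and becomes some `s_k`, `k ∈ J`,
which one more factor `D` absorbs. This is the source of common multiples. -/
theorem GarsideData.dvd_pow {J : Set I} {D : M.ArtinMonoid} (h : GarsideData hM J D)
    {x : M.ArtinMonoid} (hx : SuppIn hM J x) : x ∣ D ^ alen x := by
  have hcomm : ∀ (n : ℕ) {j : I}, j ∈ J → ∃ k ∈ J, M.artinGen j * D ^ n = D ^ n * M.artinGen k := by
    intro n
    induction n with
    | zero => exact fun {j} hj => ⟨j, hj, by simp⟩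
    | succ n ih =>
      intro j hj
      obtain ⟨k, hk, h1⟩ := ih hj
      obtain ⟨l, hl, h2⟩ := h.exists_gen_mul_eq hk
      exact ⟨l, hl, by rw [pow_succ, ← mul_assoc, h1, mul_assoc, h2, mul_assoc]⟩
  induction x using artin_induction with
  | one => exact one_dvd _
  | gen_mul i x ih =>
    rw [suppIn_mul, suppIn_gen] at hx
    obtain ⟨y, hy⟩ := ih hx.2
    obtain ⟨k, hk, h1⟩ := hcomm (alen x) hx.1
    obtain ⟨z, hz⟩ := h.isGarside.1 k hk
    refine ⟨y * z, ?_⟩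
    rw [alen_mul, alen_gen, add_comm, pow_succ]
    nth_rewrite 2 [hz]
    rw [← mul_assoc, ← h1, hy]
    simp only [mul_assoc]

end Parabolic

end CoxeterMatrix

/-! ### Alternating products. -/

section AltProd

variable {N : Type*} [Monoid N]

theorem altProd_succ (a b : N) (n : ℕ) : altProd a b (n + 1) = a * altProd b a n := rfl

theorem altProd_succ' (a b : N) (n : ℕ) :
    altProd a b (n + 1) = altProd a b n * if Even n then a else b := by
  induction n generalizing a b with
  | zero => simp [altProd]
  | succ n ih =>
    rw [altProd_succ, ih, altProd_succ, mul_assoc]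
    congr 2
    by_cases h : Even n
    · simp [h, Nat.even_add_one]
    · simp [h, Nat.even_add_one]

/-- Converts a braid relation between involutions into a Coxeter relation, as needed to define
`fixedToW`. -/
theorem mul_pow_eq_one_of_altProd {H : Type*} [Group H] {a b : H} (ha : a * a = 1) (hb : b * b = 1)
    {n : ℕ} (h : altProd a b n = altProd b a n) : (a * b) ^ n = 1 := by
  have key : ∀ n, altProd a b n = (a * b) ^ n * altProd b a n := by
    have ha' : a⁻¹ = a := inv_eq_of_mul_eq_one_right ha
    have hb' : b⁻¹ = b := inv_eq_of_mul_eq_one_right hb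
    intro n
    induction n with
    | zero => simp [altProd]
    | succ n ih =>
      have h1 : b * (a * b) ^ n * b⁻¹ = ((a * b) ^ n)⁻¹ := by
        rw [← conj_pow, ← inv_pow, mul_inv_rev, ha', hb', mul_assoc, mul_assoc, hb, mul_one]
      have h2 : (a * b) ^ (n + 1) * b * (a * b) ^ n = a := by
        rw [mul_assoc, ← mul_inv_cancel_right (b * (a * b) ^ n) b⁻¹, h1, inv_inv, pow_succ']
        rw [mul_assoc (a * b), ← mul_assoc ((a * b) ^ n), mul_inv_cancel, one_mul, mul_assoc, hb,
          mul_one]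
      rw [altProd_succ, altProd_succ, ih, ← mul_assoc, ← mul_assoc, h2]
  rw [key] at h
  exact mul_eq_right.1 h

end AltProd

namespace CoxeterMatrix

/-! ### The Garside elements of orbits and the Coxeter matrix `Γ'`. -/

section FixedMonoid

variable {I : Type*} [Fintype I] [DecidableEq I] {M : CoxeterMatrix I} (hM : M.IsSmallType)
variable {G : Subgroup M.graphAut}

theorem SphericalOrbit.stableSet (J : M.SphericalOrbit G) : StableSet G J.1 := by
  obtain ⟨i, hi⟩ := J.2.1
  rw [hi]
  exact stableSet_orbit i

theorem SphericalOrbit.nonempty (J : M.SphericalOrbit G) : J.1.Nonempty := by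
  obtain ⟨i, hi⟩ := J.2.1
  rw [hi]
  exact ⟨i, MulAction.mem_orbit_self i⟩

theorem SphericalOrbit.eq_orbit (J : M.SphericalOrbit G) {i : I} (hi : i ∈ J.1) :
    J.1 = MulAction.orbit G i := by
  obtain ⟨k, hk⟩ := J.2.1
  rw [hk] at hi ⊢
  exact (MulAction.orbit_eq_iff.2 hi).symm

theorem SphericalOrbit.eq_of_mem {J K : M.SphericalOrbit G} {i : I} (hJ : i ∈ J.1)
    (hK : i ∈ K.1) : J = K :=
  Subtype.ext (by rw [J.eq_orbit hJ, K.eq_orbit hK])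

theorem garsideData_orbit (J : M.SphericalOrbit G) : GarsideData hM J.1 (M.garside J.1) := by
  obtain ⟨w, hw⟩ := exists_isLongest_of_isSphericalSubset J.2.2
  exact hw.garsideData hM

include hM in
theorem garside_mem_fixedMonoid (J : M.SphericalOrbit G) : M.garside J.1 ∈ M.fixedMonoid G :=
  (garsideData_orbit hM J).isGarside.mem_fixedMonoid J.stableSet

include hM in
theorem garside_dvd_of_gen_dvd {x : M.ArtinMonoid} (hx : x ∈ M.fixedMonoid G)
    {J : M.SphericalOrbit G} {i : I} (hi : i ∈ J.1) (h : M.artinGen i ∣ x) :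
    M.garside J.1 ∣ x :=
  (garsideData_orbit hM J).isGarside.2 x fun _ hj =>
    gen_dvd_of_mem_orbit hx (J.eq_orbit hi ▸ hj) h

variable (G) in
/-- The submonoid of the Coxeter group of the elements whose action commutes with `G`. -/
def equivariantSubgroup : Subgroup M.Group where
  carrier := {w | ∀ g ∈ G, ∀ v, act hM w (v ∘ ⇑(g.1⁻¹)) = act hM w v ∘ ⇑(g.1⁻¹)}
  one_mem' g _ v := by rw [act_one_apply, act_one_apply]
  mul_mem' {x y} hx hy g hg v := by
    rw [act_mul_apply, act_mul_apply, hy g hg, hx g hg]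
  inv_mem' {x} hx g hg v := by
    have := hx g hg (act hM x⁻¹ v)
    rw [act_act_inv] at this
    rw [← this, act_inv_act]

theorem toW_mem_equivariantSubgroup {x : M.ArtinMonoid} (hx : x ∈ M.fixedMonoid G) :
    toW hM x ∈ equivariantSubgroup hM G := by
  intro g hg v
  have key : ∀ (x : M.ArtinMonoid) (v : I → ℝ),
      act hM (toW hM (M.artinMap g x)) (v ∘ ⇑(g.1⁻¹)) = act hM (toW hM x) v ∘ ⇑(g.1⁻¹) := by
    intro x v
    induction x using artin_induction with
    | one => simp
    | gen_mul i x ih =>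
      rw [map_mul, artinMap_gen, map_mul (toW hM), map_mul (toW hM), toW_gen, toW_gen, act_mul_apply, ih,
        act_mul_apply, act_simple_apply, act_simple_apply, refl_comp]
  rw [← key, hx g hg]

theorem not_leftDesc_of_mem_orbit {w : M.Group} (hw : w ∈ equivariantSubgroup hM G) {i j : I}
    (hj : j ∈ MulAction.orbit G i) (hi : ¬ LeftDesc w i) : ¬ LeftDesc w j := by
  obtain ⟨g, rfl⟩ := hj
  rw [not_leftDesc_iff hM] at hi ⊢
  have := inv_mem hw g.1 g.2 (simpleVec i)
  rw [M.simpleVec_comp] at this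
  change 0 ≤ act hM w⁻¹ (simpleVec (g.1.1 i))
  rw [this]
  exact fun k => hi ((g.1.1⁻¹ : Equiv.Perm I) k)

/-- The homomorphism from the Coxeter group of `Γ'` to that of `Γ`. -/
noncomputable def fixedToW : (M.fixedMatrix G).Group →* M.Group :=
  (M.fixedMatrix G).toCoxeterSystem.lift ⟨fun J => toW hM (M.garside J.1), by
    have hsq : ∀ J : M.SphericalOrbit G, toW hM (M.garside J.1) * toW hM (M.garside J.1) = 1 :=
      fun J => (garsideData_orbit hM J).isLongest.mul_self hM
    intro J K
    by_cases hJK : J = K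
    · rw [hJK, (M.fixedMatrix G).diagonal, pow_one, hsq]
    · by_cases h0 : M.fixedMatrix G J K = 0
      · rw [h0, pow_zero]
      · refine mul_pow_eq_one_of_altProd (hsq J) (hsq K) ?_
        rw [← map_altProd, ← map_altProd]
        congr 1
        have h1 : M.fixedMatrix G J K = sInf {m : ℕ | 2 ≤ m ∧
            altProd (M.garside J.1) (M.garside K.1) m =
              altProd (M.garside K.1) (M.garside J.1) m} := if_neg hJK
        -- The value `0` is that of `sInf ∅`, so a nonzero entry is attained.
        rw [h1] at h0 ⊢
        exact (Nat.sInf_mem (Nat.nonempty_of_pos_sInf (Nat.pos_of_ne_zero h0))).2⟩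

theorem fixedToW_simple (J : M.SphericalOrbit G) :
    fixedToW hM ((M.fixedMatrix G).simple J) = toW hM (M.garside J.1) :=
  (M.fixedMatrix G).toCoxeterSystem.lift_apply_simple _ J

/-- The union of a set of spherical orbits. -/
def orbitUnion (S : Set (M.SphericalOrbit G)) : Set I := {i | ∃ J ∈ S, i ∈ J.1}

theorem stableSet_orbitUnion (S : Set (M.SphericalOrbit G)) : StableSet G (orbitUnion S) := by
  rintro g hg j ⟨J, hJ, hj⟩
  exact ⟨J, hJ, J.stableSet g hg j hj⟩

/-- If `Γ'` is spherical, then unions of spherical orbits have a longest element. -/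
theorem garsideData_orbitUnion (hsph : (M.fixedMatrix G).IsSpherical)
    (S : Set (M.SphericalOrbit G)) :
    GarsideData hM (orbitUnion S) (M.garside (orbitUnion S)) := by
  -- `F` lies in the image of the finite Coxeter group of `Γ'`, hence is finite.
  let F : Subgroup M.Group := Subgroup.closure ((fun J => toW hM (M.garside J.1)) '' S)
  have hFle : F ≤ (fixedToW hM (G := G)).range := by
    rw [Subgroup.closure_le]
    rintro _ ⟨J, -, rfl⟩
    exact ⟨_, fixedToW_simple hM J⟩
  have : Finite (M.fixedMatrix G).Group := hsph
  have : Finite (fixedToW hM (G := G)).range :=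
    Finite.of_surjective _ (fixedToW hM).rangeRestrict_surjective
  have : Finite F := Finite.of_injective _ (Subgroup.inclusion_injective hFle)
  have hpar : F ≤ M.parabolic (orbitUnion S) := by
    rw [Subgroup.closure_le]
    rintro _ ⟨J, hJ, rfl⟩
    exact ((garsideData_orbit hM J).suppIn.mono (K := orbitUnion S)
      fun j hj => ⟨J, hJ, hj⟩).toW_mem
  have heq : F ≤ equivariantSubgroup hM G := by
    rw [Subgroup.closure_le]
    rintro _ ⟨J, -, rfl⟩
    exact toW_mem_equivariantSubgroup hM (garside_mem_fixedMonoid hM J)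
  -- Elements of `F` commute with `G`, so one that lacks the descent `j` lacks the whole orbit of
  -- `j`, and multiplying by the image of `Δ_J` makes it longer.
  obtain ⟨w, -, hw⟩ := exists_isLongest hpar (by
    rintro x hx j ⟨J, hJ, hj⟩ hn
    have hD := garsideData_orbit hM J
    refine ⟨toW hM (M.garside J.1) * x, mul_mem (Subgroup.subset_closure ⟨J, hJ, rfl⟩) hx, ?_⟩
    rw [len_toW_mul hD.isRed hD.suppIn fun k hk =>
      not_leftDesc_of_mem_orbit hM (heq hx) (J.eq_orbit hj ▸ hk) hn]
    have := hD.alen_pos J.nonempty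
    omega)
  exact hw.garsideData hM

theorem alen_altProd_lt {a b : M.ArtinMonoid} (ha : 0 < alen a) (hb : 0 < alen b) {m n : ℕ}
    (h : m < n) : alen (altProd a b m) < alen (altProd a b n) := by
  induction h with
  | refl =>
    rw [altProd_succ', alen_mul]
    split_ifs <;> omega
  | step _ ih =>
    rw [altProd_succ', alen_mul]
    omega

theorem altProd_dvd_altProd {N : Type*} [Monoid N] (a b : N) {m n : ℕ} (h : m ≤ n) :
    altProd a b m ∣ altProd a b n := by
  induction h with
  | refl => exact dvd_rfl
  | step _ ih =>
    rw [altProd_succ']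
    exact ih.mul_right _

/-- Factors `Δ_J`, `Δ_K` are peeled off `D` from the left, starting with `Δ_J`. They must alternate:
`D` is reduced, while `Δ_L` maps to an involution, so `Δ_L Δ_L` is not reduced. -/
theorem exists_altProd_eq (J K : M.SphericalOrbit G)
    {D : M.ArtinMonoid} (hD : GarsideData hM (J.1 ∪ K.1) D) :
    ∃ p, 1 ≤ p ∧ altProd (M.garside J.1) (M.garside K.1) p = D := by
  have hDG : D ∈ M.fixedMonoid G :=
    hD.isGarside.mem_fixedMonoid (J.stableSet.union K.stableSet)
  have hsq : ∀ (L : M.SphericalOrbit G) {u v : M.ArtinMonoid},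
      D ≠ u * M.garside L.1 * (M.garside L.1 * v) := by
    intro L u v h
    have hL := garsideData_orbit hM L
    have h1 : IsRed hM (M.garside L.1 * M.garside L.1) := by
      have := hD.isRed
      rw [h, mul_assoc, ← mul_assoc (M.garside L.1)] at this
      exact this.of_mul.2.of_mul.1
    rw [IsRed, map_mul, hL.isLongest.mul_self hM, len_one, alen_mul] at h1
    have := hL.alen_pos L.nonempty
    omega
  have key : ∀ n p y, alen y = n → altProd (M.garside J.1) (M.garside K.1) (p + 1) * y = D →
      ∃ p, 1 ≤ p ∧ altProd (M.garside J.1) (M.garside K.1) p = D := by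
    intro n
    induction n using Nat.strong_induction_on with
    | _ n ih =>
      intro p y hn hy
      rcases eq_one_or_exists_gen_mul y with rfl | ⟨i, y', hy'⟩
      · exact ⟨p + 1, by omega, by rw [← hy, mul_one]⟩
      have hyG : y ∈ M.fixedMonoid G := by
        refine mem_fixedMonoid_of_mul hM (x := altProd (M.garside J.1) (M.garside K.1) (p + 1)) ?_
          (hy ▸ hDG)
        have := (altProd (⟨_, garside_mem_fixedMonoid hM J⟩ : M.fixedMonoid G)
          ⟨_, garside_mem_fixedMonoid hM K⟩ (p + 1)).2
        rwa [← (M.fixedMonoid G).coe_subtype, map_altProd] at this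
      have hi : i ∈ J.1 ∪ K.1 := by
        have := hD.suppIn
        rw [← hy, hy', suppIn_mul, suppIn_mul, suppIn_gen] at this
        exact this.2.1
      obtain ⟨L, hL, hLy⟩ : ∃ L : M.SphericalOrbit G, (L = J ∨ L = K) ∧ M.garside L.1 ∣ y := by
        rcases hi with hi | hi
        · exact ⟨J, Or.inl rfl, garside_dvd_of_gen_dvd hM hyG hi (Dvd.intro _ hy'.symm)⟩
        · exact ⟨K, Or.inr rfl, garside_dvd_of_gen_dvd hM hyG hi (Dvd.intro _ hy'.symm)⟩
      obtain ⟨z, rfl⟩ := hLy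
      have hLpos := (garsideData_orbit hM L).alen_pos L.nonempty
      by_cases hnext : M.garside L.1 = if Even (p + 1) then M.garside J.1 else M.garside K.1
      · refine ih (alen z) ?_ (p + 1) z rfl ?_
        · rw [← hn, alen_mul]
          omega
        · rw [altProd_succ', ← hnext, mul_assoc, hy]
      · have hlast : M.garside L.1 = if Even p then M.garside J.1 else M.garside K.1 := by
          rcases hL with rfl | rfl <;> by_cases hp : Even p <;>
            simp [hp, Nat.even_add_one] at hnext ⊢
        rw [altProd_succ', ← hlast] at hy
        exact absurd hy.symm (hsq L)
  obtain ⟨y, hy⟩ : M.garside J.1 ∣ D := (garsideData_orbit hM J).isGarside.2 D fun j hj =>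
    hD.isGarside.1 j (Or.inl hj)
  exact key _ 0 y rfl (by rw [hy]; simp [altProd])

/-- The Garside element of `J ∪ K` is the alternating product with `m'_{J,K}` factors. -/
theorem altProd_fixedMatrix_eq {J K : M.SphericalOrbit G} (hJK : J ≠ K)
    {D : M.ArtinMonoid} (hD : GarsideData hM (J.1 ∪ K.1) D) :
    2 ≤ M.fixedMatrix G J K ∧
      altProd (M.garside J.1) (M.garside K.1) (M.fixedMatrix G J K) = D := by
  have hJ := garsideData_orbit hM J
  have hK := garsideData_orbit hM K
  have hJpos := hJ.alen_pos J.nonempty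
  have hKpos := hK.alen_pos K.nonempty
  obtain ⟨p, hp1, hp⟩ := exists_altProd_eq hM J K hD
  obtain ⟨q, hq1, hq⟩ := exists_altProd_eq hM K J (D := D) (by rwa [Set.union_comm])
  -- If `p < q`, the product with `q` factors begins with `b` followed by the one with `p` factors,
  -- so `D` would be divisible by the longer `b D`.
  have hlt : ∀ {a b : M.ArtinMonoid} {p q : ℕ}, 0 < alen a → 0 < alen b → altProd a b p = D →
      altProd b a q = D → ¬ p < q := by
    intro a b p q ha hb h1 h2 h
    obtain ⟨z, hz⟩ := altProd_dvd_altProd b a (show p + 1 ≤ q from h)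
    rw [altProd_succ, h1, h2] at hz
    have := congrArg alen hz
    simp at this
    omega
  obtain rfl : p = q := le_antisymm (not_lt.1 (hlt hKpos hJpos hq hp))
    (not_lt.1 (hlt hJpos hKpos hp hq))
  have hp2 : 2 ≤ p := by
    by_contra h
    obtain rfl : p = 1 := by omega
    rw [altProd_succ, altProd, mul_one] at hp hq
    obtain ⟨k, hk⟩ := K.nonempty
    have := (hJ.suppIn.of_dvd (hp.trans hq.symm ▸ hK.isGarside.1 k hk))
    rw [suppIn_gen] at this
    exact hJK (SphericalOrbit.eq_of_mem this hk)
  have hmem : p ∈ {m : ℕ | 2 ≤ m ∧ altProd (M.garside J.1) (M.garside K.1) m =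
      altProd (M.garside K.1) (M.garside J.1) m} := ⟨hp2, hp.trans hq.symm⟩
  have hm : M.fixedMatrix G J K = sInf {m : ℕ | 2 ≤ m ∧
      altProd (M.garside J.1) (M.garside K.1) m = altProd (M.garside K.1) (M.garside J.1) m} :=
    if_neg hJK
  have hle : M.fixedMatrix G J K ≤ p := hm ▸ Nat.sInf_le hmem
  obtain ⟨h2, heq⟩ := Nat.sInf_mem ⟨p, hmem⟩
  rw [← hm] at h2 heq
  refine ⟨h2, ?_⟩
  -- The product with `m'_{J,K}` factors begins with `Δ_J` and, by the relation, also with `Δ_K`; so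
  -- it is a multiple of `D`, and fewer than `p` factors would be too short.
  have hdvd : D ∣ altProd (M.garside J.1) (M.garside K.1) (M.fixedMatrix G J K) := by
    refine hD.isGarside.2 _ fun j hj => ?_
    have h1 : 1 ≤ M.fixedMatrix G J K := by omega
    rcases hj with hj | hj
    · refine (hJ.isGarside.1 j hj).trans ?_
      simpa [altProd] using altProd_dvd_altProd (M.garside J.1) (M.garside K.1) h1
    · rw [heq]
      refine (hK.isGarside.1 j hj).trans ?_
      simpa [altProd] using altProd_dvd_altProd (M.garside K.1) (M.garside J.1) h1
  rcases hle.eq_or_lt with h | h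
  · rw [h, hp]
  · obtain ⟨z, hz⟩ := hdvd
    have h1 := congrArg alen hz
    have h3 := alen_altProd_lt hJpos hKpos h
    rw [hp] at h3
    simp at h1
    omega

end FixedMonoid

/-! ### The Artin-Tits group of `Γ'` as a group of fractions. -/

section FixedGroup

variable {I : Type*} [Fintype I] [DecidableEq I] {M : CoxeterMatrix I} (hM : M.IsSmallType)
variable {G : Subgroup M.graphAut}

theorem altProd_artinGroupGen {I : Type*} (M : CoxeterMatrix I) (i j : I) :
    altProd (M.artinGroupGen i) (M.artinGroupGen j) (M i j) =
      altProd (M.artinGroupGen j) (M.artinGroupGen i) (M i j) := by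
  by_cases h : M i j = 0
  · rw [h]
    rfl
  · have h1 := PresentedGroup.one_of_mem (rels := {r : FreeGroup I | ∃ i j : I, M i j ≠ 0 ∧
      r = altProd (FreeGroup.of i) (FreeGroup.of j) (M i j) *
        (altProd (FreeGroup.of j) (FreeGroup.of i) (M i j))⁻¹}) ⟨i, j, h, rfl⟩
    rw [map_mul, map_inv, mul_inv_eq_one, map_altProd, map_altProd] at h1
    exact h1

variable (G) in
/-- Evaluation of words in the spherical orbits in the Artin-Tits group of `Γ'`. -/
noncomputable def wordGroup : FreeMonoid (M.SphericalOrbit G) →* (M.fixedMatrix G).ArtinGroup :=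
  FreeMonoid.lift (M.fixedMatrix G).artinGroupGen

/-- Evaluation of words in the spherical orbits in `(B⁺)^G`. -/
noncomputable def wordFixed (hM : M.IsSmallType) (G : Subgroup M.graphAut) :
    FreeMonoid (M.SphericalOrbit G) →* M.fixedMonoid G :=
  FreeMonoid.lift fun J => ⟨M.garside J.1, garside_mem_fixedMonoid hM J⟩

theorem wordGroup_of (J : M.SphericalOrbit G) :
    wordGroup G (FreeMonoid.of J) = (M.fixedMatrix G).artinGroupGen J :=
  FreeMonoid.lift_eval_of _ _

theorem wordFixed_of (J : M.SphericalOrbit G) :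
    (wordFixed hM G (FreeMonoid.of J)).1 = M.garside J.1 :=
  congrArg Subtype.val (FreeMonoid.lift_eval_of (fun J : M.SphericalOrbit G =>
    (⟨M.garside J.1, garside_mem_fixedMonoid hM J⟩ : M.fixedMonoid G)) J)

theorem wordFixed_mul (u v : FreeMonoid (M.SphericalOrbit G)) :
    (wordFixed hM G (u * v)).1 = (wordFixed hM G u).1 * (wordFixed hM G v).1 := by
  rw [map_mul]
  rfl

theorem wordFixed_altProd (J K : M.SphericalOrbit G) (n : ℕ) :
    (wordFixed hM G (altProd (FreeMonoid.of J) (FreeMonoid.of K) n)).1 =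
      altProd (M.garside J.1) (M.garside K.1) n := by
  have := map_altProd ((M.fixedMonoid G).subtype.comp (wordFixed hM G)) (FreeMonoid.of J)
    (FreeMonoid.of K) n
  simp only [MonoidHom.comp_apply, Submonoid.coe_subtype, wordFixed_of] at this
  exact this

theorem suppIn_wordFixed (u : FreeMonoid (M.SphericalOrbit G)) :
    SuppIn hM (orbitUnion (Set.univ : Set (M.SphericalOrbit G))) (wordFixed hM G u).1 := by
  induction u using FreeMonoid.inductionOn' with
  | one => rw [map_one]; exact suppIn_one hM _
  | of_mul J u ih =>
    rw [wordFixed_mul, suppIn_mul, wordFixed_of]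
    exact ⟨(garsideData_orbit hM J).suppIn.mono (K := orbitUnion Set.univ) fun _ hj => ⟨J, trivial, hj⟩, ih⟩

/-- The support condition makes the orbit of the first letter spherical, and its Garside element,
which divides the fixed element, is split off. -/
theorem exists_wordFixed_eq {x : M.ArtinMonoid} (hx : x ∈ M.fixedMonoid G)
    (hs : SuppIn hM (orbitUnion (Set.univ : Set (M.SphericalOrbit G))) x) :
    ∃ u, (wordFixed hM G u).1 = x := by
  induction hn : alen x using Nat.strong_induction_on generalizing x with
  | _ n ih =>
    subst hn
    rcases eq_one_or_exists_gen_mul x with rfl | ⟨i, y, hy⟩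
    · exact ⟨1, by rw [map_one]; rfl⟩
    · obtain ⟨J, -, hi⟩ : i ∈ orbitUnion (Set.univ : Set (M.SphericalOrbit G)) :=
        (suppIn_gen hM).1 (hs.of_dvd (Dvd.intro y hy.symm))
      obtain ⟨z, rfl⟩ := garside_dvd_of_gen_dvd hM hx hi (Dvd.intro y hy.symm)
      have hpos := (garsideData_orbit hM J).alen_pos J.nonempty
      obtain ⟨u, hu⟩ := ih (alen z) (by rw [alen_mul]; omega)
        (mem_fixedMonoid_of_mul hM (garside_mem_fixedMonoid hM J) hx) ((suppIn_mul hM).1 hs).2 rfl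
      exact ⟨FreeMonoid.of J * u, by rw [wordFixed_mul, wordFixed_of, hu]⟩

variable (hsph : (M.fixedMatrix G).IsSpherical)
include hsph

/-- If `Γ'` is spherical, words with the same value in `(B⁺)^G` have the same value in the
Artin-Tits group of `Γ'`. -/
theorem wordGroup_eq_of_wordFixed_eq {u v : FreeMonoid (M.SphericalOrbit G)}
    (h : (wordFixed hM G u).1 = (wordFixed hM G v).1) : wordGroup G u = wordGroup G v := by
  have hne : ∀ (J : M.SphericalOrbit G) (u : FreeMonoid (M.SphericalOrbit G)),
      0 < alen (wordFixed hM G (FreeMonoid.of J * u)).1 := by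
    intro J u
    rw [wordFixed_mul, wordFixed_of, alen_mul]
    have := (garsideData_orbit hM J).alen_pos J.nonempty
    omega
  induction hn : alen (wordFixed hM G u).1 using Nat.strong_induction_on generalizing u v with
  | _ n ih =>
    subst hn
    induction u using FreeMonoid.casesOn with
    | one =>
      induction v using FreeMonoid.casesOn with
      | one => rfl
      | of_mul K v =>
        have := hne K v
        rw [← h, map_one] at this
        exact absurd this (lt_irrefl _)
    | of_mul J u =>
      induction v using FreeMonoid.casesOn with
      | one =>
        have := hne J u
        rw [h, map_one] at this
        exact absurd this (lt_irrefl _)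
      | of_mul K v =>
        have hJpos := (garsideData_orbit hM J).alen_pos J.nonempty
        have hKpos := (garsideData_orbit hM K).alen_pos K.nonempty
        have hl := congrArg alen h
        -- The induction hypothesis after cancelling a common first letter in `B⁺`.
        have hcancel : ∀ {L : M.SphericalOrbit G} {s t : FreeMonoid (M.SphericalOrbit G)},
            alen (wordFixed hM G (FreeMonoid.of L * s)).1 =
              alen (wordFixed hM G (FreeMonoid.of J * u)).1 →
            (wordFixed hM G (FreeMonoid.of L * s)).1 = (wordFixed hM G (FreeMonoid.of L * t)).1 →
            wordGroup G (FreeMonoid.of L * s) = wordGroup G (FreeMonoid.of L * t) := by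
          intro L s t hls hst
          have hLpos := (garsideData_orbit hM L).alen_pos L.nonempty
          rw [wordFixed_mul, wordFixed_mul] at hst
          rw [map_mul, map_mul, ih (alen (wordFixed hM G s).1) ?_
            (artin_mul_left_cancel hM hst) rfl]
          rw [← hls, wordFixed_mul, alen_mul, wordFixed_of]
          omega
        by_cases hJK : J = K
        · subst hJK
          exact hcancel rfl h
        -- The common value is divisible by `Δ_J` and `Δ_K`, hence by `Δ_{J ∪ K}`, and the quotient
        -- is the value of a word `t`. Each given word is then compared with the alternating word
        -- with its own first letter followed by `t`; these two agree in the group by its defining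
        -- relation.
        have hD : GarsideData hM (J.1 ∪ K.1) (M.garside (J.1 ∪ K.1)) := by
          have := garsideData_orbitUnion hM hsph {J, K}
          rwa [show orbitUnion {J, K} = J.1 ∪ K.1 by ext; simp [orbitUnion]] at this
        obtain ⟨h2, hm⟩ := altProd_fixedMatrix_eq hM hJK hD
        have hD' : GarsideData hM (K.1 ∪ J.1) (M.garside (J.1 ∪ K.1)) := by
          rwa [Set.union_comm]
        obtain ⟨-, hm'⟩ := altProd_fixedMatrix_eq hM (Ne.symm hJK) hD'
        rw [(M.fixedMatrix G).symmetric] at hm'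
        obtain ⟨z, hz⟩ := hD.isGarside.2 (wordFixed hM G (FreeMonoid.of J * u)).1 (by
          rintro j (hj | hj)
          · refine ((garsideData_orbit hM J).isGarside.1 j hj).trans ?_
            rw [wordFixed_mul, wordFixed_of]
            exact Dvd.intro _ rfl
          · refine ((garsideData_orbit hM K).isGarside.1 j hj).trans ?_
            rw [h, wordFixed_mul, wordFixed_of]
            exact Dvd.intro _ rfl)
        have hzG : z ∈ M.fixedMonoid G := by
          refine mem_fixedMonoid_of_mul hM (x := M.garside (J.1 ∪ K.1)) ?_
            (hz ▸ (wordFixed hM G (FreeMonoid.of J * u)).2)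
          exact hD.isGarside.mem_fixedMonoid (J.stableSet.union K.stableSet)
        have hzs : SuppIn hM (orbitUnion (Set.univ : Set (M.SphericalOrbit G))) z := by
          have := suppIn_wordFixed hM (FreeMonoid.of J * u)
          rw [hz, suppIn_mul] at this
          exact this.2
        obtain ⟨t, rfl⟩ := exists_wordFixed_eq hM hzG hzs
        obtain ⟨k, hk⟩ : ∃ k, M.fixedMatrix G J K = k + 1 := ⟨_, (Nat.sub_add_cancel (by omega)).symm⟩
        have e1 : wordGroup G (FreeMonoid.of J * u) =
            wordGroup G (altProd (FreeMonoid.of J) (FreeMonoid.of K) (M.fixedMatrix G J K) * t) := by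
          rw [hk, altProd_succ, mul_assoc]
          refine hcancel rfl ?_
          rw [hz, ← mul_assoc, ← altProd_succ, ← hk, wordFixed_mul, wordFixed_altProd, hm]
        have e2 : wordGroup G (FreeMonoid.of K * v) =
            wordGroup G (altProd (FreeMonoid.of K) (FreeMonoid.of J) (M.fixedMatrix G J K) * t) := by
          rw [hk, altProd_succ, mul_assoc]
          refine hcancel hl.symm ?_
          rw [← h, hz, ← mul_assoc, ← altProd_succ, ← hk, wordFixed_mul, wordFixed_altProd, hm']
        rw [e1, e2, map_mul, map_mul, map_altProd, map_altProd, wordGroup_of, wordGroup_of,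
          altProd_artinGroupGen]

include hM in
-- Both words divide one power of the Garside element of the union of all spherical orbits. The
-- complements are fixed by `G`, hence are words again.
theorem exists_common_multiple (u v : FreeMonoid (M.SphericalOrbit G)) :
    ∃ u' v', wordGroup G (u * u') = wordGroup G (v * v') := by
  have hD := garsideData_orbitUnion hM hsph (Set.univ : Set (M.SphericalOrbit G))
  set D := M.garside (orbitUnion (Set.univ : Set (M.SphericalOrbit G)))
  have hDG : D ∈ M.fixedMonoid G := hD.isGarside.mem_fixedMonoid (stableSet_orbitUnion _)
  have key : ∀ (n : ℕ) (u : FreeMonoid (M.SphericalOrbit G)), alen (wordFixed hM G u).1 ≤ n →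
      ∃ u', (wordFixed hM G (u * u')).1 = D ^ n := by
    intro n u hn
    obtain ⟨x, hx⟩ := (hD.dvd_pow (suppIn_wordFixed hM u)).trans (pow_dvd_pow D hn)
    have hpow : SuppIn hM (orbitUnion (Set.univ : Set (M.SphericalOrbit G))) (D ^ n) := by
      rw [SuppIn, map_pow, hD.suppIn, one_pow]
    obtain ⟨u', hu'⟩ := exists_wordFixed_eq hM (x := x)
      (mem_fixedMonoid_of_mul hM (wordFixed hM G u).2 (hx ▸ pow_mem hDG n))
      (by rw [hx, suppIn_mul] at hpow; exact hpow.2)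
    exact ⟨u', by rw [wordFixed_mul, hu', hx]⟩
  obtain ⟨u', hu'⟩ := key (max _ _) u (le_max_left _ (alen (wordFixed hM G v).1))
  obtain ⟨v', hv'⟩ := key (max _ _) v (le_max_right (alen (wordFixed hM G u).1) _)
  exact ⟨u', v', wordGroup_eq_of_wordFixed_eq hM hsph (hu'.trans hv'.symm)⟩

include hM in
/-- If `Γ'` is spherical, its Artin-Tits group consists of fractions. -/
theorem exists_fraction (g : (M.fixedMatrix G).ArtinGroup) :
    ∃ u v, g = wordGroup G u * (wordGroup G v)⁻¹ := by
  have hg : g ∈ Subgroup.closure (Set.range (M.fixedMatrix G).artinGroupGen) := by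
    have := PresentedGroup.closure_range_of {r : FreeGroup (M.SphericalOrbit G) |
      ∃ i j, M.fixedMatrix G i j ≠ 0 ∧
        r = altProd (FreeGroup.of i) (FreeGroup.of j) (M.fixedMatrix G i j) *
          (altProd (FreeGroup.of j) (FreeGroup.of i) (M.fixedMatrix G i j))⁻¹}
    have h2 : g ∈ (⊤ : Subgroup (M.fixedMatrix G).ArtinGroup) := trivial
    rw [← this] at h2
    exact h2
  induction hg using Subgroup.closure_induction_left with
  | one => exact ⟨1, 1, by simp⟩
  | mul_left x hx y _ ih =>
    obtain ⟨J, rfl⟩ := hx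
    obtain ⟨u, v, rfl⟩ := ih
    exact ⟨FreeMonoid.of J * u, v, by rw [map_mul, wordGroup_of, mul_assoc]⟩
  | inv_mul_cancel x hx y _ ih =>
    obtain ⟨J, rfl⟩ := hx
    obtain ⟨u, v, rfl⟩ := ih
    obtain ⟨s, t, hst⟩ := exists_common_multiple hM hsph (FreeMonoid.of J) u
    refine ⟨s, v * t, ?_⟩
    rw [map_mul, map_mul, wordGroup_of] at hst
    rw [map_mul, mul_inv_rev, inv_mul_eq_iff_eq_mul, ← mul_assoc, hst, ← mul_assoc,
      mul_inv_cancel_right]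

end FixedGroup

end CoxeterMatrix

namespace CoxeterMatrix

/-! ### The group representation over an overring. -/

section GroupRepresentation

variable {I : Type*} [Fintype I] [DecidableEq I] {M : CoxeterMatrix I} (hM : M.IsSmallType)
variable {R : Type*} [CommRing R] {b c d : Rˣ} {f : I → Module.Dual R (M.LKModule R)}
variable {G : Subgroup M.graphAut}

theorem altProd_garside_eq (J K : M.SphericalOrbit G) (h : M.fixedMatrix G J K ≠ 0) :
    altProd (M.garside J.1) (M.garside K.1) (M.fixedMatrix G J K) =
      altProd (M.garside K.1) (M.garside J.1) (M.fixedMatrix G J K) := by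
  by_cases hJK : J = K
  · rw [hJK]
  · have e : M.fixedMatrix G J K = sInf {m : ℕ | 2 ≤ m ∧
        altProd (M.garside J.1) (M.garside K.1) m =
          altProd (M.garside K.1) (M.garside J.1) m} := if_neg hJK
    rw [e] at h ⊢
    exact (Nat.sInf_mem (Nat.nonempty_of_pos_sInf (Nat.pos_of_ne_zero h))).2

/-- The operator of a Garside element of a spherical orbit, as an automorphism of `V^G`. -/
noncomputable def garsideUnit (hf : M.IsLKFamily b c d f) (hG : M.IsInvariantFamily G f)
    (hu : ∀ i, IsUnit (f i (M.rootVec R (simpleVec i)))) (J : M.SphericalOrbit G) :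
    LinearMap.GeneralLinearGroup R (M.fixedModule R G) :=
  ((Module.End.isUnit_iff (twistedRep hM hf hG ⟨_, garside_mem_fixedMonoid hM J⟩)).2
    ⟨twistedRep_injective_apply hM hf hG (fun i _ hr => (hu i).mul_left_eq_zero.1 hr) _,
      twistedRep_surjective_apply hM hf hG hu _⟩).unit

theorem altProd_garsideUnit (hf : M.IsLKFamily b c d f) (hG : M.IsInvariantFamily G f)
    (hu : ∀ i, IsUnit (f i (M.rootVec R (simpleVec i)))) (J K : M.SphericalOrbit G) (n : ℕ)
    (h : altProd (M.garside J.1) (M.garside K.1) n = altProd (M.garside K.1) (M.garside J.1) n) :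
    altProd (garsideUnit hM hf hG hu J) (garsideUnit hM hf hG hu K) n =
      altProd (garsideUnit hM hf hG hu K) (garsideUnit hM hf hG hu J) n := by
  refine Units.ext ?_
  have e1 := fun J K => map_altProd (Units.coeHom (Module.End R (M.fixedModule R G)))
    (garsideUnit hM hf hG hu J) (garsideUnit hM hf hG hu K) n
  have e2 := fun J K : M.SphericalOrbit G => map_altProd (twistedRep hM hf hG)
    ⟨_, garside_mem_fixedMonoid hM J⟩ ⟨_, garside_mem_fixedMonoid hM K⟩ n
  have e3 := fun J K : M.SphericalOrbit G => map_altProd (M.fixedMonoid G).subtype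
    ⟨_, garside_mem_fixedMonoid hM J⟩ ⟨_, garside_mem_fixedMonoid hM K⟩ n
  refine (e1 J K).trans (.trans ?_ (e1 K J).symm)
  refine (e2 J K).symm.trans (.trans ?_ (e2 K J))
  exact congrArg _ (Subtype.ext ((e3 J K).trans (h.trans (e3 K J).symm)))

/-- The representation of the Artin-Tits group of `Γ'` on `V^G`. -/
noncomputable def twistedGroupRep (hf : M.IsLKFamily b c d f) (hG : M.IsInvariantFamily G f)
    (hu : ∀ i, IsUnit (f i (M.rootVec R (simpleVec i)))) :
    (M.fixedMatrix G).ArtinGroup →* LinearMap.GeneralLinearGroup R (M.fixedModule R G) :=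
  PresentedGroup.toGroup (f := garsideUnit hM hf hG hu) (by
    rintro _ ⟨J, K, h, rfl⟩
    rw [map_mul, map_inv, map_altProd, map_altProd, FreeGroup.lift_apply_of,
      FreeGroup.lift_apply_of,
      altProd_garsideUnit hM hf hG hu J K _ (altProd_garside_eq J K h), mul_inv_cancel])

theorem twistedGroupRep_gen (hf : M.IsLKFamily b c d f) (hG : M.IsInvariantFamily G f)
    (hu : ∀ i, IsUnit (f i (M.rootVec R (simpleVec i)))) (J : M.SphericalOrbit G) :
    twistedGroupRep hM hf hG hu ((M.fixedMatrix G).artinGroupGen J) =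
      garsideUnit hM hf hG hu J :=
  PresentedGroup.toGroup.of _

theorem isTwistedGroupRep_twistedGroupRep (hf : M.IsLKFamily b c d f)
    (hG : M.IsInvariantFamily G f) (hu : ∀ i, IsUnit (f i (M.rootVec R (simpleVec i)))) :
    M.IsTwistedGroupRep G (psiRep hM hf) (twistedGroupRep hM hf hG hu) := by
  intro J v
  rw [twistedGroupRep_gen]
  rfl

theorem twistedGroupRep_wordGroup (hf : M.IsLKFamily b c d f) (hG : M.IsInvariantFamily G f)
    (hu : ∀ i, IsUnit (f i (M.rootVec R (simpleVec i)))) (u : FreeMonoid (M.SphericalOrbit G)) :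
    (twistedGroupRep hM hf hG hu (wordGroup G u) : Module.End R (M.fixedModule R G)) =
      twistedRep hM hf hG (wordFixed hM G u) := by
  refine DFunLike.congr_fun (f := (Units.coeHom (Module.End R (M.fixedModule R G))).comp
    ((twistedGroupRep hM hf hG hu).comp (wordGroup G)))
    (g := (twistedRep hM hf hG).comp (wordFixed hM G)) (FreeMonoid.hom_eq fun J => ?_) u
  simp only [MonoidHom.comp_apply, wordGroup_of, twistedGroupRep_gen]
  have e : wordFixed hM G (FreeMonoid.of J) = ⟨_, garside_mem_fixedMonoid hM J⟩ :=
    Subtype.ext (wordFixed_of hM J)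
  rw [e]
  rfl

/-- If `Γ'` is spherical and the scalars `R` embed into `S`, then the faithfulness of the monoid
representation over `R` gives that of the group representation over `S`. -/
theorem twistedGroupRep_injective {S : Type*} [CommRing S] (h : R →+* S)
    (hh : Function.Injective h) (hf : M.IsLKFamily b c d f) (hG : M.IsInvariantFamily G f)
    (hinj : Function.Injective (twistedRep hM hf hG))
    {f' : I → Module.Dual S (M.LKModule S)}
    (hff' : ∀ i, ∀ v ∈ M.posRoots, f' i (M.rootVec S v) = h (f i (M.rootVec R v)))
    (hf' : M.IsLKFamily (Units.map (h : R →* S) b) (Units.map (h : R →* S) c)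
      (Units.map (h : R →* S) d) f') (hG' : M.IsInvariantFamily G f')
    (hu : ∀ i, IsUnit (f' i (M.rootVec S (simpleVec i))))
    (hsph : (M.fixedMatrix G).IsSpherical) :
    Function.Injective (twistedGroupRep hM hf' hG' hu) := by
  refine (injective_iff_map_eq_one _).2 fun g hg => ?_
  obtain ⟨u, v, rfl⟩ := exists_fraction hM hsph g
  rw [map_mul, map_inv, mul_inv_eq_one] at hg
  have hg' := congrArg Units.val hg
  rw [twistedGroupRep_wordGroup, twistedGroupRep_wordGroup] at hg'
  rw [mul_inv_eq_one]
  -- For `g = u v⁻¹` in the kernel the operators of `u` and `v` agree over `S`. They agree on the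
  -- image of `V^G`, hence over `R`, where the monoid representation is faithful.
  refine wordGroup_eq_of_wordFixed_eq hM hsph (congrArg Subtype.val (hinj ?_))
  refine LinearMap.ext fun x => Subtype.ext (baseMap_injective h hh ?_)
  rw [twistedRep_apply, twistedRep_apply, baseMap_psiRep hM h hf hf' hff',
    baseMap_psiRep hM h hf hf' hff']
  exact congrArg Subtype.val
    (LinearMap.congr_fun hg' ⟨M.baseMap h x, baseMap_mem_fixedModule h x.2⟩)

theorem extendFamily_rootVec (S : Type*) [CommRing S] [Algebra R S] (i : I) {v : I → ℝ}
    (hv : v ∈ M.posRoots) :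
    M.extendFamily S f i (M.rootVec S v) = algebraMap R S (f i (M.rootVec R v)) := by
  rw [← basisVec_eq_rootVec (M := M) (R := S) ⟨v, hv⟩,
    ← basisVec_eq_rootVec (M := M) (R := R) ⟨v, hv⟩, extendFamily, basisVec,
    Finsupp.linearCombination_single, one_smul]

end GroupRepresentation

/-! ### The case of polynomial scalars. -/

section Polynomial

variable {I : Type*} [Fintype I] [DecidableEq I] {M : CoxeterMatrix I} (hM : M.IsSmallType)
variable {G : Subgroup M.graphAut}

/-- Evaluation at `0` kills the multiples of `X`, and `a = d - b c / d` stays positive because `b c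
< d²`. As `R₀[X]` has no zero divisors, nonzero `f_i(e_{α_i})` give injective operators and so left
cancellation. -/
theorem twistedRep_injective_of_polynomial {R₀ : Type*} [CommRing R₀] [LinearOrder R₀]
    [IsStrictOrderedRing R₀] {b c d : R₀ˣ}
    {f : I → Module.Dual (Polynomial R₀) (M.LKModule (Polynomial R₀))}
    (hb : (0 : R₀) < b) (hc : (0 : R₀) < c) (hd : (0 : R₀) < d)
    (hbcd : (b : R₀) * c < (d : R₀) ^ 2)
    (hf : M.IsLKFamily (constUnit b) (constUnit c) (constUnit d) f)
    (hG : M.IsInvariantFamily G f) (hX : ∀ i v, (Polynomial.X : Polynomial R₀) ∣ f i v)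
    (hne : ∀ i, f i (M.basisVec (M.simpleRoot i)) ≠ 0) :
    Function.Injective (twistedRep hM hf hG) := by
  have hunit : ∀ u : R₀ˣ, Polynomial.evalRingHom 0 (constUnit u : Polynomial R₀) = u := fun u => by
    simp [constUnit]
  refine twisted_injective hM hf hG (isLeftCancelMul_mrange_twistedRep hM hf hG fun i r hr => ?_)
    (Polynomial.evalRingHom 0) ?_ (by rwa [hunit]) (by rwa [hunit]) (by rwa [hunit])
    fun i α => ?_
  · rw [← basisVec_simpleRoot] at hr
    exact (mul_eq_zero.1 hr).resolve_right (hne i)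
  · have hdd : (d : R₀) * ((d⁻¹ : R₀ˣ) : R₀) = 1 := d.mul_inv
    have hd' : (0 : R₀) < ((d⁻¹ : R₀ˣ) : R₀) := pos_of_mul_pos_right (hdd ▸ one_pos) hd.le
    have hinv : Polynomial.evalRingHom 0 (((constUnit d)⁻¹ : (Polynomial R₀)ˣ) : Polynomial R₀) =
        ((d⁻¹ : R₀ˣ) : R₀) := by
      rw [constUnit, ← map_inv]
      exact hunit d⁻¹
    rw [lkParam, map_sub, map_mul, map_mul, hunit, hunit, hunit, hinv]
    have := mul_lt_mul_of_pos_right hbcd hd'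
    rw [pow_two, mul_assoc (d : R₀), hdd, mul_one] at this
    exact sub_pos.2 this
  · obtain ⟨p, hp⟩ := hX i (M.basisVec α)
    rw [hp, map_mul]
    simp

end Polynomial

end CoxeterMatrix

theorem mainTheorem2 {I : Type*} [Fintype I] [DecidableEq I] (M : CoxeterMatrix I)
    (hM : M.IsSmallType) (G : Subgroup M.graphAut) :
    -- the criterion
    (∀ (R : Type*) [CommRing R] (b c d : Rˣ) (f : I → Module.Dual R (M.LKModule R)),
      M.IsLKFamily b c d f → M.IsInvariantFamily G f →
      ∃ (ψ : M.ArtinMonoid →* Module.End R (M.LKModule R))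
        (ρ : M.fixedMonoid G →* Module.End R (M.fixedModule R G)),
        M.IsLKRep b c d f ψ ∧ M.IsTwistedRep G ψ ρ ∧
        (IsLeftCancelMul (MonoidHom.mrange ρ) →
          ∀ (R₀ : Type*) [CommRing R₀] [LinearOrder R₀] [IsStrictOrderedRing R₀] (h : R →+* R₀),
            0 < h (CoxeterMatrix.lkParam b c d) → 0 < h b → 0 < h c → 0 < h d →
            (∀ (i : I) (α : M.PosRoot), h (f i (M.basisVec α)) = 0) →
            Function.Injective ρ)) ∧
    -- the typical situation over `R₀[X]`
    (∀ (R₀ : Type*) [CommRing R₀] [LinearOrder R₀] [IsStrictOrderedRing R₀] (b c d : R₀ˣ)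
      (f : I → Module.Dual (Polynomial R₀) (M.LKModule (Polynomial R₀))),
      (0 : R₀) < b → (0 : R₀) < c → (0 : R₀) < d → (b : R₀) * c < (d : R₀) ^ 2 →
      M.IsLKFamily (CoxeterMatrix.constUnit b) (CoxeterMatrix.constUnit c) (CoxeterMatrix.constUnit d) f → M.IsInvariantFamily G f →
      (∀ i v, (Polynomial.X : Polynomial R₀) ∣ f i v) →
      (∀ i, f i (M.basisVec (M.simpleRoot i)) ≠ 0) →
      -- `ψ^G` is faithful
      (∃ (ψ : M.ArtinMonoid →* Module.End (Polynomial R₀) (M.LKModule (Polynomial R₀)))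
        (ρ : M.fixedMonoid G →*
          Module.End (Polynomial R₀) (M.fixedModule (Polynomial R₀) G)),
        M.IsLKRep (CoxeterMatrix.constUnit b) (CoxeterMatrix.constUnit c) (CoxeterMatrix.constUnit d) f ψ ∧ M.IsTwistedRep G ψ ρ ∧ Function.Injective ρ) ∧
      -- `ψ^G_gr` is defined over every overring `R'` in which the `f_i(e_{α_i})` become units,
      -- and it is faithful if `Γ'` is spherical
      ∀ (R' : Type*) [CommRing R'] [Algebra (Polynomial R₀) R'],
        Function.Injective (algebraMap (Polynomial R₀) R') →
        (∀ i, IsUnit (algebraMap (Polynomial R₀) R' (f i (M.basisVec (M.simpleRoot i))))) →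
        ∃ (ψ' : M.ArtinMonoid →* Module.End R' (M.LKModule R'))
          (ρ' : (M.fixedMatrix G).ArtinGroup →*
            LinearMap.GeneralLinearGroup R' (M.fixedModule R' G)),
          M.IsLKRep (CoxeterMatrix.extendUnit R' (CoxeterMatrix.constUnit b)) (CoxeterMatrix.extendUnit R' (CoxeterMatrix.constUnit c))
            (CoxeterMatrix.extendUnit R' (CoxeterMatrix.constUnit d)) (M.extendFamily R' f) ψ' ∧
          M.IsTwistedGroupRep G ψ' ρ' ∧
          ((M.fixedMatrix G).IsSpherical → Function.Injective ρ')) := by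
  refine ⟨fun R _ b c d f hf hG => ⟨CoxeterMatrix.psiRep hM hf, CoxeterMatrix.twistedRep hM hf hG,
    CoxeterMatrix.psiRep_gen hM hf, fun _ _ => rfl, fun hcancel R₀ _ _ _ h ha hb hc hd hf0 =>
      CoxeterMatrix.twisted_injective hM hf hG hcancel h ha hb hc hd hf0⟩,
    fun R₀ _ _ _ b c d f hb hc hd hbcd hf hG hX hne => ?_⟩
  have hinj := CoxeterMatrix.twistedRep_injective_of_polynomial hM hb hc hd hbcd hf hG hX hne
  refine ⟨⟨CoxeterMatrix.psiRep hM hf, CoxeterMatrix.twistedRep hM hf hG,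
    CoxeterMatrix.psiRep_gen hM hf, fun _ _ => rfl, hinj⟩, fun R' _ _ hR' hunit => ?_⟩
  have hff' : ∀ i, ∀ v ∈ M.posRoots, M.extendFamily R' f i (M.rootVec R' v) =
      algebraMap (Polynomial R₀) R' (f i (M.rootVec (Polynomial R₀) v)) :=
    fun i _ hv => CoxeterMatrix.extendFamily_rootVec R' i hv
  have hf' := CoxeterMatrix.isLKFamily_baseChange hM (algebraMap (Polynomial R₀) R') hf hff'
  have hG' := CoxeterMatrix.isInvariantFamily_baseChange (algebraMap (Polynomial R₀) R') hG hff'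
  have hu : ∀ i, IsUnit (M.extendFamily R' f i (M.rootVec R' (CoxeterMatrix.simpleVec i))) := by
    intro i
    rw [hff' i _ (CoxeterMatrix.simpleVec_mem_posRoots i), ← CoxeterMatrix.basisVec_simpleRoot]
    exact hunit i
  exact ⟨CoxeterMatrix.psiRep hM hf', CoxeterMatrix.twistedGroupRep hM hf' hG' hu,
    CoxeterMatrix.psiRep_gen hM hf', CoxeterMatrix.isTwistedGroupRep_twistedGroupRep hM hf' hG' hu,
    CoxeterMatrix.twistedGroupRep_injective hM _ hR' hf hG hinj hff' hf' hG' hu⟩
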